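/- **Model.** For every number of antennas $L\ge 1$ consider a broadcast channel with $m=m(L)$ users labelled by initial natural numbers, and a (deterministic) set $A_{\mathrm{on}}=A_{\mathrm{on}}(L)$ of $s=s(L)$ of these users, the on-users. User $i$ has a path loss coefficient $\gamma_i\ge 0$ and $R_i=R_i(L)\in\mathbb{N}$ feedback bits; $\rho\ge 0$ is the total power. For every on-user $i$: * the channel state $\mathbf h_i\in\mathbb{C}^L$ has i.i.d. $\mathcal{CN}(0,1)$ entries; $\mathbf v_i=\mathbf h_i/\|\mathbf h_i\|$ is its direction; * the codebook $\mathcal B_i$ consists of $2^{R_i}$ random vectors, each uniformly distributed on the unit sphere of $\mathbb{C}^L$; * $\mathbf p_i\in\mathcal B_i$ maximises $|\mathbf v_i^\dagger\mathbf p|$ over $\mathbf p\in\mathcal B_i$ (ties are broken arbitrarily). For each $L$, the directions $\mathbf v_i$ $(i\in A_{\mathrm{on}})$ and all the codewords of all the codebooks $\mathcal B_i$ $(i\in A_{\mathrm{on}})$ are mutually independent. All these random vectors, for all $L$, live on one probability space; nothing is assumed about the dependence between different values of $L$. The zero-forcing beamforming vector of $i\in A_{\mathrm{on}}$ is $\mathbf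 q_i=\Pi_i\mathbf p_i/\|\Pi_i\mathbf p_i\|$ ($\mathbf q_i=0$ if $\Pi_i\mathbf p_i=0$), where $\Pi_i$ is the orthogonal projection of $\mathbb{C}^L$ onto the orthogonal complement of $\operatorname{span}\{\mathbf p_j: j\in A_{\mathrm{on}}\setminus\{i\}\}$. The signal power, interference power and rate of $i\in A_{\mathrm{on}}$ are $$P_{\mathrm{sig},i}=\frac{\rho}{s}\gamma_i|\mathbf h_i^\dagger\mathbf q_i|^2,\qquad P_{\mathrm{int},i}=\frac{\rho}{s}\gamma_i\sum_{j\in A_{\mathrm{on}}\setminus\{i\}}|\mathbf h_i^\dagger\mathbf q_j|^2,\qquad \mathcal I_i=\log_2\Bigl(1+\frac{P_{\mathrm{sig},i}}{1+P_{\mathrm{int},i}}\Bigr).$$ **Proposition.** Let $L\to\infty$ with $m/L\to\bar m$, $s/L\to\bar s\in(0,1)$ and $R_i/L\to\bar r_i\in\mathbb{R}$ for every $i$. Then for every user $i$, with probability one, as $L\to\infty$ through those $L$ for which $i\in A_{\mathrm{on}}$, $$P_{\mathrm{sig},i}\to\frac{\rho}{\bar s}\gamma_i(1-2^{-\bar r_i})(1-\bar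 s),\qquad P_{\mathrm{int},i}\to\rho\gamma_i2^{-\bar r_i},\qquad \mathcal I_i\to\log_2\Bigl(1+\eta_i\frac{1-\bar s}{\bar s}\Bigr),$$ where $\eta_i=\dfrac{\rho\gamma_i(1-2^{-\bar r_i})}{1+\rho\gamma_i2^{-\bar r_i}}$. -/

import Mathlib

open MeasureTheory ProbabilityTheory Filter Topology
open scoped NNReal ENNReal

noncomputable section

/-- Complex column vectors with `L` entries, with the Hermitian inner product
`inner ℂ x y = x† y` and the Euclidean norm. -/
abbrev CVec (L : ℕ) : Type := EuclideanSpace ℂ (Fin L)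

/-- The law `CN(0,1)` on `ℂ`: independent real and imaginary parts, each `N(0,1/2)`. -/
def complexNormal : Measure ℂ :=
  ((gaussianReal 0 (1 / 2)).prod (gaussianReal 0 (1 / 2))).map
    (fun z : ℝ × ℝ => (⟨z.1, z.2⟩ : ℂ))

/-- Rayleigh fading: the entries of the random vector `h` are i.i.d. `CN(0,1)`. -/
def IsRayleigh {Ω : Type*} [MeasurableSpace Ω] (P : Measure Ω) {L : ℕ} (h : Ω → CVec L) : Prop :=
  (∀ k : Fin L, HasLaw (fun ω => h ω k) complexNormal P) ∧
    iIndepFun (fun (k : Fin L) ω => h ω k) P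

/-- The isotropic distribution: the uniform probability distribution (normalised surface measure)
on the unit sphere of `ℂ^L`, regarded as a measure on `ℂ^L`. It is meant for `L ≥ 1`. -/
def isotropicLaw (L : ℕ) : Measure (CVec L) :=
  (((volume : Measure (CVec L)).toSphere Set.univ)⁻¹ •
    (volume : Measure (CVec L)).toSphere).map Subtype.val

/-- The unit vector `x / ‖x‖` in the direction of `x` (and `0` if `x = 0`). -/
def direction {L : ℕ} (x : CVec L) : CVec L := ((‖x‖⁻¹ : ℝ) : ℂ) • x

/-- `p` is a quantisation of the channel state `h` with the codebook `B`: a codeword that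
maximises `|v† p|`, where `v = h / ‖h‖` (any choice among several maximisers is allowed). -/
def IsQuantization {L N : ℕ} (B : Fin N → CVec L) (h p : CVec L) : Prop :=
  p ∈ Set.range B ∧
    ∀ b ∈ Set.range B, ‖inner ℂ (direction h) b‖ ≤ ‖inner ℂ (direction h) p‖

/-- Zero-forcing beamforming vector of user `i` when the users in `A` are on and `p j` is the
quantised channel of user `j`: the normalised orthogonal projection of `p i` onto the orthogonal
complement of the span of the `p j`, `j ∈ A \ {i}`. -/
def zfBeam {L : ℕ} (A : Finset ℕ) (p : ℕ → CVec L) (i : ℕ) : CVec L :=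
  direction ((Submodule.span ℂ (p '' {j | j ∈ A ∧ j ≠ i}))ᗮ.starProjection (p i))

/-- Signal power of user `i`: `(ρ / s) γ |h† q_i|²`, where `s = |A|` and `h` is the channel of
user `i`. -/
def signalPower {L : ℕ} (ρ γ : ℝ) (A : Finset ℕ) (h : CVec L) (p : ℕ → CVec L) (i : ℕ) : ℝ :=
  ρ / (A.card : ℝ) * γ * ‖inner ℂ h (zfBeam A p i)‖ ^ 2

/-- Interference power of user `i`: `(ρ / s) γ ∑_{j ∈ A \ {i}} |h† q_j|²`. -/
def interferencePower {L : ℕ} (ρ γ : ℝ) (A : Finset ℕ) (h : CVec L) (p : ℕ → CVec L)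
    (i : ℕ) : ℝ :=
  ρ / (A.card : ℝ) * γ * ∑ j ∈ A.erase i, ‖inner ℂ h (zfBeam A p j)‖ ^ 2

/-- Rate of user `i` in bits: `log₂ (1 + P_sig / (1 + P_int))`. -/
def userRate {L : ℕ} (ρ γ : ℝ) (A : Finset ℕ) (h : CVec L) (p : ℕ → CVec L) (i : ℕ) : ℝ :=
  Real.logb 2 (1 + signalPower ρ γ A h p i / (1 + interferencePower ρ γ A h p i))

/-- `η = ρ γ (1 - 2^{-r}) / (1 + ρ γ 2^{-r})`. -/
def etaZF (ρ γ r : ℝ) : ℝ :=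
  ρ * γ * (1 - (2 : ℝ) ^ (-r)) / (1 + ρ * γ * (2 : ℝ) ^ (-r))

end

/-!
The limits are those of three deterministic approximations, each of which fails with summable
probability as the number `n` of antennas grows; the Borel–Cantelli lemma in the form
`ae_tendsto_zero_of_summable_tail`, applied for countably many tolerances, then gives almost sure
convergence without any assumption on the dependence between different numbers of antennas.

Fix the user `i` with channel direction `v` and quantised channel `p`, and let `x` be the family of
the quantised channels of the other on-users. A quantised isotropic direction is again isotropic
(`codebookLaw_map_quantize`), because its law is invariant under unitary maps, and ties between
codewords are null (`ae_codebookLaw_injective`). Hence the `x j` are independent isotropic vectors,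
independent of `(v, p)` (`hasLaw_codebook_quantized`), and it is enough to bound error probabilities
for *fixed* unit vectors `v` and `p` (`real_le_of_forall_unit`).

* Quantisation. For a fixed codeword `c` the probability of `|v† c|² > y` is `(1 - y) ^ (n - 1)`,
  so among `2 ^ R` independent codewords the best one has `|v† p|²` close to `1 - 2 ^ (-R / n)`.
  The two sides are `codebookLaw_quantize_gt_le` and `codebookLaw_quantize_le_le`.
* Signal. The projection `Π` to the orthogonal complement of the `x j` has an almost uniformly
  distributed range of relative dimension `1 - s / n`, so `‖Π u‖² ≈ (1 - s / n) ‖u‖²` for fixed `u`,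
  and by polarisation `v† Π p ≈ (1 - s / n) v† p` (`pi_inner_perpProj_tail`). The signal is governed
  by `|v† Π p|² / ‖Π p‖²`, whose limit is therefore `(1 - 2 ^ (-r)) (1 - s / n)`.
* Interference. The beams `qⱼ` of the other users are orthogonal to `p`, so only the component `z`
  of `v` orthogonal to `p` matters, with `‖z‖² = 1 - |v† p|²`. The law of the beams is invariant
  under the unitary maps that fix `p`; the direction of `z` may thus be replaced by a random one,
  namely by a projected Gaussian vector that is independent of the beams. Then `∑ⱼ |z† qⱼ|²` is a
  Hermitian form in a Gaussian vector, and it concentrates once the Hilbert–Schmidt norm of the Gram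
  matrix of the beams is `o(n)`. The angle between two beams is controlled by the angle between the
  two channels after projecting out all others (`sq_norm_inner_beams_le`), which are independent
  isotropic vectors there. This gives `pi_sum_sq_inner_beam_tail`.

Both arguments exchange a fixed direction for a random one through `le_of_slice_eq_of_slice_le`. All
concentration estimates come from one Chernoff bound for weighted sums of independent exponential
variables, `gaussian_quadratic_tail`. Together with `‖h‖² / n → 1` they give the limits of the signal
and interference powers, and the rate is a continuous function of these.
-/

/-! ### The complex Gaussian law -/

instance isProbabilityMeasure_complexNormal : IsProbabilityMeasure complexNormal := by
  unfold complexNormal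
  exact Measure.isProbabilityMeasure_map
    (Complex.measurableEquivRealProd.symm.measurable.aemeasurable)

theorem complexNormal_eq_withDensity :
    complexNormal =
      volume.withDensity (fun z : ℂ => ENNReal.ofReal (Real.pi⁻¹ * Real.exp (-‖z‖ ^ 2))) := by
  have hv : (1 / 2 : ℝ≥0) ≠ 0 := by norm_num
  have hmeas : Measurable
      (fun z : ℂ => ENNReal.ofReal (Real.pi⁻¹ * Real.exp (-‖z‖ ^ 2))) := by fun_prop
  have key : (gaussianReal 0 (1 / 2)).prod (gaussianReal 0 (1 / 2)) =
      (volume : Measure (ℝ × ℝ)).withDensity (fun x => ENNReal.ofReal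
        (Real.pi⁻¹ * Real.exp (-‖Complex.measurableEquivRealProd.symm x‖ ^ 2))) := by
    rw [gaussianReal_of_var_ne_zero _ hv,
      prod_withDensity (measurable_gaussianPDF _ _) (measurable_gaussianPDF _ _)]
    congr 1
    ext x
    rw [gaussianPDF_def, ← ENNReal.ofReal_mul (gaussianPDFReal_nonneg _ _ _)]
    congr 1
    have h2 : ‖Complex.measurableEquivRealProd.symm x‖ ^ 2 = x.1 ^ 2 + x.2 ^ 2 := by
      rw [← Complex.normSq_eq_norm_sq, Complex.normSq_apply]
      simp [Complex.measurableEquivRealProd_symm_apply]; ring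
    have hpi : √Real.pi * √Real.pi = Real.pi := Real.mul_self_sqrt Real.pi_pos.le
    rw [h2, gaussianPDFReal, gaussianPDFReal]
    have h3 : (2 * Real.pi * ((1 / 2 : ℝ≥0) : ℝ)) = Real.pi := by push_cast; ring
    rw [h3, mul_mul_mul_comm, ← mul_inv, hpi, ← Real.exp_add]
    congr 2
    push_cast
    ring
  have hvp := Complex.volume_preserving_equiv_real_prod.symm
  unfold complexNormal
  rw [key]
  ext s hs
  have hm : Measurable (fun z : ℝ × ℝ => (⟨z.1, z.2⟩ : ℂ)) :=
    Complex.measurableEquivRealProd.symm.measurable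
  rw [Measure.map_apply hm hs, withDensity_apply _ (hm hs), withDensity_apply _ hs,
    ← hvp.setLIntegral_comp_preimage hs hmeas]
  rfl

/-- Polar coordinates for the complex Gaussian law: the modulus has density `2 y exp (-y²)`. -/
theorem integral_norm_complexNormal (f : ℝ → ℝ) :
    ∫ z, f ‖z‖ ∂complexNormal = ∫ y in Set.Ioi (0 : ℝ), 2 * y * Real.exp (-y ^ 2) * f y := by
  rw [complexNormal_eq_withDensity, integral_withDensity_eq_integral_toReal_smul (by fun_prop)
    (by simp)]
  have := integral_fun_norm_addHaar (volume : Measure ℂ)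
    (fun y => (Real.pi⁻¹ * Real.exp (-y ^ 2)) * f y)
  have hb : (volume : Measure ℂ).real (Metric.ball 0 1) = Real.pi := by
    simp [measureReal_def, Complex.volume_ball]
  rw [hb, Complex.finrank_real_complex] at this
  calc _ = ∫ z : ℂ, (Real.pi⁻¹ * Real.exp (-‖z‖ ^ 2)) * f ‖z‖ := by
        refine integral_congr_ae (ae_of_all _ fun z => ?_)
        simp only [smul_eq_mul]
        rw [ENNReal.toReal_ofReal (by positivity)]
    _ = _ := by
        rw [this, nsmul_eq_mul, smul_eq_mul, ← integral_const_mul, ← integral_const_mul]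
        refine integral_congr_ae (ae_of_all _ fun y => ?_)
        have := Real.pi_ne_zero
        simp only [smul_eq_mul]
        field_simp
        norm_num
        ring

theorem integral_Ioi_two_mul_exp_neg_mul_sq {a b : ℝ} (ha : 0 ≤ a) (hb : 0 < b) :
    IntegrableOn (fun y : ℝ => 2 * y * Real.exp (-(b * y ^ 2))) (Set.Ioi a) ∧
    ∫ y in Set.Ioi a, 2 * y * Real.exp (-(b * y ^ 2)) = Real.exp (-(b * a ^ 2)) / b := by
  have hd : ∀ x ∈ Set.Ici a, HasDerivAt (fun y : ℝ => -Real.exp (-(b * y ^ 2)) / b)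
      (2 * x * Real.exp (-(b * x ^ 2))) x := by
    intro x _
    have h1 : HasDerivAt (fun y : ℝ => -(b * y ^ 2)) (-(b * (2 * x))) x := by
      have := ((hasDerivAt_pow 2 x).const_mul b).fun_neg
      simpa using this
    have := (h1.exp.fun_neg).div_const b
    refine this.congr_deriv ?_
    rw [div_eq_iff hb.ne']
    ring
  have hlim : Tendsto (fun y : ℝ => -Real.exp (-(b * y ^ 2)) / b) atTop (𝓝 0) := by
    have h1 : Tendsto (fun y : ℝ => b * y ^ 2) atTop atTop :=
      (tendsto_pow_atTop two_ne_zero).const_mul_atTop hb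
    have := (Real.tendsto_exp_neg_atTop_nhds_zero.comp h1).neg.div_const b
    simpa using this
  have hnn : ∀ x ∈ Set.Ioi a, 0 ≤ 2 * x * Real.exp (-(b * x ^ 2)) := by
    intro x hx
    have : 0 ≤ x := ha.trans (le_of_lt hx)
    positivity
  refine ⟨integrableOn_Ioi_deriv_of_nonneg' hd hnn hlim, ?_⟩
  rw [integral_Ioi_of_hasDerivAt_of_nonneg' hd hnn hlim]
  ring

/-- The squared modulus of a complex Gaussian is exponentially distributed: its moment generating
function. -/
theorem integral_exp_mul_sq_norm_complexNormal {t : ℝ} (ht : t < 1) :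
    ∫ z, Real.exp (t * ‖z‖ ^ 2) ∂complexNormal = 1 / (1 - t) := by
  rw [integral_norm_complexNormal (fun y => Real.exp (t * y ^ 2))]
  have := (integral_Ioi_two_mul_exp_neg_mul_sq le_rfl (sub_pos.2 ht)).2
  simp only [ne_eq, OfNat.ofNat_ne_zero, not_false_eq_true, zero_pow, mul_zero, neg_zero,
    Real.exp_zero] at this
  rw [← this]
  refine integral_congr_ae (ae_of_all _ fun y => ?_)
  simp only
  rw [mul_assoc (2 * y), ← Real.exp_add]
  congr 2
  ring

theorem integrable_exp_mul_sq_norm_complexNormal {t : ℝ} (ht : t < 1) :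
    Integrable (fun z => Real.exp (t * ‖z‖ ^ 2)) complexNormal := by
  by_contra h
  have h1 := integral_undef h
  rw [integral_exp_mul_sq_norm_complexNormal ht] at h1
  have : 0 < 1 / (1 - t) := by have := sub_pos.2 ht; positivity
  linarith

/-- The squared modulus of a complex Gaussian is exponentially distributed: its tail. -/
theorem complexNormal_sq_norm_gt {y : ℝ} (hy : 0 ≤ y) :
    complexNormal.real {z | y < ‖z‖ ^ 2} = Real.exp (-y) := by
  have hs : MeasurableSet {z : ℂ | y < ‖z‖ ^ 2} :=
    measurableSet_lt measurable_const (by fun_prop)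
  have h1 : complexNormal.real {z | y < ‖z‖ ^ 2} =
      ∫ z, (fun r : ℝ => (Set.Ioi (√y)).indicator (fun _ => (1 : ℝ)) r) ‖z‖ ∂complexNormal := by
    rw [← integral_indicator_one hs]
    refine integral_congr_ae (ae_of_all _ fun z => ?_)
    simp only [Set.indicator, Set.mem_ofPred_eq, Set.mem_Ioi, Pi.one_apply,
      Real.sqrt_lt hy (norm_nonneg z)]
  rw [h1, integral_norm_complexNormal]
  have h2 := (integral_Ioi_two_mul_exp_neg_mul_sq (Real.sqrt_nonneg y) one_pos).2
  simp only [one_mul, Real.sq_sqrt hy, div_one] at h2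
  rw [← h2, ← integral_indicator measurableSet_Ioi, ← integral_indicator measurableSet_Ioi]
  refine integral_congr_ae (ae_of_all _ fun r => ?_)
  have := Real.sqrt_nonneg y
  simp only [Set.indicator, Set.mem_Ioi]
  split_ifs with h3 h4 h4
  · simp
  · simp
  · linarith
  · rfl

theorem charFun_complexNormal (t : ℂ) :
    charFun complexNormal t = Complex.exp (-(‖t‖ ^ 2 : ℝ) / 4) := by
  have hm : Measurable (fun z : ℝ × ℝ => (⟨z.1, z.2⟩ : ℂ)) :=
    Complex.measurableEquivRealProd.symm.measurable
  rw [charFun_apply, complexNormal, integral_map hm.aemeasurable (by fun_prop)]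
  have h1 : ∀ x : ℝ × ℝ, Complex.exp ((inner ℝ (⟨x.1, x.2⟩ : ℂ) t : ℝ) * Complex.I) =
      Complex.exp (t.re * x.1 * Complex.I) * Complex.exp (t.im * x.2 * Complex.I) := by
    intro x
    rw [← Complex.exp_add, Complex.inner]
    congr 1
    simp
    ring
  simp_rw [h1]
  rw [integral_prod_mul (fun x : ℝ => Complex.exp (t.re * x * Complex.I))
    (fun x : ℝ => Complex.exp (t.im * x * Complex.I)), ← charFun_apply_real,
    ← charFun_apply_real, charFun_gaussianReal, charFun_gaussianReal, ← Complex.exp_add]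
  congr 1
  rw [← Complex.normSq_eq_norm_sq, Complex.normSq_apply]
  push_cast
  ring

/-! ### Complex Gaussian vectors -/

/-- The law of a vector in `ℂ^n` whose entries are i.i.d. `CN(0,1)`. -/
noncomputable def gaussianVec (n : ℕ) : Measure (CVec n) :=
  (Measure.pi fun _ : Fin n => complexNormal).map (WithLp.toLp 2)

instance isProbabilityMeasure_gaussianVec (n : ℕ) : IsProbabilityMeasure (gaussianVec n) :=
  Measure.isProbabilityMeasure_map (by fun_prop)

theorem charFun_gaussianVec {n : ℕ} (t : CVec n) :
    charFun (gaussianVec n) t = Complex.exp (-(‖t‖ ^ 2 : ℝ) / 4) := by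
  rw [gaussianVec, charFun_pi, EuclideanSpace.norm_sq_eq]
  simp_rw [charFun_complexNormal]
  rw [← Complex.exp_sum]
  congr 1
  push_cast
  rw [neg_div, Finset.sum_div, ← Finset.sum_neg_distrib]
  simp [neg_div]

theorem real_inner_eq_re {n : ℕ} (x y : CVec n) : inner ℝ x y = (inner ℂ x y).re := by
  simp [PiLp.inner_apply]

theorem charFun_map_isometryEquiv {n : ℕ} (μ : Measure (CVec n)) (U : CVec n ≃ₗᵢ[ℂ] CVec n)
    (t : CVec n) : charFun (μ.map U) (U t) = charFun μ t := by
  rw [charFun_apply, charFun_apply, integral_map U.continuous.measurable.aemeasurable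
    (by fun_prop)]
  simp_rw [real_inner_eq_re, LinearIsometryEquiv.inner_map_map]

theorem gaussianVec_map_isometryEquiv {n : ℕ} (U : CVec n ≃ₗᵢ[ℂ] CVec n) :
    (gaussianVec n).map U = gaussianVec n := by
  have := Measure.isProbabilityMeasure_map (μ := gaussianVec n) (f := U)
    U.continuous.measurable.aemeasurable
  refine Measure.ext_of_charFun (funext fun t => ?_)
  obtain ⟨t, rfl⟩ := U.surjective t
  rw [charFun_map_isometryEquiv, charFun_gaussianVec, charFun_gaussianVec, U.norm_map]

/-- The coordinates of a complex Gaussian vector in any orthonormal basis are i.i.d. `CN(0,1)`. -/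
theorem gaussianVec_map_repr {n : ℕ} (b : OrthonormalBasis (Fin n) ℂ (CVec n)) :
    (gaussianVec n).map (fun g k => inner ℂ (b k) g) =
      Measure.pi fun _ : Fin n => complexNormal := by
  have h1 : (fun (g : CVec n) k => inner ℂ (b k) g) = WithLp.ofLp ∘ b.repr := by
    ext g k
    simp [OrthonormalBasis.repr_apply_apply]
  rw [h1, ← Measure.map_map (by fun_prop) b.repr.continuous.measurable,
    gaussianVec_map_isometryEquiv, gaussianVec, Measure.map_map (by fun_prop) (by fun_prop)]
  exact Measure.map_id

/-! ### Quadratic forms in complex Gaussians -/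

theorem exp_neg_mul_one_div_one_sub_le {x : ℝ} (hx : |x| ≤ 1 / 2) :
    Real.exp (-x) * (1 / (1 - x)) ≤ Real.exp (2 * x ^ 2) := by
  obtain ⟨h1, h2⟩ := abs_le.1 hx
  have h3 : 0 < 1 - x := by linarith
  have h4 := Real.abs_log_sub_add_sum_range_le (x := x) (by linarith) 1
  have h5 : |x| ^ (1 + 1) / (1 - |x|) ≤ 2 * x ^ 2 := by
    rw [div_le_iff₀ (by linarith), one_add_one_eq_two, sq_abs]
    nlinarith [sq_nonneg x]
  have h6 := neg_le_of_abs_le (h4.trans h5)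
  simp only [Finset.range_one, Finset.sum_singleton, zero_add, pow_one, Nat.cast_zero,
    div_one] at h6
  calc Real.exp (-x) * (1 / (1 - x)) = Real.exp (-x - Real.log (1 - x)) := by
        rw [Real.exp_sub, Real.exp_log h3]; ring
    _ ≤ _ := Real.exp_le_exp.2 (by linarith)

/-- The Chernoff bound with exponent `1 / (2 √K)`, which keeps every factor of the moment
generating function in the range where it is at most Gaussian. -/
theorem gaussian_quadratic_upper_tail {ι : Type*} [Fintype ι] (w : ι → ℝ) {K : ℝ} (hK : 0 < K)
    (hw : ∑ k, w k ^ 2 ≤ K) (τ : ℝ) :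
    (Measure.pi fun _ : ι => complexNormal).real {g | τ ≤ ∑ k, w k * (‖g k‖ ^ 2 - 1)} ≤
      2 * Real.exp (-τ / (2 * √K)) := by
  set μ := Measure.pi fun _ : ι => complexNormal
  have hsK : 0 < √K := Real.sqrt_pos.2 hK
  have hsq : √K ^ 2 = K := Real.sq_sqrt hK.le
  set t : ℝ := 1 / (2 * √K) with ht
  have ht0 : 0 < t := by positivity
  have htK : t ^ 2 * K = 1 / 4 := by
    rw [ht, div_pow, mul_pow, hsq]; field_simp; norm_num
  have hwk : ∀ k, |t * w k| ≤ 1 / 2 := by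
    intro k
    have h1 : w k ^ 2 ≤ K :=
      (Finset.single_le_sum (fun i _ => sq_nonneg (w i)) (Finset.mem_univ k)).trans hw
    refine abs_le_of_sq_le_sq ?_ (by norm_num)
    rw [mul_pow]
    nlinarith [sq_nonneg t]
  have hfac : ∀ g : ι → ℂ, Real.exp (t * ∑ k, w k * (‖g k‖ ^ 2 - 1)) =
      ∏ k, (fun k (z : ℂ) => Real.exp (-(t * w k)) * Real.exp ((t * w k) * ‖z‖ ^ 2)) k (g k) := by
    intro g
    simp only
    rw [Finset.mul_sum, Real.exp_sum]
    refine Finset.prod_congr rfl fun k _ => ?_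
    rw [← Real.exp_add]
    congr 1
    ring
  have hlt : ∀ k, t * w k < 1 := fun k => by linarith [(abs_le.1 (hwk k)).2]
  have hint : Integrable (fun g : ι → ℂ => Real.exp (t * ∑ k, w k * (‖g k‖ ^ 2 - 1))) μ := by
    simp_rw [hfac]
    exact Integrable.fintype_prod fun k =>
      (integrable_exp_mul_sq_norm_complexNormal (hlt k)).const_mul _
  refine (measure_ge_le_exp_mul_mgf τ ht0.le hint).trans ?_
  have hmgf : mgf (fun g : ι → ℂ => ∑ k, w k * (‖g k‖ ^ 2 - 1)) μ t ≤ Real.exp (1 / 2) := by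
    rw [mgf]
    simp_rw [hfac]
    rw [integral_fintype_prod_eq_prod
      (f := fun k (z : ℂ) => Real.exp (-(t * w k)) * Real.exp ((t * w k) * ‖z‖ ^ 2))]
    calc _ ≤ ∏ k, Real.exp (2 * (t * w k) ^ 2) := by
          refine Finset.prod_le_prod (fun k _ => integral_nonneg fun z => by positivity) fun k _ => ?_
          rw [integral_const_mul, integral_exp_mul_sq_norm_complexNormal (hlt k)]
          exact exp_neg_mul_one_div_one_sub_le (hwk k)
      _ ≤ _ := by
          rw [← Real.exp_sum, Real.exp_le_exp]
          simp_rw [mul_pow]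
          rw [← Finset.mul_sum, ← Finset.mul_sum]
          nlinarith [mul_le_mul_of_nonneg_left hw (sq_nonneg t)]
  have h2 : Real.exp (1 / 2) ≤ 2 := by
    rw [show (1 / 2 : ℝ) = 1 - 1 / 2 by norm_num]
    have h3 := Real.exp_one_lt_d9
    refine abs_le_of_sq_le_sq' ?_ (by norm_num) |>.2
    rw [← Real.exp_nat_mul]
    norm_num
    linarith
  calc _ ≤ Real.exp (-t * τ) * 2 := by gcongr; exact hmgf.trans h2
    _ = _ := by rw [mul_comm, ht]; congr 2; ring

/-- A weighted sum of independent centred exponential variables concentrates at the scale of the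
Euclidean norm `√K` of its weights, with subexponential tails. -/
theorem gaussian_quadratic_tail {ι : Type*} [Fintype ι] (w : ι → ℝ) {K : ℝ} (hK : 0 < K)
    (hw : ∑ k, w k ^ 2 ≤ K) (τ : ℝ) :
    (Measure.pi fun _ : ι => complexNormal).real {g | τ ≤ |∑ k, w k * (‖g k‖ ^ 2 - 1)|} ≤
      4 * Real.exp (-τ / (2 * √K)) := by
  have h1 := gaussian_quadratic_upper_tail w hK hw τ
  have h2 := gaussian_quadratic_upper_tail (fun k => -w k) hK (by simpa using hw) τ
  refine (measureReal_mono (s₂ := {g | τ ≤ ∑ k, w k * (‖g k‖ ^ 2 - 1)} ∪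
    {g | τ ≤ ∑ k, -w k * (‖g k‖ ^ 2 - 1)}) fun g hg => ?_).trans
    ((measureReal_union_le _ _).trans (by linarith))
  simp only [Set.mem_ofPred_eq, Set.mem_union, neg_mul, Finset.sum_neg_distrib] at hg ⊢
  exact le_abs.1 hg

/-- The tail estimate for the Hermitian form `g ↦ ⟪g, T g⟫` of a complex Gaussian vector `g`:
it concentrates around the trace of `T` at the scale of the Hilbert-Schmidt norm of `T`, both
expressed through an arbitrary orthonormal basis `e`. -/
theorem gaussianVec_quadratic_tail {n : ℕ} (T : CVec n →ₗ[ℂ] CVec n) (hT : T.IsSymmetric)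
    {K : ℝ} (hK : 0 < K) (e : OrthonormalBasis (Fin n) ℂ (CVec n))
    (hTK : ∑ k, ‖T (e k)‖ ^ 2 ≤ K) (τ : ℝ) :
    (gaussianVec n).real
      {g | τ ≤ |(inner ℂ g (T g)).re - ∑ k, (inner ℂ (e k) (T (e k))).re|} ≤
      4 * Real.exp (-τ / (2 * √K)) := by
  have hfr : Module.finrank ℂ (CVec n) = n := by simp
  set b := hT.eigenvectorBasis hfr with hb
  set w := hT.eigenvalues hfr with hw
  have hTb : ∀ k, T (b k) = (w k : ℂ) • b k := fun k => hT.apply_eigenvectorBasis hfr k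
  -- the Hilbert-Schmidt norm and the trace do not depend on the orthonormal basis
  have hHS : ∑ k, ‖T (e k)‖ ^ 2 = ∑ k, w k ^ 2 := by
    calc _ = ∑ k, ∑ l, ‖inner ℂ (b l) (T (e k))‖ ^ 2 :=
          Finset.sum_congr rfl fun k _ => (b.sum_sq_norm_inner_right _).symm
      _ = ∑ l, ∑ k, ‖inner ℂ (T (b l)) (e k)‖ ^ 2 := by
          rw [Finset.sum_comm]
          simp_rw [hT _ _]
      _ = _ := by
          refine Finset.sum_congr rfl fun l _ => ?_
          rw [e.sum_sq_norm_inner_left, hTb, norm_smul, b.norm_eq_one]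
          simp
  have htr : ∑ k, (inner ℂ (e k) (T (e k))).re = ∑ k, w k := by
    have h1 := LinearMap.trace_eq_sum_inner T e
    have h2 := LinearMap.trace_eq_sum_inner T b
    rw [h1] at h2
    have h3 := congrArg Complex.re h2
    simp only [Complex.re_sum] at h3
    rw [h3]
    refine Finset.sum_congr rfl fun l _ => ?_
    rw [hTb, inner_smul_right, inner_self_eq_norm_sq_to_K, b.norm_eq_one]
    simp
  have hform : ∀ g : CVec n, (inner ℂ g (T g)).re = ∑ k, w k * ‖inner ℂ (b k) g‖ ^ 2 := by
    intro g
    rw [← b.sum_inner_mul_inner g (T g), Complex.re_sum]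
    refine Finset.sum_congr rfl fun k _ => ?_
    rw [← hT, hTb, inner_smul_left, Complex.conj_ofReal, mul_left_comm, ← inner_conj_symm g,
      ← Complex.normSq_eq_conj_mul_self, Complex.normSq_eq_norm_sq, ← Complex.ofReal_mul,
      Complex.ofReal_re]
  have h := gaussian_quadratic_tail w hK (hHS ▸ hTK) τ
  rw [← gaussianVec_map_repr b, map_measureReal_apply (by fun_prop)
    (measurableSet_le measurable_const (by fun_prop))] at h
  refine le_trans (le_of_eq ?_) h
  congr 1
  ext g
  simp only [Set.mem_ofPred_eq, Set.mem_preimage]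
  rw [hform, htr, ← Finset.sum_sub_distrib]
  simp [mul_sub]

/-! ### Unitary maps and directions -/

/-- The unitary group acts transitively on orthonormal families of a given length. -/
theorem exists_isometryEquiv_apply_eq {n m : ℕ} {v v' : Fin m → CVec n} (hv : Orthonormal ℂ v)
    (hv' : Orthonormal ℂ v') : ∃ U : CVec n ≃ₗᵢ[ℂ] CVec n, ∀ i, U (v i) = v' i := by
  have hmn : m ≤ n := by
    simpa using hv.linearIndependent.fintype_card_le_finrank
  have hext : ∀ w : Fin m → CVec n, Orthonormal ℂ w →
      ∃ b : OrthonormalBasis (Fin n) ℂ (CVec n), ∀ i, b (Fin.castLE hmn i) = w i := by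
    intro w hw
    set W : Fin n → CVec n := fun i => if h : (i : ℕ) < m then w ⟨i, h⟩ else 0
    have hW : Orthonormal ℂ (({i : Fin n | (i : ℕ) < m} : Set (Fin n)).domRestrict W) := by
      have : ({i : Fin n | (i : ℕ) < m} : Set (Fin n)).domRestrict W =
          w ∘ fun i => ⟨i.1, i.2⟩ := by
        ext1 i
        have hi : (i.1 : ℕ) < m := i.2
        simp [W, Set.domRestrict, hi]
      rw [this]
      refine hw.comp _ fun i j hij => ?_
      simpa [Fin.ext_iff, Subtype.ext_iff] using hij
    obtain ⟨b, hb⟩ := hW.exists_orthonormalBasis_extension_of_card_eq (by simp)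
    refine ⟨b, fun i => ?_⟩
    rw [hb _ (by simp)]
    simp [W]
  obtain ⟨b, hb⟩ := hext v hv
  obtain ⟨b', hb'⟩ := hext v' hv'
  refine ⟨b.equiv b' (Equiv.refl _), fun i => ?_⟩
  rw [← hb, ← hb', OrthonormalBasis.equiv_apply_basis]
  rfl

theorem exists_isometryEquiv_apply_eq_of_norm_eq {n : ℕ} {x y : CVec n} (h : ‖x‖ = ‖y‖) :
    ∃ U : CVec n ≃ₗᵢ[ℂ] CVec n, U x = y := by
  by_cases hx : x = 0
  · refine ⟨LinearIsometryEquiv.refl ℂ _, ?_⟩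
    rw [hx, norm_zero] at h
    rw [hx, norm_eq_zero.1 h.symm]
    rfl
  have hx' : ‖x‖ ≠ 0 := norm_ne_zero_iff.2 hx
  have hon : ∀ z : CVec n, ‖z‖ = ‖x‖ → Orthonormal ℂ (fun _ : Fin 1 => ((‖x‖⁻¹ : ℝ) : ℂ) • z) := by
    intro z hz
    refine ⟨fun _ => ?_, fun i j hij => absurd (Subsingleton.elim i j) hij⟩
    rw [norm_smul, hz, Complex.norm_real, norm_inv, norm_norm, inv_mul_cancel₀ hx']
  obtain ⟨U, hU⟩ := exists_isometryEquiv_apply_eq (hon x rfl) (hon y h.symm)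
  refine ⟨U, ?_⟩
  have := hU 0
  rw [map_smul] at this
  exact smul_right_injective _ (Complex.ofReal_ne_zero.2 (inv_ne_zero hx')) this

theorem norm_direction {n : ℕ} {x : CVec n} (hx : x ≠ 0) : ‖direction x‖ = 1 := by
  rw [direction, norm_smul, Complex.norm_real, norm_inv, norm_norm,
    inv_mul_cancel₀ (norm_ne_zero_iff.2 hx)]

theorem direction_zero {n : ℕ} : direction (0 : CVec n) = 0 := by simp [direction]

theorem norm_smul_direction {n : ℕ} (x : CVec n) : (‖x‖ : ℂ) • direction x = x := by
  by_cases hx : x = 0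
  · simp [hx]
  · rw [direction, smul_smul, ← Complex.ofReal_mul, mul_inv_cancel₀ (norm_ne_zero_iff.2 hx)]
    simp

theorem map_direction {n : ℕ} (U : CVec n ≃ₗᵢ[ℂ] CVec n) (x : CVec n) :
    U (direction x) = direction (U x) := by
  rw [direction, direction, map_smul, U.norm_map]

theorem measurable_direction {n : ℕ} : Measurable (direction : CVec n → CVec n) := by
  unfold direction
  fun_prop

theorem norm_inner_direction_left_sq {n : ℕ} (x y : CVec n) :
    ‖inner ℂ (direction x) y‖ ^ 2 = ‖inner ℂ x y‖ ^ 2 / ‖x‖ ^ 2 := by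
  rw [direction, inner_smul_left, norm_mul, Complex.conj_ofReal, Complex.norm_real, norm_inv,
    norm_norm]
  ring

theorem norm_inner_direction_right_sq {n : ℕ} (x y : CVec n) :
    ‖inner ℂ x (direction y)‖ ^ 2 = ‖inner ℂ x y‖ ^ 2 / ‖y‖ ^ 2 := by
  rw [norm_inner_symm, norm_inner_direction_left_sq, norm_inner_symm]

/-! ### The isotropic law -/

instance isProbabilityMeasure_isotropicLaw (n : ℕ) [NeZero n] :
    IsProbabilityMeasure (isotropicLaw n) := by
  have h : (volume : Measure (CVec n)).toSphere Set.univ ≠ 0 := by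
    rw [Ne, Measure.measure_univ_eq_zero]
    exact Measure.toSphere_ne_zero _
  constructor
  rw [isotropicLaw, Measure.map_apply measurable_subtype_coe MeasurableSet.univ,
    Set.preimage_univ, Measure.smul_apply, smul_eq_mul,
    ENNReal.inv_mul_cancel h (measure_ne_top _ _)]

theorem ae_isotropicLaw_norm_eq_one (n : ℕ) : ∀ᵐ x ∂isotropicLaw n, ‖x‖ = 1 := by
  rw [isotropicLaw, ae_map_iff (by fun_prop) (measurableSet_eq_fun (by fun_prop) (by fun_prop))]
  exact ae_of_all _ fun x => by simp

theorem measurePreserving_isometryEquiv_volume {n : ℕ} (U : CVec n ≃ₗᵢ[ℂ] CVec n) :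
    MeasurePreserving U (volume : Measure (CVec n)) volume :=
  LinearIsometryEquiv.measurePreserving (E := CVec n) (F := CVec n)
    { U.toLinearEquiv.restrictScalars ℝ with norm_map' := U.norm_map }

open scoped Pointwise in
theorem isotropicLaw_map_isometryEquiv {n : ℕ} (U : CVec n ≃ₗᵢ[ℂ] CVec n) :
    (isotropicLaw n).map U = isotropicLaw n := by
  have hU : Measurable U := U.continuous.measurable
  have hval : Measurable (Subtype.val : Metric.sphere (0 : CVec n) 1 → CVec n) :=
    measurable_subtype_coe
  ext s hs
  rw [Measure.map_apply hU hs, isotropicLaw, Measure.map_apply hval (hU hs),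
    Measure.map_apply hval hs, Measure.smul_apply, Measure.smul_apply,
    Measure.toSphere_apply' _ (hval (hU hs)), Measure.toSphere_apply' _ (hval hs)]
  congr 2
  have hmp := (measurePreserving_isometryEquiv_volume U).measure_preimage_emb
    U.toHomeomorph.measurableEmbedding
      (Set.Ioo (0 : ℝ) 1 • Subtype.val '' (Subtype.val ⁻¹' s : Set (Metric.sphere (0 : CVec n) 1)))
  rw [← hmp]
  congr 1
  have hlin : ∀ (r : ℝ) (y : CVec n), U (r • y) = r • U y := fun r y => by
    have := U.map_smul (r : ℂ) y
    simpa using this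
  ext x
  simp only [Set.mem_preimage, Set.mem_smul, Set.mem_image, Subtype.exists, exists_and_right,
    exists_eq_right]
  constructor
  · rintro ⟨r, hr, y, ⟨hy1, hy2⟩, rfl⟩
    exact ⟨r, hr, U y, ⟨by simpa using hy1, hy2⟩, (hlin r y).symm⟩
  · rintro ⟨r, hr, y, ⟨hy1, hy2⟩, hxy⟩
    refine ⟨r, hr, U.symm y, ⟨by simpa using hy1, by simpa using hy2⟩, U.injective ?_⟩
    rw [hlin, U.apply_symm_apply, hxy]

/-- A unitarily invariant probability measure on the unit sphere is unique: the characteristic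
function at `t` may be averaged over the directions of `t`, and after exchanging the integrals the
two measures play symmetric roles. -/
theorem eq_of_map_isometryEquiv_eq {n : ℕ} {μ ν : Measure (CVec n)} [IsProbabilityMeasure μ]
    [IsProbabilityMeasure ν] (hμ : ∀ U : CVec n ≃ₗᵢ[ℂ] CVec n, μ.map U = μ)
    (hν : ∀ U : CVec n ≃ₗᵢ[ℂ] CVec n, ν.map U = ν)
    (hμ1 : ∀ᵐ x ∂μ, ‖x‖ = 1) (hν1 : ∀ᵐ x ∂ν, ‖x‖ = 1) : μ = ν := by
  have key : ∀ {μ ν : Measure (CVec n)} [IsProbabilityMeasure μ] [IsProbabilityMeasure ν],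
      (∀ U : CVec n ≃ₗᵢ[ℂ] CVec n, μ.map U = μ) → (∀ᵐ x ∂ν, ‖x‖ = 1) → ∀ t,
      charFun μ t = ∫ u, ∫ x, Complex.exp ((‖t‖ * inner ℝ x u : ℝ) * Complex.I) ∂μ ∂ν := by
    intro μ ν _ _ hμ hν1 t
    have h1 : ∀ᵐ u ∂ν, ∫ x, Complex.exp ((‖t‖ * inner ℝ x u : ℝ) * Complex.I) ∂μ =
        charFun μ t := by
      filter_upwards [hν1] with u hu
      obtain ⟨U, hU⟩ := exists_isometryEquiv_apply_eq_of_norm_eq (x := ‖t‖ • u) (y := t)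
        (by simp [norm_smul, hu])
      have h2 := charFun_map_isometryEquiv μ U (‖t‖ • u)
      rw [hμ, hU] at h2
      rw [h2, charFun_apply]
      simp_rw [inner_smul_right]
    rw [integral_congr_ae h1]
    simp
  refine Measure.ext_of_charFun (funext fun t => ?_)
  rw [key hμ hν1 t, key hν hμ1 t, integral_integral_swap]
  · simp_rw [real_inner_comm]
  · refine Integrable.of_bound (C := 1) ?_ (ae_of_all _ fun x => ?_)
    · simp only [Function.uncurry_def]
      fun_prop
    · simp only [Function.uncurry_def, Complex.norm_exp_ofReal_mul_I, le_refl]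

theorem eq_isotropicLaw {n : ℕ} [NeZero n] {μ : Measure (CVec n)} [IsProbabilityMeasure μ]
    (hμ : ∀ U : CVec n ≃ₗᵢ[ℂ] CVec n, μ.map U = μ) (hμ1 : ∀ᵐ x ∂μ, ‖x‖ = 1) :
    μ = isotropicLaw n :=
  eq_of_map_isometryEquiv_eq hμ isotropicLaw_map_isometryEquiv hμ1 (ae_isotropicLaw_norm_eq_one n)

instance nullSingletonClass_complexNormal : NullSingletonClass complexNormal := by
  rw [complexNormal_eq_withDensity]
  infer_instance

theorem ae_gaussianVec_ne {n : ℕ} [NeZero n] (a : CVec n) : ∀ᵐ g ∂gaussianVec n, g ≠ a := by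
  rw [gaussianVec, ae_map_iff (by fun_prop) (p := fun g => g ≠ a) (measurableSet_singleton a).compl, ae_iff]
  refine measure_mono_null (fun x hx => ?_)
    (measure_singleton (μ := Measure.pi fun _ : Fin n => complexNormal) (WithLp.ofLp a))
  simp only [ne_eq, not_not, Set.mem_ofPred_eq] at hx
  simp [← hx]

/-- The direction of a complex Gaussian vector is isotropic, so estimates for isotropic vectors can
be proved on Gaussian ones. -/
theorem gaussianVec_map_direction (n : ℕ) [NeZero n] :
    (gaussianVec n).map direction = isotropicLaw n := by
  have := Measure.isProbabilityMeasure_map (μ := gaussianVec n)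
    (measurable_direction (n := n)).aemeasurable
  refine eq_isotropicLaw (fun U => ?_) ?_
  · rw [Measure.map_map U.continuous.measurable measurable_direction]
    have : U ∘ direction = direction ∘ U := funext fun x => map_direction U x
    rw [this, ← Measure.map_map measurable_direction U.continuous.measurable,
      gaussianVec_map_isometryEquiv]
  · rw [ae_map_iff measurable_direction.aemeasurable
      (measurableSet_eq_fun (by fun_prop) (by fun_prop))]
    filter_upwards [ae_gaussianVec_ne (0 : CVec n)] with g hg using norm_direction hg

theorem IsRayleigh.hasLaw {Ω : Type*} [MeasurableSpace Ω] {P : Measure Ω} [IsProbabilityMeasure P]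
    {n : ℕ} {h : Ω → CVec n} (hh : IsRayleigh P h) : HasLaw h (gaussianVec n) P := by
  have hm : ∀ k, AEMeasurable (fun ω => h ω k) P := fun k => (hh.1 k).aemeasurable
  have hm' : AEMeasurable (fun ω k => h ω k) P := aemeasurable_pi_iff.2 hm
  have h1 : h = WithLp.toLp 2 ∘ fun ω k => h ω k := rfl
  have hm2 : Measurable (WithLp.toLp 2 : (Fin n → ℂ) → CVec n) := by fun_prop
  refine ⟨h1 ▸ hm2.comp_aemeasurable hm', ?_⟩
  rw [h1, ← AEMeasurable.map_map_of_aemeasurable hm2.aemeasurable hm',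
    (iIndepFun_iff_map_fun_eq_pi_map hm).1 hh.2]
  simp_rw [(hh.1 _).map_eq]
  rfl

theorem IsRayleigh.hasLaw_direction {Ω : Type*} [MeasurableSpace Ω] {P : Measure Ω}
    [IsProbabilityMeasure P] {n : ℕ} [NeZero n] {h : Ω → CVec n} (hh : IsRayleigh P h) :
    HasLaw (fun ω => direction (h ω)) (isotropicLaw n) P := by
  refine ⟨measurable_direction.comp_aemeasurable hh.hasLaw.aemeasurable, ?_⟩
  rw [← gaussianVec_map_direction, ← hh.hasLaw.map_eq,
    AEMeasurable.map_map_of_aemeasurable measurable_direction.aemeasurable hh.hasLaw.aemeasurable]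
  rfl

/-! ### Isotropic vectors against fixed directions and subspaces -/

theorem norm_sq_starProjection_eq_re_inner {n : ℕ} (V : Submodule ℂ (CVec n)) (g : CVec n) :
    ‖V.starProjection g‖ ^ 2 = (inner ℂ g (V.starProjection g)).re := by
  rw [Submodule.starProjection_apply, Submodule.norm_coe,
    ← Submodule.re_inner_starProjection_eq_normSq, Submodule.inner_starProjection_left_eq_right]
  rfl

theorem sum_re_inner_starProjection {n : ℕ} (V : Submodule ℂ (CVec n))
    (e : OrthonormalBasis (Fin n) ℂ (CVec n)) :
    ∑ k, (inner ℂ (e k) (V.starProjection (e k))).re = Module.finrank ℂ V := by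
  have hproj : LinearMap.IsProj V (V.starProjection : CVec n →ₗ[ℂ] CVec n) :=
    ⟨fun x => V.starProjection_apply_mem x, fun x hx => Submodule.starProjection_eq_self_iff.2 hx⟩
  have h := LinearMap.trace_eq_sum_inner (V.starProjection : CVec n →ₗ[ℂ] CVec n) e
  rw [hproj.trace] at h
  have := congrArg Complex.re h
  rw [Complex.re_sum] at this
  simpa using this.symm

theorem gaussianVec_starProjection_tail {n : ℕ} [NeZero n] (V : Submodule ℂ (CVec n)) (τ : ℝ) :
    (gaussianVec n).real {g | τ ≤ |‖V.starProjection g‖ ^ 2 - Module.finrank ℂ V|} ≤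
      4 * Real.exp (-τ / (2 * √n)) := by
  have e := EuclideanSpace.basisFun (Fin n) ℂ
  have h := gaussianVec_quadratic_tail (V.starProjection : CVec n →ₗ[ℂ] CVec n)
    (Submodule.starProjection_isSymmetric V) (K := n) (by exact_mod_cast NeZero.pos n) e ?_ τ
  · simp only [ContinuousLinearMap.coe_coe, sum_re_inner_starProjection] at h
    simpa only [norm_sq_starProjection_eq_re_inner] using h
  · calc _ ≤ ∑ _k : Fin n, (1 : ℝ) := Finset.sum_le_sum fun k _ => by
          have := V.norm_starProjection_apply_le (e k)
          rw [e.norm_eq_one] at this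
          exact pow_le_one₀ (norm_nonneg _) this
      _ = n := by simp

theorem gaussianVec_norm_sq_tail {n : ℕ} [NeZero n] (τ : ℝ) :
    (gaussianVec n).real {g | τ ≤ |‖g‖ ^ 2 - n|} ≤ 4 * Real.exp (-τ / (2 * √n)) := by
  simpa [Submodule.starProjection_top] using gaussianVec_starProjection_tail (n := n) ⊤ τ

/-- For a unit vector `u` and an isotropic `c`, `|u† c|²` has the law `Beta(1, n-1)`. -/
theorem isotropicLaw_sq_norm_inner_gt {n : ℕ} [NeZero n] {u : CVec n} (hu : ‖u‖ = 1) {x : ℝ}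
    (hx0 : 0 ≤ x) (hx1 : x < 1) :
    (isotropicLaw n).real {c | x < ‖inner ℂ u c‖ ^ 2} = (1 - x) ^ (n - 1) := by
  obtain ⟨m, rfl⟩ : ∃ m, n = m + 1 := ⟨n - 1, by have := NeZero.pos n; omega⟩
  obtain ⟨b, hb⟩ : ∃ b : OrthonormalBasis (Fin (m + 1)) ℂ (CVec (m + 1)), b 0 = u := by
    have e := EuclideanSpace.basisFun (Fin (m + 1)) ℂ
    obtain ⟨U, hU⟩ := exists_isometryEquiv_apply_eq_of_norm_eq (x := e 0) (y := u)
      (by rw [hu, e.norm_eq_one])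
    exact ⟨e.map U, by simpa using hU⟩
  have hx1' : 0 < 1 - x := by linarith
  set a := x / (1 - x) with ha
  have ha0 : 0 ≤ a := by positivity
  have hS : MeasurableSet {z : ℂ × (Fin m → ℂ) | a * ∑ k, ‖z.2 k‖ ^ 2 < ‖z.1‖ ^ 2} :=
    measurableSet_lt (by fun_prop) (by fun_prop)
  have hmp := measurePreserving_piFinSuccAbove (fun _ : Fin (m + 1) => complexNormal) 0
  have hmeas : Measurable (fun c : CVec (m + 1) => ‖inner ℂ u c‖ ^ 2) := by fun_prop
  have hset : direction ⁻¹' {c : CVec (m + 1) | x < ‖inner ℂ u c‖ ^ 2} =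
      (fun g k => inner ℂ (b k) g) ⁻¹' (MeasurableEquiv.piFinSuccAbove (fun _ => ℂ) 0 ⁻¹'
        {z : ℂ × (Fin m → ℂ) | a * ∑ k, ‖z.2 k‖ ^ 2 < ‖z.1‖ ^ 2}) := by
    ext g
    simp only [Set.mem_preimage, Set.mem_ofPred_eq, MeasurableEquiv.piFinSuccAbove_apply,
      Fin.insertNthEquiv_zero, Fin.consEquiv_symm_apply, Fin.tail]
    rw [hb, norm_inner_direction_right_sq]
    have hn := b.sum_sq_norm_inner_right g
    rw [Fin.sum_univ_succ, hb] at hn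
    by_cases hg : g = 0
    · simp [hg, hx0]
    have hg' : 0 < ‖g‖ ^ 2 := by positivity
    rw [lt_div_iff₀ hg', ← hn, ha, div_mul_eq_mul_div, div_lt_iff₀ hx1']
    constructor <;> intro h <;> linarith
  rw [← gaussianVec_map_direction, map_measureReal_apply measurable_direction
    (measurableSet_lt measurable_const hmeas), hset,
    ← map_measureReal_apply (by fun_prop) ((MeasurableEquiv.measurable _) hS),
    gaussianVec_map_repr b, hmp.measureReal_preimage hS.nullMeasurableSet, measureReal_def,
    Measure.prod_apply_symm hS]
  have hslice : ∀ z : Fin m → ℂ, complexNormal ((fun y => (y, z)) ⁻¹'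
      {z : ℂ × (Fin m → ℂ) | a * ∑ k, ‖z.2 k‖ ^ 2 < ‖z.1‖ ^ 2}) =
      ENNReal.ofReal (∏ k, Real.exp (-a * ‖z k‖ ^ 2)) := by
    intro z
    rw [← Real.exp_sum, ← Finset.mul_sum, neg_mul, ← complexNormal_sq_norm_gt (by positivity),
      measureReal_def, ENNReal.ofReal_toReal (measure_ne_top _ _)]
    rfl
  simp_rw [hslice]
  rw [← ofReal_integral_eq_lintegral_ofReal, integral_fintype_prod_eq_pow
    (fun z : ℂ => Real.exp (-a * ‖z‖ ^ 2)), integral_exp_mul_sq_norm_complexNormal (by linarith)]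
  · have : 1 / (1 - -a) = 1 - x := by
      rw [ha]; field_simp; ring
    rw [this, ENNReal.toReal_ofReal (by positivity)]
    simp
  · exact Integrable.fintype_prod (f := fun _ (z : ℂ) => Real.exp (-a * ‖z‖ ^ 2)) fun _ =>
      integrable_exp_mul_sq_norm_complexNormal (by linarith)
  · exact ae_of_all _ fun z => Finset.prod_nonneg fun k _ => (Real.exp_pos _).le

/-- The squared length of the projection of an isotropic vector to a subspace `V` of `ℂ^n`
concentrates around `dim V / n`. -/
theorem isotropicLaw_starProjection_tail {n : ℕ} [NeZero n] (V : Submodule ℂ (CVec n)) {ε : ℝ}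
    (hε : 0 < ε) :
    (isotropicLaw n).real {u | 4 * ε < |‖V.starProjection u‖ ^ 2 - Module.finrank ℂ V / n|} ≤
      8 * Real.exp (-(ε * √n) / 2) := by
  have hn : (0 : ℝ) < n := by exact_mod_cast NeZero.pos n
  have hD : (Module.finrank ℂ V : ℝ) ≤ n := by
    exact_mod_cast (Submodule.finrank_le V).trans (by simp)
  set D : ℝ := (Module.finrank ℂ V : ℝ) with hDdef
  have hD0 : 0 ≤ D := Nat.cast_nonneg _
  have hexp : -(ε * n) / (2 * √n) = -(ε * √n) / 2 := by
    have hs : 0 < √(n : ℝ) := Real.sqrt_pos.2 hn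
    rw [div_eq_div_iff (by positivity) (by norm_num)]
    nth_rewrite 1 [← Real.sq_sqrt hn.le]
    ring
  have h1 := gaussianVec_starProjection_tail V (ε * n)
  have h2 := gaussianVec_norm_sq_tail (n := n) (ε * n)
  rw [hexp] at h1 h2
  rw [← gaussianVec_map_direction, map_measureReal_apply measurable_direction
    (measurableSet_lt measurable_const (by fun_prop))]
  have h0 : (gaussianVec n).real {g | g = 0} = 0 := by
    have := ae_gaussianVec_ne (0 : CVec n)
    rw [ae_iff] at this
    simp only [ne_eq, not_not] at this
    rw [measureReal_def, this, ENNReal.toReal_zero]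
  refine (measureReal_mono (s₂ := ({g | ε * n ≤ |‖V.starProjection g‖ ^ 2 - D|} ∪
    {g | ε * n ≤ |‖g‖ ^ 2 - n|}) ∪ {g | g = 0}) fun g hg => ?_).trans
    ((measureReal_union_le _ _).trans
      ((add_le_add (measureReal_union_le _ _) h0.le).trans (by linarith)))
  simp only [Set.mem_preimage, Set.mem_ofPred_eq, Set.mem_union] at hg ⊢
  by_contra hcon
  push Not at hcon
  obtain ⟨⟨hc1, hc2⟩, hc3⟩ := hcon
  have hg0 : 0 < ‖g‖ ^ 2 := by positivity
  have hproj : ‖V.starProjection (direction g)‖ ^ 2 = ‖V.starProjection g‖ ^ 2 / ‖g‖ ^ 2 := by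
    rw [direction, map_smul, norm_smul, Complex.norm_real, norm_inv, norm_norm]
    ring
  rw [hproj] at hg
  have hle : ‖V.starProjection g‖ ^ 2 ≤ ‖g‖ ^ 2 := by
    gcongr
    exact V.norm_starProjection_apply_le g
  have hN : 0 ≤ ‖V.starProjection g‖ ^ 2 := by positivity
  generalize ‖V.starProjection g‖ ^ 2 = N at *
  generalize ‖g‖ ^ 2 = M at *
  -- both ratios lie in `[0, 1]`, so large `ε` is trivial
  rcases le_or_gt (1 / 2) ε with hε2 | hε2
  · have : N / M ≤ 1 := (div_le_one hg0).2 hle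
    have h3 : D / n ≤ 1 := (div_le_one hn).2 hD
    have h4 : 0 ≤ N / M := by positivity
    have h5 : 0 ≤ D / n := by positivity
    have := abs_sub_le_iff.2 (⟨by linarith, by linarith⟩ : N / M - D / n ≤ 1 ∧ D / n - N / M ≤ 1)
    linarith
  · rw [abs_lt] at hc1 hc2
    have hM : n / 2 ≤ M := by nlinarith
    have hkey : |N / M - D / n| ≤ 4 * ε := by
      rw [div_sub_div _ _ hg0.ne' hn.ne', abs_div, abs_of_pos (mul_pos hg0 hn),
        div_le_iff₀ (by positivity)]
      have h6 : |N * n - M * D| ≤ 2 * ε * n ^ 2 := by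
        rw [abs_le]
        constructor <;> nlinarith
      nlinarith
    linarith

/-! ### Projections to the complement of the span of finitely many vectors -/

/-- The orthogonal projection of `u` to the orthogonal complement of the span of `S`. -/
noncomputable abbrev perpProj {n : ℕ} (S : Set (CVec n)) (u : CVec n) : CVec n :=
  (Submodule.span ℂ S)ᗮ.starProjection u

theorem perpProj_mem {n : ℕ} (S : Set (CVec n)) (u : CVec n) :
    perpProj S u ∈ (Submodule.span ℂ S)ᗮ := Submodule.starProjection_apply_mem _ _

theorem inner_perpProj_eq_zero {n : ℕ} {S : Set (CVec n)} {s : CVec n} (hs : s ∈ S) (u : CVec n) :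
    inner ℂ s (perpProj S u) = 0 :=
  (Submodule.mem_orthogonal _ _).1 (perpProj_mem S u) s (Submodule.subset_span hs)

theorem inner_direction_perpProj_eq_zero {n : ℕ} {S : Set (CVec n)} {s : CVec n} (hs : s ∈ S)
    (u : CVec n) : inner ℂ s (direction (perpProj S u)) = 0 := by
  rw [direction, inner_smul_right, inner_perpProj_eq_zero hs, mul_zero]

theorem inner_perpProj_left {n : ℕ} (S : Set (CVec n)) (x y : CVec n) :
    inner ℂ (perpProj S x) y = inner ℂ x (perpProj S y) :=
  Submodule.inner_starProjection_left_eq_right _ x y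

theorem perpProj_perpProj {n : ℕ} (S : Set (CVec n)) (x : CVec n) :
    perpProj S (perpProj S x) = perpProj S x :=
  Submodule.starProjection_eq_self_iff.2 (perpProj_mem S x)

theorem perpProj_empty {n : ℕ} (u : CVec n) : perpProj ∅ u = u := by
  simp [perpProj, Submodule.starProjection_top]

theorem perpProj_eq {n : ℕ} {S : Set (CVec n)} {u v : CVec n} (hv : ∀ s ∈ S, inner ℂ s v = 0)
    (huv : u - v ∈ Submodule.span ℂ S) : perpProj S u = v := by
  refine Submodule.eq_starProjection_of_mem_of_inner_eq_zero ?_ fun w hw => ?_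
  · rw [← Submodule.span_singleton_le_iff_mem, ← Submodule.isOrtho_iff_le,
      Submodule.isOrtho_span]
    rintro _ rfl s hs
    rw [← inner_conj_symm, hv s hs, map_zero]
  · exact (Submodule.mem_orthogonal _ _).1 hw _ huv

theorem sub_perpProj_mem_span {n : ℕ} (S : Set (CVec n)) (u : CVec n) :
    u - perpProj S u ∈ Submodule.span ℂ S := by
  have := Submodule.sub_starProjection_mem_orthogonal (K := (Submodule.span ℂ S)ᗮ) u
  rwa [Submodule.orthogonal_orthogonal] at this

/-- The Gram–Schmidt step. -/
theorem perpProj_insert {n : ℕ} (S : Set (CVec n)) (x u : CVec n) :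
    perpProj (insert x S) u = perpProj S u -
      inner ℂ (direction (perpProj S x)) u • direction (perpProj S x) := by
  set d := direction (perpProj S x) with hd
  have hd' : (‖perpProj S x‖ : ℂ) • d = perpProj S x := norm_smul_direction _
  have hSd : ∀ s ∈ S, inner ℂ s d = 0 := fun s hs => inner_direction_perpProj_eq_zero hs x
  have hPd : perpProj S d = d := by
    rw [hd, direction, perpProj, map_smul]
    exact congrArg _ (perpProj_perpProj S x)
  refine perpProj_eq (fun s hs => ?_) ?_
  · rcases hs with rfl | hs
    · rw [inner_sub_right, inner_smul_right, ← inner_perpProj_left, ← hPd,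
        ← inner_perpProj_left S s, ← hd', hPd, inner_smul_left, inner_smul_left]
      by_cases h : d = 0
      · simp [h]
      · have h1 : ‖d‖ = 1 := by
          refine norm_direction fun h0 => h ?_
          rw [hd, h0, direction_zero]
        rw [inner_self_eq_norm_sq_to_K, h1]
        simp [mul_comm]
    · rw [inner_sub_right, inner_smul_right, inner_perpProj_eq_zero hs, hSd s hs]
      simp
  · have hmono : Submodule.span ℂ S ≤ Submodule.span ℂ (insert x S) :=
      Submodule.span_mono (Set.subset_insert _ _)
    have h1 : perpProj S x ∈ Submodule.span ℂ (insert x S) := by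
      have := Submodule.sub_mem _ (Submodule.subset_span (Set.mem_insert x S))
        (hmono (sub_perpProj_mem_span S x))
      rwa [sub_sub_cancel] at this
    rw [← sub_add]
    exact Submodule.add_mem _ (hmono (sub_perpProj_mem_span S u))
      (Submodule.smul_mem _ _ (Submodule.smul_mem _ _ h1))

theorem norm_perpProj_anti {n : ℕ} {S S' : Set (CVec n)} (h : S ⊆ S') (u : CVec n) :
    ‖perpProj S' u‖ ≤ ‖perpProj S u‖ := by
  have hle : (Submodule.span ℂ S')ᗮ ≤ (Submodule.span ℂ S)ᗮ :=
    Submodule.orthogonal_le (Submodule.span_mono h)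
  have h1 := congrArg (fun f => f u) (Submodule.starProjection_comp_starProjection_of_le hle)
  simp only [ContinuousLinearMap.comp_apply] at h1
  rw [perpProj, ← h1]
  exact Submodule.norm_starProjection_apply_le _ _

theorem perpProj_image_isometryEquiv {n : ℕ} (U : CVec n ≃ₗᵢ[ℂ] CVec n) (S : Set (CVec n))
    (u : CVec n) : perpProj (U '' S) (U u) = U (perpProj S u) := by
  refine perpProj_eq ?_ ?_
  · rintro _ ⟨s, hs, rfl⟩
    rw [U.inner_map_map, inner_perpProj_eq_zero hs]
  · rw [← map_sub]
    have h := Submodule.mem_map_of_mem (f := (U : CVec n →ₗ[ℂ] CVec n)) (sub_perpProj_mem_span S u)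
    rw [Submodule.map_span] at h
    exact h

theorem measurable_perpProj_image {α J : Type*} [MeasurableSpace α] {n : ℕ} {X : J → α → CVec n}
    (hX : ∀ j, Measurable (X j)) (F : Finset J) {u : α → CVec n} (hu : Measurable u) :
    Measurable fun a => perpProj ((fun j => X j a) '' (F : Set J)) (u a) := by
  classical
  induction F using Finset.induction_on generalizing u with
  | empty => simpa [perpProj_empty] using hu
  | insert j F _ ih =>
    simp only [Finset.coe_insert, Set.image_insert_eq, perpProj_insert]
    have hd : Measurable fun a =>
        direction (perpProj ((fun j => X j a) '' (F : Set J)) (X j a)) :=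
      measurable_direction.comp (ih (hX j))
    exact (ih hu).sub ((hd.inner (𝕜 := ℂ) hu).fun_smul hd)

theorem measurable_perpProj_image_set {α J : Type*} [Finite J] [MeasurableSpace α] {n : ℕ}
    {X : J → α → CVec n} (hX : ∀ j, Measurable (X j)) (s : Set J) {u : α → CVec n}
    (hu : Measurable u) : Measurable fun a => perpProj ((fun j => X j a) '' s) (u a) := by
  have := measurable_perpProj_image hX (s.toFinite.toFinset) hu
  simpa using this

/-- In the plane spanned by two unit vectors, the dual basis encloses the same angle as the
basis. -/
theorem sq_norm_inner_dual_le {n : ℕ} {a b : CVec n} (ha : ‖a‖ = 1) (hb : ‖b‖ = 1) :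
    ‖inner ℂ (direction (a - inner ℂ b a • b)) (direction (b - inner ℂ a b • a))‖ ^ 2 ≤
      ‖inner ℂ a b‖ ^ 2 := by
  set c := inner ℂ a b with hc
  have hba : inner ℂ b a = (starRingEnd ℂ) c := (inner_conj_symm b a).symm
  have haa : inner ℂ a a = (1 : ℂ) := by rw [inner_self_eq_norm_sq_to_K, ha]; simp
  have hbb : inner ℂ b b = (1 : ℂ) := by rw [inner_self_eq_norm_sq_to_K, hb]; simp
  have hcc : (starRingEnd ℂ) c * c = ((‖c‖ ^ 2 : ℝ) : ℂ) := by
    rw [← Complex.normSq_eq_conj_mul_self, Complex.normSq_eq_norm_sq]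
  have h1 : inner ℂ (a - inner ℂ b a • b) (b - c • a) = -c * ((1 - ‖c‖ ^ 2 : ℝ) : ℂ) := by
    rw [hba, inner_sub_left, inner_sub_right, inner_sub_right, inner_smul_right, inner_smul_left,
      inner_smul_left, inner_smul_right, haa, hbb, hba, ← hc, Complex.conj_conj]
    push_cast [← hcc]
    ring
  have hn1 : ‖a - inner ℂ b a • b‖ ^ 2 = 1 - ‖c‖ ^ 2 := by
    have : inner ℂ (a - inner ℂ b a • b) (a - inner ℂ b a • b) = ((1 - ‖c‖ ^ 2 : ℝ) : ℂ) := by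
      rw [hba, inner_sub_left, inner_sub_right, inner_sub_right, inner_smul_right, inner_smul_left,
        inner_smul_left, inner_smul_right, haa, hbb, hba, ← hc, Complex.conj_conj]
      rw [Complex.ofReal_sub, ← hcc]
      push_cast
      ring
    rw [← inner_self_eq_norm_sq (𝕜 := ℂ), this]
    exact Complex.ofReal_re _
  have hn2 : ‖b - c • a‖ ^ 2 = 1 - ‖c‖ ^ 2 := by
    have : inner ℂ (b - c • a) (b - c • a) = ((1 - ‖c‖ ^ 2 : ℝ) : ℂ) := by
      rw [inner_sub_left, inner_sub_right, inner_sub_right, inner_smul_right, inner_smul_left,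
        inner_smul_left, inner_smul_right, haa, hbb, hba, ← hc]
      rw [Complex.ofReal_sub, ← hcc]
      push_cast
      ring
    rw [← inner_self_eq_norm_sq (𝕜 := ℂ), this]
    exact Complex.ofReal_re _
  rw [norm_inner_direction_left_sq, norm_inner_direction_right_sq, h1, hn1, hn2, norm_mul,
    norm_neg, Complex.norm_real, Real.norm_eq_abs, mul_pow, sq_abs]
  by_cases h0 : 1 - ‖c‖ ^ 2 = 0
  · simp [h0]
  · apply le_of_eq
    field_simp

theorem direction_smul_of_pos {n : ℕ} {r : ℝ} (hr : 0 < r) (x : CVec n) :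
    direction ((r : ℂ) • x) = direction x := by
  rw [direction, direction, smul_smul, norm_smul, Complex.norm_real, Real.norm_eq_abs,
    abs_of_pos hr, ← Complex.ofReal_mul]
  congr 2
  field_simp

/-- The angle between two zero-forcing beams: it is bounded by the angle between the two channels
after projecting out all other channels. -/
theorem sq_norm_inner_beams_le {n : ℕ} (S : Set (CVec n)) (x y : CVec n) :
    ‖inner ℂ (direction (perpProj (insert y S) x)) (direction (perpProj (insert x S) y))‖ ^ 2 ≤
      ‖inner ℂ (direction (perpProj S x)) y‖ ^ 2 / ‖perpProj S y‖ ^ 2 := by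
  rw [perpProj_insert, perpProj_insert]
  set a := perpProj S x with ha
  set b := perpProj S y with hb
  have hdir : ∀ z w : CVec n,
      inner ℂ (direction (perpProj S z)) w = inner ℂ (direction (perpProj S z)) (perpProj S w) := by
    intro z w
    rw [direction, inner_smul_left, inner_smul_left, inner_perpProj_left,
      inner_perpProj_left, perpProj_perpProj]
  by_cases hx : a = 0
  · have h : inner ℂ (direction b) x = 0 := by rw [hb, hdir, ← ha, hx, inner_zero_right]
    simp [hx, h, direction_zero]
  by_cases hy : b = 0
  · have h : inner ℂ (direction a) y = 0 := by rw [ha, hdir, ← hb, hy, inner_zero_right]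
    simp [hy, h, direction_zero]
  have hna : 0 < ‖a‖ := norm_pos_iff.2 hx
  have hnb : 0 < ‖b‖ := norm_pos_iff.2 hy
  have h1 : a - inner ℂ (direction b) x • direction b = ((‖a‖ : ℝ) : ℂ) •
      (direction a - inner ℂ (direction b) (direction a) • direction b) := by
    rw [smul_sub, smul_smul, ← inner_smul_right, norm_smul_direction, hb, hdir, ← ha]
  have h2 : b - inner ℂ (direction a) y • direction a = ((‖b‖ : ℝ) : ℂ) •
      (direction b - inner ℂ (direction a) (direction b) • direction a) := by
    rw [smul_sub, smul_smul, ← inner_smul_right, norm_smul_direction, ha, hdir, ← hb]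
  rw [h1, h2, direction_smul_of_pos hna, direction_smul_of_pos hnb]
  refine (sq_norm_inner_dual_le (norm_direction hx) (norm_direction hy)).trans (le_of_eq ?_)
  rw [norm_inner_direction_right_sq, ha, hdir x y]

theorem finrank_span_of_perpProj_ne_zero {n : ℕ} {J : Type*} [Fintype J] {X : J → CVec n}
    (hX : ∀ j, perpProj (X '' {k | k ≠ j}) (X j) ≠ 0) :
    Module.finrank ℂ (Submodule.span ℂ (Set.range X)) = Fintype.card J := by
  refine finrank_span_eq_card ?_
  rw [linearIndependent_iff_notMem_span]
  intro j hj
  refine hX j ?_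
  have : Set.univ \ {j} = {k | k ≠ j} := by ext; simp
  rw [this] at hj
  refine perpProj_eq (fun s _ => inner_zero_right _) ?_
  rwa [sub_zero]

theorem finrank_orthogonal_span {n : ℕ} (S : Set (CVec n)) :
    (Module.finrank ℂ (Submodule.span ℂ S)ᗮ : ℝ) =
      n - Module.finrank ℂ (Submodule.span ℂ S) := by
  have h := Submodule.finrank_add_finrank_orthogonal (Submodule.span ℂ S)
  rw [finrank_euclideanSpace_fin] at h
  have h' := congrArg (Nat.cast : ℕ → ℝ) h
  push_cast at h'
  linarith

/-! ### Averaging over product measures -/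

section Averaging

variable {α β : Type*} [MeasurableSpace α] [MeasurableSpace β]

theorem prod_real_le_of_slice_le {μ : Measure α} {ν : Measure β} [IsProbabilityMeasure μ]
    [IsProbabilityMeasure ν] {B : Set (α × β)} (hB : MeasurableSet B) {ε : ℝ} (hε : 0 ≤ ε)
    (h : ∀ᵐ a ∂μ, ν.real {b | (a, b) ∈ B} ≤ ε) : (μ.prod ν).real B ≤ ε := by
  rw [measureReal_def, Measure.prod_apply hB]
  refine ENNReal.toReal_le_of_le_ofReal hε ?_
  calc ∫⁻ a, ν (Prod.mk a ⁻¹' B) ∂μ ≤ ∫⁻ _, ENNReal.ofReal ε ∂μ := by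
        refine lintegral_mono_ae ?_
        filter_upwards [h] with a ha
        exact (ENNReal.le_ofReal_iff_toReal_le (measure_ne_top _ _) hε).2 ha
    _ = _ := by simp

/-- If the slices of `B` at almost every `a` have the same measure `c`, then `c` may be estimated
through the other slices of `B`, outside an exceptional set `Gᶜ`. -/
theorem le_of_slice_eq_of_slice_le {μ : Measure α} {ν : Measure β} [IsProbabilityMeasure μ]
    [IsProbabilityMeasure ν] {B : Set (α × β)} (hB : MeasurableSet B) {G : Set β}
    (hG : MeasurableSet G) {c ε : ℝ} (hε : 0 ≤ ε) (hc : ∀ᵐ a ∂μ, c = ν.real {b | (a, b) ∈ B})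
    (h : ∀ b ∈ G, μ.real {a | (a, b) ∈ B} ≤ ε) : c ≤ ν.real Gᶜ + ε := by
  have h1 : c = (μ.prod ν).real B := by
    rw [measureReal_def, Measure.prod_apply hB]
    have : ∀ᵐ a ∂μ, ν (Prod.mk a ⁻¹' B) = ENNReal.ofReal c := by
      filter_upwards [hc] with a ha
      rw [ha, measureReal_def, ENNReal.ofReal_toReal (measure_ne_top _ _)]
      rfl
    have hc0 : 0 ≤ c := by
      obtain ⟨a, ha⟩ := hc.exists
      rw [ha]
      exact measureReal_nonneg
    rw [lintegral_congr_ae this]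
    simp [hc0]
  have h2 : (μ.prod ν).real (B ∩ Prod.snd ⁻¹' G) ≤ ε := by
    have hBG : MeasurableSet (B ∩ Prod.snd ⁻¹' G) := hB.inter (measurable_snd hG)
    rw [← Measure.prod_swap, map_measureReal_apply measurable_swap hBG]
    refine prod_real_le_of_slice_le (measurable_swap hBG) hε (ae_of_all _ fun b => ?_)
    by_cases hb : b ∈ G
    · exact (measureReal_mono fun a ha => ha.1).trans (h b hb)
    · have : {a : α | (b, a) ∈ Prod.swap ⁻¹' (B ∩ Prod.snd ⁻¹' G)} = ∅ := by
        ext a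
        simp [hb]
      rw [this, measureReal_empty]
      exact hε
  have h3 : (μ.prod ν).real (Prod.snd ⁻¹' Gᶜ) = ν.real Gᶜ :=
    measurePreserving_snd.measureReal_preimage hG.compl.nullMeasurableSet
  rw [h1]
  calc (μ.prod ν).real B ≤ (μ.prod ν).real ((B ∩ Prod.snd ⁻¹' G) ∪ (Prod.snd ⁻¹' Gᶜ)) := by
        refine measureReal_mono fun z hz => ?_
        by_cases hzG : z.2 ∈ G
        · exact Or.inl ⟨hz, hzG⟩
        · exact Or.inr hzG
    _ ≤ _ := (measureReal_union_le _ _).trans (by linarith)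

/-- Resampling one coordinate preserves a product of probability measures. -/
theorem measurePreserving_update {J : Type*} [Fintype J] [DecidableEq J] (μ : J → Measure α)
    [∀ j, IsProbabilityMeasure (μ j)] (j : J) :
    MeasurePreserving (fun z : (J → α) × α => Function.update z.1 j z.2)
      ((Measure.pi μ).prod (μ j)) (Measure.pi μ) := by
  have hm : Measurable (fun z : (J → α) × α => Function.update z.1 j z.2) := by
    refine measurable_pi_iff.2 fun k => ?_
    by_cases hk : k = j
    · subst hk
      simpa using measurable_snd
    · simp only [Function.update_of_ne hk]
      fun_prop
  refine ⟨hm, (Measure.pi_eq fun s hs => ?_).symm⟩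
  rw [Measure.map_apply hm (MeasurableSet.univ_pi hs)]
  have : (fun z : (J → α) × α => Function.update z.1 j z.2) ⁻¹' Set.univ.pi s =
      (Set.univ.pi (Function.update s j Set.univ)) ×ˢ s j := by
    ext z
    simp only [Set.mem_preimage, Set.mem_univ_pi, Set.mem_prod]
    constructor
    · intro h
      refine ⟨fun k => ?_, by simpa using h j⟩
      by_cases hk : k = j
      · subst hk; simp
      · simpa [hk] using h k
    · rintro ⟨h1, h2⟩ k
      by_cases hk : k = j
      · subst hk; simpa using h2
      · simpa [hk] using h1 k
  rw [this, Measure.prod_prod, Measure.pi_pi, ← Finset.prod_erase_mul _ _ (Finset.mem_univ j),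
    ← Finset.prod_erase_mul _ _ (Finset.mem_univ j)]
  simp only [Function.update_self, measure_univ, mul_one]
  congr 1
  refine Finset.prod_congr rfl fun k hk => ?_
  rw [Function.update_of_ne (Finset.ne_of_mem_erase hk)]

/-- To bound an event it is enough to resample the coordinate `j` and to bound the event
conditionally on all other coordinates. -/
theorem pi_real_le_of_update_le {J : Type*} [Fintype J] [DecidableEq J] {μ : J → Measure α}
    [∀ j, IsProbabilityMeasure (μ j)] (j : J) {B : Set (J → α)} (hB : MeasurableSet B) {ε : ℝ}
    (hε : 0 ≤ ε) (h : ∀ᵐ y ∂Measure.pi μ, (μ j).real {u | Function.update y j u ∈ B} ≤ ε) :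
    (Measure.pi μ).real B ≤ ε := by
  have hmp := measurePreserving_update μ j
  rw [← hmp.measureReal_preimage hB.nullMeasurableSet]
  exact prod_real_le_of_slice_le (hmp.measurable hB) hε h

end Averaging

/-! ### Zero-forcing beams of independent isotropic vectors -/

section Beams

variable {n : ℕ} {J : Type*}

theorem measurable_perpProj_range {α : Type*} [Finite J] [MeasurableSpace α]
    {X : J → α → CVec n} (hX : ∀ j, Measurable (X j)) {u : α → CVec n} (hu : Measurable u) :
    Measurable fun a => perpProj (Set.range fun j => X j a) (u a) := by
  simpa only [Set.image_univ] using measurable_perpProj_image_set hX Set.univ hu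

theorem range_update [DecidableEq J] (x : J → CVec n) (j : J) (p : CVec n) :
    Set.range (Function.update x j p) = insert p (x '' {k | k ≠ j}) := by
  ext y
  simp only [Set.mem_range, Set.mem_insert_iff, Set.mem_image, Set.mem_ofPred_eq]
  constructor
  · rintro ⟨k, rfl⟩
    by_cases hk : k = j
    · subst hk; simp
    · exact Or.inr ⟨k, hk, by simp [hk]⟩
  · rintro (rfl | ⟨k, hk, rfl⟩)
    · exact ⟨j, by simp⟩
    · exact ⟨k, by simp [hk]⟩

/-- The component of the channel `x j` orthogonal to `p` and to the channels `x k`, `k ≠ j`. -/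
noncomputable def zfResidual [DecidableEq J] (p : CVec n) (x : J → CVec n) (j : J) : CVec n :=
  perpProj (Set.range (Function.update x j p)) (x j)

/-- The zero-forcing beam of user `j` when the channels are `p` and the family `x`. -/
noncomputable def beam [DecidableEq J] (p : CVec n) (x : J → CVec n) (j : J) : CVec n :=
  direction (zfResidual p x j)

/-- The direction of the component of `x j` orthogonal to `p` and to the channels `x l`,
`l ≠ j, k`. -/
noncomputable def pairBeam [DecidableEq J] (p : CVec n) (x : J → CVec n) (j k : J) : CVec n :=
  direction (perpProj (insert p (x '' {l | l ≠ j ∧ l ≠ k})) (x j))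

theorem measurable_update_apply {α E : Type*} [MeasurableSpace α] [MeasurableSpace E]
    [DecidableEq J] {x : α → J → E} (hx : Measurable x) (j : J) {p : α → E} (hp : Measurable p)
    (k : J) : Measurable fun a => Function.update (x a) j (p a) k := by
  by_cases hk : k = j
  · subst hk; simpa using hp
  · simp only [Function.update_of_ne hk]; fun_prop

theorem measurable_zfResidual [DecidableEq J] [Finite J] {α : Type*} [MeasurableSpace α]
    {p : α → CVec n} (hp : Measurable p) {x : α → J → CVec n} (hx : Measurable x) (j : J) :
    Measurable fun a => zfResidual (p a) (x a) j :=
  measurable_perpProj_range (X := fun k a => Function.update (x a) j (p a) k)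
    (measurable_update_apply hx j hp) (by fun_prop)

theorem measurable_beam [DecidableEq J] [Finite J] {α : Type*} [MeasurableSpace α]
    {p : α → CVec n} (hp : Measurable p) {x : α → J → CVec n} (hx : Measurable x) (j : J) :
    Measurable fun a => beam (p a) (x a) j :=
  measurable_direction.comp (measurable_zfResidual hp hx j)

theorem measurable_pairBeam [DecidableEq J] [Finite J] {α : Type*} [MeasurableSpace α]
    {p : α → CVec n} (hp : Measurable p) {x : α → J → CVec n} (hx : Measurable x) (j k : J) :
    Measurable fun a => pairBeam (p a) (x a) j k := by
  refine measurable_direction.comp ?_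
  have h1 := measurable_perpProj_image_set (X := fun l a => x a l) (fun l => by fun_prop)
    {l | l ≠ j ∧ l ≠ k} (u := fun a => x a j) (by fun_prop)
  have h2 := measurable_perpProj_image_set (X := fun l a => x a l) (fun l => by fun_prop)
    {l | l ≠ j ∧ l ≠ k} (u := p) hp
  have hd := measurable_direction.comp h2
  have hxj : Measurable fun a => x a j := by fun_prop
  simp only [perpProj_insert]
  exact Measurable.sub h1 ((hd.inner (𝕜 := ℂ) hxj).fun_smul hd)

theorem inner_beam_eq_zero [DecidableEq J] (p : CVec n) (x : J → CVec n) (j : J) :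
    inner ℂ p (beam p x j) = 0 := by
  refine inner_direction_perpProj_eq_zero ?_ _
  rw [range_update]
  exact Set.mem_insert _ _

theorem zfResidual_map [DecidableEq J] (U : CVec n ≃ₗᵢ[ℂ] CVec n) (p : CVec n) (x : J → CVec n)
    (j : J) : zfResidual (U p) (fun k => U (x k)) j = U (zfResidual p x j) := by
  rw [zfResidual, zfResidual, ← perpProj_image_isometryEquiv, ← Set.range_comp]
  congr 2
  ext k
  by_cases hk : k = j
  · subst hk; simp
  · simp [hk]

theorem beam_map [DecidableEq J] (U : CVec n ≃ₗᵢ[ℂ] CVec n) (p : CVec n) (x : J → CVec n)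
    (j : J) : beam (U p) (fun k => U (x k)) j = U (beam p x j) := by
  rw [beam, zfResidual_map, beam, map_direction]

/-- The vector `x k` is independent of `pairBeam p x j k`, so the right-hand side is small with high
probability although the two beams on the left depend on all channels. -/
theorem sq_norm_inner_beam_le [DecidableEq J] (p : CVec n) (x : J → CVec n) {j k : J}
    (hjk : j ≠ k) : ‖inner ℂ (beam p x j) (beam p x k)‖ ^ 2 ≤
      ‖inner ℂ (pairBeam p x j k) (x k)‖ ^ 2 / ‖zfResidual p x k‖ ^ 2 := by
  set S := insert p (x '' {l | l ≠ j ∧ l ≠ k}) with hS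
  have h1 : Set.range (Function.update x j p) = insert (x k) S := by
    rw [range_update, hS, Set.insert_comm, ← Set.image_insert_eq]
    congr 2
    ext l
    simp only [Set.mem_ofPred_eq, Set.mem_insert_iff]
    by_cases hl : l = k
    · simp [hl, hjk.symm]
    · simp [hl]
  have h2 : Set.range (Function.update x k p) = insert (x j) S := by
    rw [range_update, hS, Set.insert_comm, ← Set.image_insert_eq]
    congr 2
    ext l
    simp only [Set.mem_ofPred_eq, Set.mem_insert_iff]
    by_cases hl : l = j
    · simp [hl, hjk]
    · simp [hl]
  have h3 := sq_norm_inner_beams_le S (x j) (x k)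
  rw [beam, beam, zfResidual, zfResidual, h1, h2]
  by_cases h0 : perpProj (insert (x j) S) (x k) = 0
  · simp [h0, direction_zero]
  · refine h3.trans ?_
    have h4 := norm_perpProj_anti (Set.subset_insert (x j) S) (x k)
    have h5 : 0 < ‖perpProj (insert (x j) S) (x k)‖ := norm_pos_iff.2 h0
    rw [pairBeam]
    gcongr

/-- The configurations in which every channel keeps a fixed share `η` of its energy after
zero-forcing and no two beams are close to parallel. The threshold `1 / √n` lies well above the
typical size `1 / n` of the squared inner products, which makes the exceptional probabilities
exponentially small in `√n`, and is still small enough for `sum_sq_norm_inner_beam_le`. -/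
def wellSpread [DecidableEq J] (η : ℝ) (p : CVec n) : Set (J → CVec n) :=
  {x | (∀ j, η ≤ ‖zfResidual p x j‖ ^ 2) ∧
    ∀ j k, j ≠ k → ‖inner ℂ (pairBeam p x j k) (x k)‖ ^ 2 ≤ 1 / √n}

theorem measurableSet_wellSpread [DecidableEq J] [Finite J] (η : ℝ) (p : CVec n) :
    MeasurableSet (wellSpread η p : Set (J → CVec n)) := by
  have h1 : ∀ j : J, Measurable fun x : J → CVec n => zfResidual p x j := fun j =>
    measurable_zfResidual measurable_const measurable_id j
  have h2 : ∀ j k : J, Measurable fun x : J → CVec n => pairBeam p x j k := fun j k =>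
    measurable_pairBeam measurable_const measurable_id j k
  have : (wellSpread η p : Set (J → CVec n)) =
      (⋂ j, {x | η ≤ ‖zfResidual p x j‖ ^ 2}) ∩
        ⋂ j, ⋂ k, ⋂ (_ : j ≠ k), {x | ‖inner ℂ (pairBeam p x j k) (x k)‖ ^ 2 ≤ 1 / √n} := by
    ext x
    simp [wellSpread]
  rw [this]
  have := Finite.to_countable (α := J)
  refine (MeasurableSet.iInter fun j => measurableSet_le measurable_const
    ((h1 j).norm.pow_const 2)).inter
    (MeasurableSet.iInter fun j => MeasurableSet.iInter fun k => MeasurableSet.iInter fun _ =>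
      measurableSet_le ?_ measurable_const)
  exact (((h2 j k).inner (𝕜 := ℂ) (by fun_prop)).norm.pow_const 2)

theorem norm_beam_of_wellSpread [DecidableEq J] {p : CVec n} {η : ℝ} (hη : 0 < η) {x : J → CVec n}
    (hx : x ∈ wellSpread η p) (j : J) : ‖beam p x j‖ = 1 := by
  refine norm_direction fun h => ?_
  have := hx.1 j
  rw [h] at this
  simp at this
  linarith

variable [Fintype J] [DecidableEq J]

theorem pi_zfResidual_lt_le [NeZero n] (p : CVec n) {η : ℝ} (hη : 0 < η)
    (hgap : 2 * η ≤ 1 - (Fintype.card J : ℝ) / n) (j : J) :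
    (Measure.pi fun _ : J => isotropicLaw n).real {x | ‖zfResidual p x j‖ ^ 2 < η} ≤
      8 * Real.exp (-(η * √n) / 8) := by
  have hm : Measurable fun x : J → CVec n => zfResidual p x j :=
    measurable_zfResidual measurable_const measurable_id j
  refine pi_real_le_of_update_le j (measurableSet_lt (hm.norm.pow_const 2) measurable_const)
    (by positivity) (ae_of_all _ fun y => ?_)
  set V := (Submodule.span ℂ (Set.range (Function.update y j p)))ᗮ with hV
  have hfr : 2 * η ≤ (Module.finrank ℂ V : ℝ) / n := by
    have hn : (0 : ℝ) < n := by exact_mod_cast NeZero.pos n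
    have h1 : (Module.finrank ℂ (Submodule.span ℂ (Set.range (Function.update y j p))) : ℝ) ≤
        Fintype.card J := by
      exact_mod_cast finrank_range_le_card (R := ℂ) (Function.update y j p)
    rw [hV, finrank_orthogonal_span, sub_div, div_self hn.ne']
    have : (Module.finrank ℂ (Submodule.span ℂ (Set.range (Function.update y j p))) : ℝ) / n ≤
        Fintype.card J / n := by gcongr
    linarith
  refine (measureReal_mono fun u hu => ?_).trans
    ((isotropicLaw_starProjection_tail V (ε := η / 4) (by positivity)).trans (le_of_eq ?_))
  · simp only [Set.mem_ofPred_eq, zfResidual, Function.update_idem, Function.update_self] at hu ⊢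
    rw [lt_abs]
    right
    change ‖V.starProjection u‖ ^ 2 < η at hu
    linarith
  · congr 2; ring

theorem pi_inner_pairBeam_gt_le [NeZero n] (hn : 2 ≤ n) (p : CVec n) {j k : J} (hjk : j ≠ k) :
    (Measure.pi fun _ : J => isotropicLaw n).real
      {x | 1 / √n < ‖inner ℂ (pairBeam p x j k) (x k)‖ ^ 2} ≤ Real.exp (-√n / 2) := by
  have hm : Measurable fun x : J → CVec n => pairBeam p x j k :=
    measurable_pairBeam measurable_const measurable_id j k
  refine pi_real_le_of_update_le k (measurableSet_lt measurable_const
    (((hm.inner (𝕜 := ℂ) (by fun_prop)).norm.pow_const 2))) (by positivity)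
    (ae_of_all _ fun y => ?_)
  set u := pairBeam p y j k with hu
  have hpb : ∀ c, pairBeam p (Function.update y k c) j k = u := by
    intro c
    rw [hu, pairBeam, pairBeam, Function.update_of_ne hjk]
    congr 3
    refine Set.image_congr fun l hl => ?_
    rw [Function.update_of_ne hl.2]
  have hn' : (2 : ℝ) ≤ n := by exact_mod_cast hn
  have hs : 1 < √(n : ℝ) := Real.lt_sqrt_of_sq_lt (by linarith)
  have hsq : √(n : ℝ) ^ 2 = n := Real.sq_sqrt (by linarith)
  simp only [Set.mem_ofPred_eq, Function.update_self, hpb]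
  by_cases h0 : u = 0
  · have : {c : CVec n | 1 / √(n : ℝ) < ‖inner ℂ u c‖ ^ 2} = ∅ := by
      ext c
      simp [h0]
    rw [this, measureReal_empty]
    positivity
  have hu1 : ‖u‖ = 1 := by
    refine norm_direction fun h => h0 ?_
    rw [hu, pairBeam, h, direction_zero]
  have hx1 : 1 / √(n : ℝ) < 1 := (div_lt_one (by linarith)).2 hs
  rw [isotropicLaw_sq_norm_inner_gt hu1 (by positivity) hx1]
  calc (1 - 1 / √(n : ℝ)) ^ (n - 1) ≤ Real.exp (-(1 / √(n : ℝ))) ^ (n - 1) := by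
        refine pow_le_pow_left₀ (by linarith) ?_ _
        exact Real.one_sub_le_exp_neg _
    _ = Real.exp (-((n - 1) / √n)) := by
        rw [← Real.exp_nat_mul, Nat.cast_sub (by omega)]
        congr 1
        push_cast
        ring
    _ ≤ _ := by
        rw [Real.exp_le_exp, neg_div, neg_le_neg_iff, div_le_div_iff₀ (by norm_num) (by linarith)]
        nlinarith

/-- A union bound over the channels and the pairs of channels. -/
theorem pi_compl_wellSpread_le [NeZero n] (hn : 2 ≤ n) (p : CVec n) {η : ℝ} (hη : 0 < η)
    (hgap : 2 * η ≤ 1 - (Fintype.card J : ℝ) / n) :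
    (Measure.pi fun _ : J => isotropicLaw n).real (wellSpread η p)ᶜ ≤
      9 * n ^ 2 * Real.exp (-(η * √n) / 8) := by
  set M := Measure.pi fun _ : J => isotropicLaw n
  have hn0 : (0 : ℝ) < n := by exact_mod_cast NeZero.pos n
  have hn1 : (1 : ℝ) ≤ n := by exact_mod_cast NeZero.pos n
  have hd : (Fintype.card J : ℝ) ≤ n := by
    have : (Fintype.card J : ℝ) / n ≤ 1 := by linarith
    exact (div_le_one hn0).1 this
  have hη1 : η ≤ 1 := by
    have : 0 ≤ (Fintype.card J : ℝ) / n := by positivity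
    linarith
  have hsub : (wellSpread η p : Set (J → CVec n))ᶜ ⊆
      (⋃ j, {x | ‖zfResidual p x j‖ ^ 2 < η}) ∪
      ⋃ jk : J × J, if jk.1 = jk.2 then ∅ else
        {x | 1 / √n < ‖inner ℂ (pairBeam p x jk.1 jk.2) (x jk.2)‖ ^ 2} := by
    intro x hx
    by_contra hcon
    simp only [Set.mem_union, Set.mem_iUnion, not_or, not_exists, Set.mem_ofPred_eq, not_lt] at hcon
    refine hx ⟨hcon.1, fun j k hjk => ?_⟩
    have := hcon.2 (j, k)
    rw [if_neg hjk] at this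
    simpa using this
  have h2 : ∀ jk : J × J, M.real (if jk.1 = jk.2 then ∅ else
        {x | 1 / √n < ‖inner ℂ (pairBeam p x jk.1 jk.2) (x jk.2)‖ ^ 2}) ≤
        Real.exp (-(η * √n) / 8) := by
    intro jk
    split_ifs with h
    · rw [measureReal_empty]; positivity
    · refine (pi_inner_pairBeam_gt_le hn p h).trans ?_
      rw [Real.exp_le_exp]
      have := Real.sqrt_nonneg (n : ℝ)
      nlinarith
  calc M.real (wellSpread η p)ᶜ ≤ _ := measureReal_mono hsub
    _ ≤ _ := measureReal_union_le _ _
    _ ≤ ∑ _j : J, 8 * Real.exp (-(η * √n) / 8) +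
        ∑ _jk : J × J, Real.exp (-(η * √n) / 8) := by
        refine add_le_add ((measureReal_iUnion_fintype_le _).trans
          (Finset.sum_le_sum fun j _ => pi_zfResidual_lt_le p hη hgap j))
          ((measureReal_iUnion_fintype_le _).trans (Finset.sum_le_sum fun jk _ => h2 jk))
    _ = (8 * Fintype.card J + (Fintype.card J : ℝ) ^ 2) * Real.exp (-(η * √n) / 8) := by
        simp only [Finset.sum_const, Finset.card_univ, Fintype.card_prod, nsmul_eq_mul]
        push_cast
        ring
    _ ≤ _ := by
        gcongr
        have : (0 : ℝ) ≤ Fintype.card J := Nat.cast_nonneg _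
        nlinarith

/-- The squared Hilbert–Schmidt norm of the Gram matrix of the beams is `O(n^(3/2))`, which is
`o(n²)`: this is what makes the interference concentrate. -/
theorem sum_sq_norm_inner_beam_le [NeZero n] {p : CVec n} {η : ℝ} (hη : 0 < η) (hη1 : η ≤ 1)
    (hd : (Fintype.card J : ℝ) ≤ n) {x : J → CVec n} (hx : x ∈ wellSpread η p) :
    ∑ j, ∑ k, ‖inner ℂ (beam p x j) (beam p x k)‖ ^ 2 ≤ 2 * (n * √n) / η := by
  have hn1 : (1 : ℝ) ≤ n := by exact_mod_cast NeZero.pos n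
  have hs : 1 ≤ √(n : ℝ) := Real.one_le_sqrt.2 hn1
  have hsq : √(n : ℝ) ^ 2 = n := Real.sq_sqrt (by linarith)
  set d : ℝ := (Fintype.card J : ℝ) with hdd
  have hd0 : 0 ≤ d := Nat.cast_nonneg _
  have hterm : ∀ j k, ‖inner ℂ (beam p x j) (beam p x k)‖ ^ 2 ≤
      (if j = k then 1 else 0) + 1 / (√n * η) := by
    intro j k
    by_cases hjk : j = k
    · subst hjk
      rw [inner_self_eq_norm_sq_to_K, norm_beam_of_wellSpread hη hx]
      simp
      positivity
    · rw [if_neg hjk, zero_add]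
      refine (sq_norm_inner_beam_le p x hjk).trans ?_
      rw [← div_div]
      exact div_le_div₀ (by positivity) (hx.2 j k hjk) hη (hx.1 k)
  calc _ ≤ ∑ j : J, ∑ k : J, ((if j = k then 1 else 0) + 1 / (√n * η)) :=
        Finset.sum_le_sum fun j _ => Finset.sum_le_sum fun k _ => hterm j k
    _ = d + d ^ 2 / (√n * η) := by
        simp only [Finset.sum_add_distrib, Finset.sum_ite_eq, Finset.mem_univ, if_true,
          Finset.sum_const, Finset.card_univ, nsmul_eq_mul, ← hdd]
        ring
    _ ≤ n * √n / η + n * √n / η := by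
        refine add_le_add ?_ ?_
        · rw [le_div_iff₀ hη]
          calc d * η ≤ n * 1 := by gcongr
            _ ≤ n * √n := by gcongr
        · rw [div_le_div_iff₀ (by positivity) hη]
          have : d ^ 2 ≤ n ^ 2 := by gcongr
          calc d ^ 2 * η ≤ n ^ 2 * η := by gcongr
            _ = n * √n * (√n * η) := by rw [mul_assoc, ← mul_assoc (√n), ← sq, hsq]; ring
    _ = _ := by ring

theorem finrank_span_of_wellSpread {p : CVec n} {η : ℝ} (hη : 0 < η) {x : J → CVec n}
    (hx : x ∈ wellSpread η p) :
    Module.finrank ℂ (Submodule.span ℂ (Set.range x)) = Fintype.card J := by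
  refine finrank_span_of_perpProj_ne_zero fun j h => ?_
  have h1 := norm_perpProj_anti (Set.subset_insert p (x '' {k | k ≠ j})) (x j)
  rw [← range_update, h, norm_zero] at h1
  have h2 := hx.1 j
  rw [zfResidual, norm_le_zero_iff.1 h1, norm_zero] at h2
  linarith [h2, zero_pow (M₀ := ℝ) two_ne_zero]

end Beams

/-! ### Concentration of signal and interference for fixed directions -/

theorem measurePreserving_pi_isometryEquiv {n : ℕ} [NeZero n] {J : Type*} [Fintype J]
    (U : CVec n ≃ₗᵢ[ℂ] CVec n) :
    MeasurePreserving (fun (x : J → CVec n) j => U (x j))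
      (Measure.pi fun _ : J => isotropicLaw n) (Measure.pi fun _ : J => isotropicLaw n) :=
  measurePreserving_pi _ _ fun _ =>
    ⟨U.continuous.measurable, isotropicLaw_map_isometryEquiv U⟩

/-- A sum `∑ⱼ |g† qⱼ|²` over fixed vectors `qⱼ` concentrates around `∑ⱼ ‖qⱼ‖²`, at the scale of
the Hilbert-Schmidt norm of the Gram matrix of the `qⱼ`. -/
theorem gaussianVec_sum_sq_norm_inner_tail {n : ℕ} {J : Type*} [Fintype J] (q : J → CVec n)
    {K : ℝ} (hK : 0 < K) (hq : ∑ j, ∑ k, ‖inner ℂ (q j) (q k)‖ ^ 2 ≤ K) (τ : ℝ) :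
    (gaussianVec n).real {g | τ ≤ |∑ j, ‖inner ℂ g (q j)‖ ^ 2 - ∑ j, ‖q j‖ ^ 2|} ≤
      4 * Real.exp (-τ / (2 * √K)) := by
  set T : CVec n →ₗ[ℂ] CVec n := ∑ j, ((innerSL ℂ (q j) : CVec n →ₗ[ℂ] ℂ).smulRight (q j)) with hT
  have hTa : ∀ g, T g = ∑ j, inner ℂ (q j) g • q j := by
    intro g
    simp [hT]
  have hsym : T.IsSymmetric := by
    intro g g'
    rw [hTa, hTa, sum_inner, inner_sum]
    refine Finset.sum_congr rfl fun j _ => ?_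
    rw [inner_smul_left, inner_smul_right, inner_conj_symm, mul_comm]
  have hform : ∀ g, (inner ℂ g (T g)).re = ∑ j, ‖inner ℂ g (q j)‖ ^ 2 := by
    intro g
    rw [hTa, inner_sum, Complex.re_sum]
    refine Finset.sum_congr rfl fun j _ => ?_
    rw [inner_smul_right, ← inner_conj_symm, ← Complex.normSq_eq_conj_mul_self, Complex.ofReal_re,
      Complex.normSq_eq_norm_sq]
  have e := EuclideanSpace.basisFun (Fin n) ℂ
  have htr : ∑ k, (inner ℂ (e k) (T (e k))).re = ∑ j, ‖q j‖ ^ 2 := by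
    simp_rw [hform]
    rw [Finset.sum_comm]
    exact Finset.sum_congr rfl fun j _ => e.sum_sq_norm_inner_right (q j)
  have hHS : ∑ k, ‖T (e k)‖ ^ 2 = ∑ j, ∑ k, ‖inner ℂ (q j) (q k)‖ ^ 2 := by
    have h1 : ∀ g, (‖T g‖ ^ 2 : ℂ) = ∑ j, ∑ k,
        inner ℂ g (q j) * inner ℂ (q k) g * inner ℂ (q j) (q k) := by
      intro g
      have := inner_self_eq_norm_sq_to_K (𝕜 := ℂ) (T g)
      rw [hTa, sum_inner] at this
      rw [hTa]
      refine this.symm.trans (Finset.sum_congr rfl fun j _ => ?_)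
      rw [inner_sum]
      refine Finset.sum_congr rfl fun k _ => ?_
      rw [inner_smul_left, inner_smul_right, inner_conj_symm, mul_assoc]
    have h2 : ((∑ k, ‖T (e k)‖ ^ 2 : ℝ) : ℂ) =
        ((∑ j, ∑ k, ‖inner ℂ (q j) (q k)‖ ^ 2 : ℝ) : ℂ) := by
      push_cast
      simp_rw [h1]
      rw [Finset.sum_comm]
      refine Finset.sum_congr rfl fun j _ => ?_
      rw [Finset.sum_comm]
      refine Finset.sum_congr rfl fun k _ => ?_
      rw [← Finset.sum_mul]
      have h3 : ∑ i, inner ℂ (e i) (q j) * inner ℂ (q k) (e i) = inner ℂ (q k) (q j) := by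
        rw [← e.sum_inner_mul_inner]
        exact Finset.sum_congr rfl fun i _ => mul_comm _ _
      rw [h3, ← inner_conj_symm (q k), ← Complex.normSq_eq_conj_mul_self,
        Complex.normSq_eq_norm_sq]
      push_cast
      rfl
    exact Complex.ofReal_injective h2
  have := gaussianVec_quadratic_tail T hsym hK e (hHS ▸ hq) τ
  rw [htr] at this
  simpa only [hform] using this

theorem orthonormal_pair {n : ℕ} {p z : CVec n} (hp : ‖p‖ = 1) (hz : ‖z‖ = 1)
    (hpz : inner ℂ p z = 0) : Orthonormal ℂ ![p, z] := by
  refine ⟨fun i => ?_, fun i j hij => ?_⟩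
  · fin_cases i <;> simp [hp, hz]
  · have hzp : inner ℂ z p = 0 := by rw [← inner_conj_symm, hpz, map_zero]
    fin_cases i <;> fin_cases j <;> simp [hpz, hzp] at hij ⊢

section Concentration

variable {n : ℕ} {J : Type*} [Fintype J] [NeZero n]

/-- Bounds the probability that the projection of a fixed vector to the complement of `card J`
isotropic vectors of `ℂ^n` does not have the expected length up to `ε`; `η` measures the gap
between `card J` and `n`. -/
noncomputable def projError (n : ℕ) (η ε : ℝ) : ℝ :=
  9 * n ^ 2 * Real.exp (-(η * √n) / 8) + 8 * Real.exp (-(ε * √n) / 2)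

theorem projError_nonneg (n : ℕ) (η ε : ℝ) : 0 ≤ projError n η ε := by
  unfold projError; positivity

/-- A unit vector keeps about the fraction `1 - card J / n` of its energy after projection to the
complement of `card J` independent isotropic vectors. -/
theorem pi_perpProj_unit_tail [DecidableEq J] (hn : 2 ≤ n) {η ε : ℝ} (hη : 0 < η) (hε : 0 < ε)
    (hgap : 2 * η ≤ 1 - (Fintype.card J : ℝ) / n) {u : CVec n} (hu : ‖u‖ = 1) :
    (Measure.pi fun _ : J => isotropicLaw n).real
      {x | 4 * ε < |‖perpProj (Set.range x) u‖ ^ 2 - (1 - (Fintype.card J : ℝ) / n)|} ≤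
      projError n η ε := by
  set M := Measure.pi fun _ : J => isotropicLaw n
  set D : ℝ := 1 - (Fintype.card J : ℝ) / n with hD
  have hn0 : (0 : ℝ) < n := by exact_mod_cast NeZero.pos n
  have hmeas : Measurable fun z : CVec n × (J → CVec n) => perpProj (Set.range z.2) z.1 :=
    measurable_perpProj_range (X := fun j (z : CVec n × (J → CVec n)) => z.2 j)
      (fun j => by fun_prop) measurable_fst
  have hB : MeasurableSet {z : CVec n × (J → CVec n) |
      4 * ε < |‖perpProj (Set.range z.2) z.1‖ ^ 2 - D|} :=
    measurableSet_lt measurable_const (by fun_prop)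
  refine (le_of_slice_eq_of_slice_le (μ := isotropicLaw n) (ν := M) hB
    (measurableSet_wellSpread η (0 : CVec n)) (ε := 8 * Real.exp (-(ε * √n) / 2)) (by positivity)
    ?_ ?_).trans (add_le_add_left (pi_compl_wellSpread_le hn _ hη hgap) _)
  · -- by unitary invariance, the direction `u` may be replaced by a random one
    filter_upwards [ae_isotropicLaw_norm_eq_one n] with u' hu'
    obtain ⟨U, hU⟩ := exists_isometryEquiv_apply_eq_of_norm_eq (hu.trans hu'.symm)
    have hslice : MeasurableSet {x : J → CVec n |
        4 * ε < |‖perpProj (Set.range x) u'‖ ^ 2 - D|} :=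
      measurable_prodMk_left (x := u') hB
    change _ = M.real {x : J → CVec n | 4 * ε < |‖perpProj (Set.range x) u'‖ ^ 2 - D|}
    rw [← (measurePreserving_pi_isometryEquiv (J := J) U).measureReal_preimage hslice.nullMeasurableSet]
    congr 1
    ext x
    simp only [Set.mem_ofPred_eq, Set.mem_preimage]
    have : Set.range (fun j => U (x j)) = U '' Set.range x := by
      rw [← Set.range_comp]; rfl
    rw [this, ← hU, perpProj_image_isometryEquiv, U.norm_map]
  · intro x hx
    have h := isotropicLaw_starProjection_tail (Submodule.span ℂ (Set.range x))ᗮ hε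
    rw [finrank_orthogonal_span, finrank_span_of_wellSpread hη hx, sub_div, div_self hn0.ne'] at h
    exact h

theorem pi_perpProj_tail [DecidableEq J] (hn : 2 ≤ n) {η ε : ℝ} (hη : 0 < η) (hε : 0 < ε)
    (hgap : 2 * η ≤ 1 - (Fintype.card J : ℝ) / n) {u : CVec n} (hu : ‖u‖ ≤ 2) :
    (Measure.pi fun _ : J => isotropicLaw n).real
      {x | 16 * ε < |‖perpProj (Set.range x) u‖ ^ 2 - (1 - (Fintype.card J : ℝ) / n) * ‖u‖ ^ 2|} ≤
      projError n η ε := by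
  by_cases h0 : u = 0
  · have : {x : J → CVec n | 16 * ε < |‖perpProj (Set.range x) u‖ ^ 2 -
        (1 - (Fintype.card J : ℝ) / n) * ‖u‖ ^ 2|} = ∅ := by
      ext x
      simp [h0, perpProj, hε.le]
    rw [this, measureReal_empty]
    exact projError_nonneg _ _ _
  refine (measureReal_mono fun x hx => ?_).trans
    (pi_perpProj_unit_tail hn hη hε hgap (norm_direction h0))
  simp only [Set.mem_ofPred_eq] at hx ⊢
  have h1 : perpProj (Set.range x) u =
      (‖u‖ : ℂ) • perpProj (Set.range x) (direction u) := by
    rw [perpProj, perpProj, ← map_smul, norm_smul_direction]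
  rw [h1, norm_smul, Complex.norm_real, norm_norm, mul_pow, mul_comm _ (‖u‖ ^ 2), ← mul_sub,
    abs_mul, abs_of_nonneg (by positivity)] at hx
  have h2 : ‖u‖ ^ 2 ≤ 4 := by nlinarith [norm_nonneg u]
  nlinarith [abs_nonneg (‖perpProj (Set.range x) (direction u)‖ ^ 2 -
    (1 - (Fintype.card J : ℝ) / n))]

/-- By polarisation, the projection `Π` to the complement of independent isotropic vectors acts in
inner products of fixed vectors like multiplication by the relative dimension of its range. -/
theorem pi_inner_perpProj_tail [DecidableEq J] (hn : 2 ≤ n) {η ε : ℝ} (hη : 0 < η) (hε : 0 < ε)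
    (hgap : 2 * η ≤ 1 - (Fintype.card J : ℝ) / n) {v p : CVec n} (hv : ‖v‖ = 1) (hp : ‖p‖ = 1) :
    (Measure.pi fun _ : J => isotropicLaw n).real
      {x | 16 * ε < ‖inner ℂ v (perpProj (Set.range x) p) -
        ((1 - (Fintype.card J : ℝ) / n : ℝ) : ℂ) * inner ℂ v p‖} ≤
      4 * projError n η ε := by
  set M := Measure.pi fun _ : J => isotropicLaw n
  set D : ℝ := 1 - (Fintype.card J : ℝ) / n with hD
  set E : CVec n → Set (J → CVec n) := fun u =>
    {x | 16 * ε < |‖perpProj (Set.range x) u‖ ^ 2 - D * ‖u‖ ^ 2|}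
  have hE : ∀ u, ‖u‖ ≤ 2 → M.real (E u) ≤ projError n η ε := fun u hu =>
    pi_perpProj_tail hn hη hε hgap hu
  have hI : ‖Complex.I • p‖ = 1 := by rw [norm_smul, hp]; simp
  have hsub : {x : J → CVec n | 16 * ε < ‖inner ℂ v (perpProj (Set.range x) p) -
      (D : ℂ) * inner ℂ v p‖} ⊆
      (E (v + p) ∪ E (v - p)) ∪ (E (v - Complex.I • p) ∪ E (v + Complex.I • p)) := by
    intro x hx
    by_contra hcon
    simp only [Set.mem_union, not_or, E, Set.mem_ofPred_eq, not_lt] at hcon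
    obtain ⟨⟨h1, h2⟩, h3, h4⟩ := hcon
    simp only [Set.mem_ofPred_eq] at hx
    refine absurd hx (not_lt.2 ?_)
    have hproj : inner ℂ v (perpProj (Set.range x) p) =
        inner ℂ (perpProj (Set.range x) v) (perpProj (Set.range x) p) := by
      rw [inner_perpProj_left, perpProj_perpProj]
    rw [hproj, inner_eq_sum_norm_sq_div_four (𝕜 := ℂ) (perpProj (Set.range x) v),
      inner_eq_sum_norm_sq_div_four (𝕜 := ℂ) v p]
    simp only [perpProj, ← map_smul, ← map_add, ← map_sub]
    change ‖(((‖perpProj (Set.range x) (v + p)‖ : ℂ)) ^ 2 -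
      (‖perpProj (Set.range x) (v - p)‖ : ℂ) ^ 2 +
      ((‖perpProj (Set.range x) (v - Complex.I • p)‖ : ℂ) ^ 2 -
      (‖perpProj (Set.range x) (v + Complex.I • p)‖ : ℂ) ^ 2) * Complex.I) / 4 -
      D * (((‖v + p‖ : ℂ) ^ 2 - (‖v - p‖ : ℂ) ^ 2 +
        ((‖v - Complex.I • p‖ : ℂ) ^ 2 - (‖v + Complex.I • p‖ : ℂ) ^ 2) * Complex.I) / 4)‖ ≤ _
    set a1 := ‖perpProj (Set.range x) (v + p)‖ ^ 2 - D * ‖v + p‖ ^ 2 with ha1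
    set a2 := ‖perpProj (Set.range x) (v - p)‖ ^ 2 - D * ‖v - p‖ ^ 2 with ha2
    set a3 := ‖perpProj (Set.range x) (v - Complex.I • p)‖ ^ 2 -
      D * ‖v - Complex.I • p‖ ^ 2 with ha3
    set a4 := ‖perpProj (Set.range x) (v + Complex.I • p)‖ ^ 2 -
      D * ‖v + Complex.I • p‖ ^ 2 with ha4
    calc _ = ‖((a1 : ℂ) - a2 + (a3 - a4) * Complex.I) / 4‖ := by
          rw [ha1, ha2, ha3, ha4]
          congr 1
          push_cast
          ring
      _ ≤ (|a1| + |a2| + (|a3| + |a4|)) / 4 := by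
          rw [norm_div, Complex.norm_ofNat]
          gcongr
          refine (norm_add_le _ _).trans (add_le_add ((norm_sub_le _ _).trans ?_) ?_)
          · simp
          · rw [norm_mul, Complex.norm_I, mul_one]
            refine (norm_sub_le _ _).trans ?_
            simp
      _ ≤ _ := by linarith
  have n1 : ‖v + p‖ ≤ 2 := (norm_add_le _ _).trans (by rw [hv, hp]; norm_num)
  have n2 : ‖v - p‖ ≤ 2 := (norm_sub_le _ _).trans (by rw [hv, hp]; norm_num)
  have n3 : ‖v - Complex.I • p‖ ≤ 2 := (norm_sub_le _ _).trans (by rw [hv, hI]; norm_num)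
  have n4 : ‖v + Complex.I • p‖ ≤ 2 := (norm_add_le _ _).trans (by rw [hv, hI]; norm_num)
  refine (measureReal_mono hsub).trans ((measureReal_union_le _ _).trans
    ((add_le_add (measureReal_union_le _ _) (measureReal_union_le _ _)).trans ?_))
  linarith [hE _ n1, hE _ n2, hE _ n3, hE _ n4]

/-- Bounds the probability that the interference in a fixed direction `v` deviates by more than
`6 ε` from `(1 - |v† p|²) card J / n`. The three terms account for configurations that are not
`wellSpread`, for the fluctuations of the Hermitian form of the interference, and for those of the
norm of a Gaussian vector. -/
noncomputable def beamError (n : ℕ) (η ε : ℝ) : ℝ :=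
  9 * n ^ 2 * Real.exp (-(η * √n) / 8) +
    (4 * Real.exp (-(ε * n) / (2 * √(2 * (n * √n) / η))) + 4 * Real.exp (-(ε * √n) / 2))

theorem beamError_nonneg (n : ℕ) (η ε : ℝ) : 0 ≤ beamError n η ε := by
  unfold beamError; positivity

/-- For unit vectors `qⱼ` orthogonal to `p` whose Gram matrix is not too large, the energies of the
`qⱼ` along a uniformly distributed direction orthogonal to `p` add up to about `card J / n`. -/
theorem gaussianVec_sum_sq_inner_direction_tail {p : CVec n} (hp : ‖p‖ = 1) {q : J → CVec n}
    (hpq : ∀ j, inner ℂ p (q j) = 0) (hq1 : ∀ j, ‖q j‖ = 1) (hd : (Fintype.card J : ℝ) ≤ n)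
    {K : ℝ} (hK : 0 < K) (hq : ∑ j, ∑ k, ‖inner ℂ (q j) (q k)‖ ^ 2 ≤ K) {ε : ℝ} (hε : 0 < ε)
    (hε4 : ε ≤ 1 / 4) (hnε : 1 ≤ ε * n) :
    (gaussianVec n).real {g | 6 * ε < |∑ j, ‖inner ℂ (direction (perpProj {p} g)) (q j)‖ ^ 2 -
      (Fintype.card J : ℝ) / n|} ≤
      4 * Real.exp (-(ε * n) / (2 * √K)) + 4 * Real.exp (-(ε * √n) / 2) := by
  have hn : (0 : ℝ) < n := by exact_mod_cast NeZero.pos n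
  set d : ℝ := (Fintype.card J : ℝ) with hdd
  have hd0 : 0 ≤ d := Nat.cast_nonneg _
  have h1 := gaussianVec_sum_sq_norm_inner_tail q hK hq (ε * n)
  have hsum1 : ∑ j, ‖q j‖ ^ 2 = d := by simp [hq1, hdd]
  rw [hsum1] at h1
  have h2 := gaussianVec_starProjection_tail (Submodule.span ℂ {p})ᗮ (ε * n)
  have hp0 : p ≠ 0 := by
    rintro rfl
    simp at hp
  rw [finrank_orthogonal_span, finrank_span_singleton hp0, Nat.cast_one] at h2
  have hexp : -(ε * n) / (2 * √n) = -(ε * √n) / 2 := by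
    have hs : 0 < √(n : ℝ) := Real.sqrt_pos.2 hn
    rw [div_eq_div_iff (by positivity) (by norm_num)]
    nth_rewrite 1 [← Real.sq_sqrt hn.le]
    ring
  rw [hexp] at h2
  refine (measureReal_mono fun g hg => ?_).trans
    ((measureReal_union_le _ _).trans (add_le_add h1 h2))
  by_contra hcon
  simp only [Set.mem_union, Set.mem_ofPred_eq, not_or, not_le] at hcon hg
  obtain ⟨hc1, hc2⟩ := hcon
  have hdir : ∀ j, ‖inner ℂ (direction (perpProj {p} g)) (q j)‖ ^ 2 =
      ‖inner ℂ g (q j)‖ ^ 2 / ‖perpProj {p} g‖ ^ 2 := by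
    intro j
    rw [norm_inner_direction_left_sq, inner_perpProj_left]
    congr 4
    refine perpProj_eq ?_ (by simp)
    rintro s rfl
    exact hpq j
  simp_rw [hdir] at hg
  rw [← Finset.sum_div] at hg
  change |‖perpProj {p} g‖ ^ 2 - ((n : ℝ) - 1)| < ε * n at hc2
  generalize ‖perpProj {p} g‖ ^ 2 = m at *
  generalize ∑ j, ‖inner ℂ g (q j)‖ ^ 2 = N at *
  rw [abs_lt] at hc1 hc2
  have hm : n / 4 < m := by nlinarith
  have hm2 : n / 2 ≤ m := by nlinarith
  have hm0 : 0 < m := by linarith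
  have hkey : |N / m - d / n| ≤ 6 * ε := by
    rw [div_sub_div _ _ hm0.ne' hn.ne', abs_div, abs_of_pos (mul_pos hm0 hn),
      div_le_iff₀ (by positivity)]
    have h6 : |N * n - m * d| ≤ 3 * ε * n ^ 2 := by
      rw [abs_le]
      constructor <;> nlinarith
    nlinarith
  linarith

theorem ae_gaussianVec_perpProj_ne_zero {p w : CVec n} (hw : ‖w‖ = 1) (hpw : inner ℂ p w = 0) :
    ∀ᵐ g ∂gaussianVec n, perpProj {p} g ≠ 0 := by
  have hm : MeasurableSet {c : CVec n | 0 < ‖inner ℂ w c‖ ^ 2} :=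
    measurableSet_lt measurable_const (by fun_prop)
  have h1 := isotropicLaw_sq_norm_inner_gt hw le_rfl one_pos
  rw [sub_zero, one_pow, ← gaussianVec_map_direction,
    map_measureReal_apply measurable_direction hm, measureReal_def,
    ENNReal.toReal_eq_one_iff] at h1
  have h2 := (mem_ae_iff_prob_eq_one (measurable_direction hm)).2 h1
  filter_upwards [h2] with g hg h0
  have hwp : perpProj {p} w = w := by
    refine perpProj_eq (fun s hs => ?_) (by simp)
    rw [Set.mem_singleton_iff.1 hs, hpw]
  have h3 : inner ℂ w g = 0 := by
    rw [← hwp, inner_perpProj_left, h0, inner_zero_right]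
  simp only [Set.mem_preimage, Set.mem_ofPred_eq, norm_inner_direction_right_sq, h3] at hg
  simp at hg

/-- The law of the interference in a direction orthogonal to `p` does not depend on that direction,
by invariance under the unitary maps that fix `p`. -/
theorem pi_real_sum_inner_beam_eq [DecidableEq J] {p w w' : CVec n} (hp : ‖p‖ = 1) (hw : ‖w‖ = 1)
    (hpw : inner ℂ p w = 0) (hw' : ‖w'‖ = 1) (hpw' : inner ℂ p w' = 0) (r c : ℝ) :
    (Measure.pi fun _ : J => isotropicLaw n).real
      {x | r < |∑ j, ‖inner ℂ w (beam p x j)‖ ^ 2 - c|} =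
    (Measure.pi fun _ : J => isotropicLaw n).real
      {x | r < |∑ j, ‖inner ℂ w' (beam p x j)‖ ^ 2 - c|} := by
  obtain ⟨U, hU⟩ := exists_isometryEquiv_apply_eq
    (orthonormal_pair hp hw hpw) (orthonormal_pair hp hw' hpw')
  have hUp : U p = p := by simpa using hU 0
  have hUw : U w = w' := by simpa using hU 1
  have hm : ∀ j, Measurable fun x : J → CVec n => beam p x j := fun j =>
    measurable_beam measurable_const measurable_id j
  have hslice : MeasurableSet {x : J → CVec n |
      r < |∑ j, ‖inner ℂ w' (beam p x j)‖ ^ 2 - c|} := by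
    have : ∀ j, Measurable fun x : J → CVec n => ‖inner ℂ w' (beam p x j)‖ ^ 2 := fun j =>
      (measurable_const.inner (𝕜 := ℂ) (hm j)).norm.pow_const 2
    refine measurableSet_lt measurable_const ?_
    fun_prop
  have hbeam : ∀ (x : J → CVec n) j, beam p (fun j => U (x j)) j = U (beam p x j) := by
    intro x j
    rw [← beam_map, hUp]
  have hset : {x | r < |∑ j, ‖inner ℂ w (beam p x j)‖ ^ 2 - c|} =
      (fun (x : J → CVec n) j => U (x j)) ⁻¹'
        {x | r < |∑ j, ‖inner ℂ w' (beam p x j)‖ ^ 2 - c|} := by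
    ext x
    rw [Set.mem_preimage, Set.mem_ofPred_eq, Set.mem_ofPred_eq]
    simp_rw [hbeam, ← hUw, U.inner_map_map]
  rw [hset, (measurePreserving_pi_isometryEquiv (J := J) U).measureReal_preimage hslice.nullMeasurableSet]

theorem pi_sum_sq_inner_beam_orthogonal_tail [DecidableEq J] (hn : 2 ≤ n) {η ε : ℝ}
    (hη : 0 < η) (hε : 0 < ε) (hε4 : ε ≤ 1 / 4) (hnε : 1 ≤ ε * n) (hgap : 2 * η ≤ 1 - (Fintype.card J : ℝ) / n)
    {p w : CVec n} (hp : ‖p‖ = 1) (hw : ‖w‖ = 1) (hpw : inner ℂ p w = 0) :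
    (Measure.pi fun _ : J => isotropicLaw n).real
      {x | 6 * ε < |∑ j, ‖inner ℂ w (beam p x j)‖ ^ 2 - (Fintype.card J : ℝ) / n|} ≤
      beamError n η ε := by
  set M := Measure.pi fun _ : J => isotropicLaw n
  set d : ℝ := (Fintype.card J : ℝ) with hdd
  have hn0 : (0 : ℝ) < n := by exact_mod_cast NeZero.pos n
  have hd0 : 0 ≤ d / n := by positivity
  have hd : d ≤ n := (div_le_one hn0).1 (by linarith)
  have hη1 : η ≤ 1 := by linarith
  set B : Set (CVec n × (J → CVec n)) :=
    {z | 6 * ε < |∑ j, ‖inner ℂ z.1 (beam p z.2 j)‖ ^ 2 - d / n|} with hBdef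
  have hbeam : ∀ j, Measurable fun z : CVec n × (J → CVec n) => beam p z.2 j := fun j =>
    measurable_beam measurable_const measurable_snd j
  have hB : MeasurableSet B := by
    refine measurableSet_lt measurable_const ?_
    have : ∀ j, Measurable fun z : CVec n × (J → CVec n) => inner ℂ z.1 (beam p z.2 j) :=
      fun j => measurable_fst.inner (hbeam j)
    fun_prop
  have hproj : Measurable fun g : CVec n => direction (perpProj {p} g) :=
    measurable_direction.comp (by fun_prop)
  have hB' : MeasurableSet {z : CVec n × (J → CVec n) |
      (direction (perpProj {p} z.1), z.2) ∈ B} :=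
    (((hproj.comp measurable_fst).prodMk measurable_snd)) hB
  refine (le_of_slice_eq_of_slice_le (μ := gaussianVec n) (ν := M) hB'
    (measurableSet_wellSpread η p)
    (ε := 4 * Real.exp (-(ε * n) / (2 * √(2 * (n * √n) / η))) + 4 * Real.exp (-(ε * √n) / 2))
    (by positivity) ?_ ?_).trans (add_le_add_left (pi_compl_wellSpread_le hn _ hη hgap) _)
  · -- the direction `w` may be replaced by a random direction orthogonal to `p`
    filter_upwards [ae_gaussianVec_perpProj_ne_zero hw hpw] with g hg
    exact pi_real_sum_inner_beam_eq hp hw hpw (norm_direction hg)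
      (inner_direction_perpProj_eq_zero (Set.mem_singleton p) g) _ _
  · intro x hx
    exact gaussianVec_sum_sq_inner_direction_tail hp (fun j => inner_beam_eq_zero p x j)
      (fun j => norm_beam_of_wellSpread hη hx j) hd (by positivity)
      (sum_sq_norm_inner_beam_le hη hη1 hd hx) hε hε4 hnε

/-- The interference in the fixed direction `v`: as the beams `qⱼ` are orthogonal to `p`, only the
component of `v` orthogonal to `p` contributes. -/
theorem pi_sum_sq_inner_beam_tail [DecidableEq J] (hn : 2 ≤ n) {η ε : ℝ} (hη : 0 < η) (hε : 0 < ε)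
    (hε4 : ε ≤ 1 / 4) (hnε : 1 ≤ ε * n) (hgap : 2 * η ≤ 1 - (Fintype.card J : ℝ) / n)
    {v p : CVec n} (hv : ‖v‖ = 1) (hp : ‖p‖ = 1) :
    (Measure.pi fun _ : J => isotropicLaw n).real
      {x | 6 * ε < |∑ j, ‖inner ℂ v (beam p x j)‖ ^ 2 -
        (1 - ‖inner ℂ v p‖ ^ 2) * ((Fintype.card J : ℝ) / n)|} ≤
      beamError n η ε := by
  set z := v - inner ℂ p v • p with hz
  have hpz : inner ℂ p z = 0 := by
    rw [hz, inner_sub_right, inner_smul_right, inner_self_eq_norm_sq_to_K, hp]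
    simp
  have hzn : ‖z‖ ^ 2 = 1 - ‖inner ℂ v p‖ ^ 2 := by
    have h1 := norm_add_sq_eq_norm_sq_add_norm_sq_of_inner_eq_zero (𝕜 := ℂ) (inner ℂ p v • p) z
      (by rw [inner_smul_left, hpz, mul_zero])
    rw [hz, add_sub_cancel, hv, ← hz, norm_smul, hp, norm_inner_symm p v] at h1
    nlinarith
  have hzb : ∀ (x : J → CVec n) j, inner ℂ v (beam p x j) = inner ℂ z (beam p x j) := by
    intro x j
    rw [hz, inner_sub_left, inner_smul_left, inner_beam_eq_zero, mul_zero, sub_zero]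
  simp_rw [hzb, ← hzn]
  by_cases h0 : z = 0
  · have : {x : J → CVec n | 6 * ε < |∑ j, ‖inner ℂ z (beam p x j)‖ ^ 2 -
        ‖z‖ ^ 2 * ((Fintype.card J : ℝ) / n)|} = ∅ := by
      ext x
      simp [h0, hε.le]
    rw [this, measureReal_empty]
    exact beamError_nonneg _ _ _
  have hw1 := norm_direction h0
  have hpw : inner ℂ p (direction z) = 0 := by
    rw [direction, inner_smul_right, hpz, mul_zero]
  refine (measureReal_mono fun x hx => ?_).trans
    (pi_sum_sq_inner_beam_orthogonal_tail hn hη hε hε4 hnε hgap hp hw1 hpw)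
  simp only [Set.mem_ofPred_eq] at hx ⊢
  have hzpos : 0 < ‖z‖ ^ 2 := by positivity
  have hz1 : ‖z‖ ^ 2 ≤ 1 := by rw [hzn]; nlinarith [sq_nonneg ‖inner ℂ v p‖]
  simp_rw [norm_inner_direction_left_sq]
  rw [← Finset.sum_div]
  generalize ∑ j, ‖inner ℂ z (beam p x j)‖ ^ 2 = N at *
  have : N - ‖z‖ ^ 2 * ((Fintype.card J : ℝ) / n) =
      ‖z‖ ^ 2 * (N / ‖z‖ ^ 2 - (Fintype.card J : ℝ) / n) := by
    field_simp
  rw [this, abs_mul, abs_of_pos hzpos] at hx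
  nlinarith [abs_nonneg (N / ‖z‖ ^ 2 - (Fintype.card J : ℝ) / n)]

end Concentration

/-! ### Random vector quantisation -/

/-- An index maximising `f`, chosen as a function of the set of all maximisers. -/
noncomputable def argmaxIdx {ι : Type*} [Nonempty ι] (f : ι → ℝ) : ι :=
  Classical.epsilon (· ∈ {k | ∀ l, f l ≤ f k})

theorem le_argmaxIdx {ι : Type*} [Nonempty ι] [Finite ι] (f : ι → ℝ) (l : ι) :
    f l ≤ f (argmaxIdx f) :=
  Classical.epsilon_spec (p := (· ∈ {k | ∀ l, f l ≤ f k})) (Finite.exists_max f) l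

theorem measurable_argmaxIdx {ι : Type*} [Nonempty ι] [Finite ι] [MeasurableSpace ι]
    [MeasurableSingletonClass ι] : Measurable (argmaxIdx : (ι → ℝ) → ι) := by
  have h1 : Measurable (fun f : ι → ℝ => {k | ∀ l, f l ≤ f k}) := by
    refine measurable_set_iff.2 fun k => ?_
    refine measurableSet_setOfPred.1 ?_
    have : {f : ι → ℝ | k ∈ {k | ∀ l, f l ≤ f k}} = ⋂ l, {f | f l ≤ f k} := by
      ext f
      simp
    rw [this]
    have := Finite.to_countable (α := ι)
    exact MeasurableSet.iInter fun l => measurableSet_le (by fun_prop) (by fun_prop)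
  have h2 : Measurable (fun s : Set ι => Classical.epsilon (· ∈ s)) := measurable_of_finite _
  exact h2.comp h1

/-- The codeword of the codebook `c` that is best aligned with `v`. -/
noncomputable def quantize {n : ℕ} {ι : Type*} [Nonempty ι] (v : CVec n) (c : ι → CVec n) :
    CVec n :=
  c (argmaxIdx fun k => ‖inner ℂ v (c k)‖)

section Quantize

variable {n : ℕ} {ι : Type*}

theorem norm_inner_le_quantize [Nonempty ι] [Finite ι] (v : CVec n) (c : ι → CVec n) (k : ι) :
    ‖inner ℂ v (c k)‖ ≤ ‖inner ℂ v (quantize v c)‖ :=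
  le_argmaxIdx (fun k => ‖inner ℂ v (c k)‖) k

theorem quantize_map [Nonempty ι] (U : CVec n ≃ₗᵢ[ℂ] CVec n) (v : CVec n) (c : ι → CVec n) :
    quantize (U v) (fun k => U (c k)) = U (quantize v c) := by
  simp [quantize]

theorem measurable_quantize [Nonempty ι] [Finite ι] :
    Measurable fun z : CVec n × (ι → CVec n) => quantize z.1 z.2 := by
  let _ : MeasurableSpace ι := ⊤
  have h1 : Measurable fun z : CVec n × (ι → CVec n) =>
      argmaxIdx fun k => ‖inner ℂ z.1 (z.2 k)‖ := by
    refine measurable_argmaxIdx.comp (measurable_pi_iff.2 fun k => ?_)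
    fun_prop
  have := Finite.to_countable (α := ι)
  have h2 : Measurable fun y : ι × (ι → CVec n) => y.2 y.1 :=
    measurable_from_prod_countable_right fun k => measurable_pi_apply k
  exact h2.comp (h1.prodMk measurable_snd)

/-- Where no two codewords are equally well aligned with the channel, the tie-breaking rule does not
matter. -/
theorem eq_quantize_of_injective {N : ℕ} [NeZero N] {B : Fin N → CVec n} {h p : CVec n}
    (hp : IsQuantization B h p)
    (hinj : Function.Injective fun k => ‖inner ℂ (direction h) (B k)‖) :
    p = quantize (direction h) B := by
  obtain ⟨⟨k, rfl⟩, hmax⟩ := hp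
  have h1 := hmax _ ⟨argmaxIdx fun k => ‖inner ℂ (direction h) (B k)‖, rfl⟩
  have h2 := norm_inner_le_quantize (direction h) B k
  exact congrArg B (hinj (le_antisymm h2 h1))

variable [NeZero n]

/-- The modulus of an inner product with an isotropic vector has no atoms; for `n = 1` it would be
constant. -/
theorem isotropicLaw_norm_inner_eq (hn : 2 ≤ n) {u : CVec n} (hu : ‖u‖ = 1) (t : ℝ) :
    (isotropicLaw n).real {c | ‖inner ℂ u c‖ = t} = 0 := by
  have hm : n - 1 ≠ 0 := by omega
  rcases lt_or_ge t 0 with ht | ht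
  · have : {c : CVec n | ‖inner ℂ u c‖ = t} = ∅ := by
      ext c
      simp only [Set.mem_ofPred_eq, Set.mem_empty_iff_false, iff_false]
      have := norm_nonneg (inner ℂ u c)
      intro h
      linarith
    rw [this, measureReal_empty]
  refine le_antisymm ?_ measureReal_nonneg
  have hmeas : ∀ x : ℝ, MeasurableSet {c : CVec n | x < ‖inner ℂ u c‖ ^ 2} := fun x =>
    measurableSet_lt measurable_const (by fun_prop)
  have hcont : Continuous fun x : ℝ => (1 - x) ^ (n - 1) := by fun_prop
  rcases lt_or_ge (t ^ 2) 1 with h1 | h1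
  · -- the tail function `(1 - x) ^ (n - 1)` has no jump
    rcases ht.eq_or_lt with rfl | ht0
    · have h0 := isotropicLaw_sq_norm_inner_gt hu le_rfl one_pos
      have h2 := measureReal_compl (μ := isotropicLaw n) (hmeas 0)
      rw [h0, sub_zero, one_pow, probReal_univ, sub_self] at h2
      refine le_trans (measureReal_mono fun c hc => ?_) h2.le
      simp only [Set.mem_ofPred_eq] at hc
      simp [hc]
    · have hle : ∀ x ∈ Set.Ico 0 (t ^ 2), (isotropicLaw n).real {c | ‖inner ℂ u c‖ = t} ≤
          (1 - x) ^ (n - 1) - (1 - t ^ 2) ^ (n - 1) := by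
        intro x hx
        rw [← isotropicLaw_sq_norm_inner_gt hu hx.1 (hx.2.trans h1),
          ← isotropicLaw_sq_norm_inner_gt hu (sq_nonneg t) h1]
        have hsub : {c : CVec n | t ^ 2 < ‖inner ℂ u c‖ ^ 2} ⊆ {c | x < ‖inner ℂ u c‖ ^ 2} :=
          fun c hc => hx.2.trans hc
        rw [← measureReal_sdiff hsub (hmeas _)]
        refine measureReal_mono fun c hc => ?_
        simp only [Set.mem_ofPred_eq] at hc
        simp [hc, hx.2]
      have hlim : Tendsto (fun x : ℝ => (1 - x) ^ (n - 1) - (1 - t ^ 2) ^ (n - 1))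
          (𝓝[<] (t ^ 2)) (𝓝 0) := by
        have hc : Continuous fun x : ℝ => (1 - x) ^ (n - 1) - (1 - t ^ 2) ^ (n - 1) := by fun_prop
        have := hc.tendsto (t ^ 2)
        simp only [sub_self] at this
        exact this.mono_left nhdsWithin_le_nhds
      exact ge_of_tendsto hlim
        (eventually_of_mem (Ico_mem_nhdsLT (by positivity)) hle)
  · have hle : ∀ x ∈ Set.Ico (0 : ℝ) 1, (isotropicLaw n).real {c | ‖inner ℂ u c‖ = t} ≤
        (1 - x) ^ (n - 1) := by
      intro x hx
      rw [← isotropicLaw_sq_norm_inner_gt hu hx.1 hx.2]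
      refine measureReal_mono fun c hc => ?_
      simp only [Set.mem_ofPred_eq] at hc ⊢
      rw [hc]
      exact hx.2.trans_le h1
    have hlim : Tendsto (fun x : ℝ => (1 - x) ^ (n - 1)) (𝓝[<] 1) (𝓝 0) := by
      have := hcont.tendsto 1
      simp only [sub_self, zero_pow hm] at this
      exact this.mono_left nhdsWithin_le_nhds
    exact ge_of_tendsto hlim (eventually_of_mem (Ico_mem_nhdsLT one_pos) hle)

variable [Fintype ι]

/-- The law of an isotropic direction together with an independent codebook of isotropic
vectors. -/
noncomputable def codebookLaw (n : ℕ) (ι : Type*) [Fintype ι] :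
    Measure (CVec n × (ι → CVec n)) :=
  (isotropicLaw n).prod (Measure.pi fun _ : ι => isotropicLaw n)

instance isProbabilityMeasure_codebookLaw : IsProbabilityMeasure (codebookLaw n ι) := by
  unfold codebookLaw
  infer_instance

/-- Ties between codewords have probability zero. -/
theorem ae_codebookLaw_injective (hn : 2 ≤ n) :
    ∀ᵐ z ∂codebookLaw n ι, Function.Injective fun k => ‖inner ℂ z.1 (z.2 k)‖ := by
  classical
  have hpair : ∀ k l : ι, k ≠ l →
      ∀ᵐ z ∂codebookLaw n ι, ‖inner ℂ z.1 (z.2 k)‖ ≠ ‖inner ℂ z.1 (z.2 l)‖ := by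
    intro k l hkl
    have hB : MeasurableSet {z : CVec n × (ι → CVec n) |
        ‖inner ℂ z.1 (z.2 k)‖ = ‖inner ℂ z.1 (z.2 l)‖} :=
      measurableSet_eq_fun (by fun_prop) (by fun_prop)
    have h0 : (codebookLaw n ι).real {z : CVec n × (ι → CVec n) |
        ‖inner ℂ z.1 (z.2 k)‖ = ‖inner ℂ z.1 (z.2 l)‖} ≤ 0 := by
      refine prod_real_le_of_slice_le hB le_rfl ?_
      filter_upwards [ae_isotropicLaw_norm_eq_one n] with v hv
      refine pi_real_le_of_update_le k
        (measurableSet_eq_fun (by fun_prop) (by fun_prop)) le_rfl (ae_of_all _ fun y => ?_)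
      simp only [Set.mem_ofPred_eq, Function.update_self, Function.update_of_ne hkl.symm]
      exact (isotropicLaw_norm_inner_eq hn hv _).le
    have h1 := le_antisymm h0 measureReal_nonneg
    rw [measureReal_def, ENNReal.toReal_eq_zero_iff] at h1
    rw [ae_iff]
    simp only [ne_eq, not_not]
    exact h1.resolve_right (measure_ne_top _ _)
  have hall : ∀ᵐ z ∂codebookLaw n ι, ∀ k l : ι, k ≠ l →
      ‖inner ℂ z.1 (z.2 k)‖ ≠ ‖inner ℂ z.1 (z.2 l)‖ := by
    rw [ae_all_iff]; intro k
    rw [ae_all_iff]; intro l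
    by_cases hkl : k = l
    · exact ae_of_all _ fun z h => absurd hkl h
    · filter_upwards [hpair k l hkl] with z hz _ using hz
  filter_upwards [hall] with z hz k l hkl
  by_contra hne
  exact hz k l hne hkl

/-- By symmetry the quantised direction is again isotropic. -/
theorem codebookLaw_map_quantize [Nonempty ι] :
    (codebookLaw n ι).map (fun z => quantize z.1 z.2) = isotropicLaw n := by
  have := Measure.isProbabilityMeasure_map (μ := codebookLaw n ι)
    (measurable_quantize (n := n) (ι := ι)).aemeasurable
  refine eq_isotropicLaw (fun U => ?_) ?_
  · have hU : Measurable U := U.continuous.measurable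
    have hmp : MeasurePreserving (Prod.map U fun (x : ι → CVec n) k => U (x k))
        (codebookLaw n ι) (codebookLaw n ι) :=
      MeasurePreserving.prod ⟨hU, isotropicLaw_map_isometryEquiv U⟩ (measurePreserving_pi_isometryEquiv U)
    rw [Measure.map_map hU measurable_quantize]
    conv_rhs => rw [← hmp.map_eq, Measure.map_map measurable_quantize hmp.measurable]
    congr 1
    ext1 z
    exact (quantize_map U z.1 z.2).symm
  · rw [ae_map_iff measurable_quantize.aemeasurable
      (measurableSet_eq_fun (by fun_prop) (by fun_prop))]
    have h1 : ∀ᵐ x ∂Measure.pi (fun _ : ι => isotropicLaw n), ∀ k, ‖x k‖ = 1 := by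
      rw [ae_all_iff]
      exact fun k =>
        (measurePreserving_eval (fun _ : ι => isotropicLaw n) k).quasiMeasurePreserving.ae
          (ae_isotropicLaw_norm_eq_one n)
    have h2 : ∀ᵐ z ∂codebookLaw n ι, ∀ k, ‖z.2 k‖ = 1 :=
      measurePreserving_snd.quasiMeasurePreserving.ae h1
    filter_upwards [h2] with z hz using hz _

theorem pi_codeword_gt {v : CVec n} (hv : ‖v‖ = 1) {x : ℝ} (hx0 : 0 ≤ x) (hx1 : x < 1) (k : ι) :
    (Measure.pi fun _ : ι => isotropicLaw n).real {c | x < ‖inner ℂ v (c k)‖ ^ 2} =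
      (1 - x) ^ (n - 1) := by
  have hs : MeasurableSet {c : CVec n | x < ‖inner ℂ v c‖ ^ 2} :=
    measurableSet_lt measurable_const (by fun_prop)
  have hset : {c : ι → CVec n | x < ‖inner ℂ v (c k)‖ ^ 2} =
      Function.eval k ⁻¹' {c : CVec n | x < ‖inner ℂ v c‖ ^ 2} := by
    ext c
    rw [Set.mem_preimage, Set.mem_ofPred_eq, Set.mem_ofPred_eq, Function.eval]
  rw [hset, (measurePreserving_eval (fun _ : ι => isotropicLaw n) k).measureReal_preimage
    hs.nullMeasurableSet, isotropicLaw_sq_norm_inner_gt hv hx0 hx1]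

theorem pi_quantize_gt_le [Nonempty ι] {v : CVec n} (hv : ‖v‖ = 1) {x : ℝ} (hx0 : 0 ≤ x)
    (hx1 : x < 1) :
    (Measure.pi fun _ : ι => isotropicLaw n).real
      {c : ι → CVec n | x < ‖inner ℂ v (quantize v c)‖ ^ 2} ≤
      Fintype.card ι * (1 - x) ^ (n - 1) := by
  have hsub : {c : ι → CVec n | x < ‖inner ℂ v (quantize v c)‖ ^ 2} ⊆
      ⋃ k, {c : ι → CVec n | x < ‖inner ℂ v (c k)‖ ^ 2} := by
    intro c hc
    rw [Set.mem_ofPred_eq, quantize] at hc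
    rw [Set.mem_iUnion]
    exact ⟨argmaxIdx fun k => ‖inner ℂ v (c k)‖, by rwa [Set.mem_ofPred_eq]⟩
  refine (measureReal_mono hsub).trans ((measureReal_iUnion_fintype_le _).trans ?_)
  rw [Finset.sum_congr rfl fun k _ => pi_codeword_gt hv hx0 hx1 k, Finset.sum_const,
    Finset.card_univ, nsmul_eq_mul]

/-- The quantisation is not much better than expected (union bound). -/
theorem codebookLaw_quantize_gt_le [Nonempty ι] {x : ℝ} (hx0 : 0 ≤ x) (hx1 : x < 1) :
    (codebookLaw n ι).real {z | x < ‖inner ℂ z.1 (quantize z.1 z.2)‖ ^ 2} ≤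
      Fintype.card ι * (1 - x) ^ (n - 1) := by
  have hx1' : 0 < 1 - x := by linarith
  have hnn : 0 ≤ (Fintype.card ι : ℝ) * (1 - x) ^ (n - 1) := by positivity
  have hq := measurable_quantize (n := n) (ι := ι)
  have hm : MeasurableSet {z : CVec n × (ι → CVec n) |
      x < ‖inner ℂ z.1 (quantize z.1 z.2)‖ ^ 2} :=
    measurableSet_lt measurable_const (by fun_prop)
  refine prod_real_le_of_slice_le hm hnn ?_
  filter_upwards [ae_isotropicLaw_norm_eq_one n] with v hv
  exact pi_quantize_gt_le hv hx0 hx1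

/-- The quantisation is not much worse than expected: all codewords would have to miss. -/
theorem codebookLaw_quantize_le_le [Nonempty ι] {x : ℝ} (hx0 : 0 ≤ x) (hx1 : x < 1) :
    (codebookLaw n ι).real {z | ‖inner ℂ z.1 (quantize z.1 z.2)‖ ^ 2 ≤ x} ≤
      Real.exp (-(Fintype.card ι * (1 - x) ^ (n - 1))) := by
  have hq := measurable_quantize (n := n) (ι := ι)
  have hm : MeasurableSet {z : CVec n × (ι → CVec n) |
      ‖inner ℂ z.1 (quantize z.1 z.2)‖ ^ 2 ≤ x} :=
    measurableSet_le (by fun_prop) measurable_const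
  refine prod_real_le_of_slice_le hm (by positivity) ?_
  filter_upwards [ae_isotropicLaw_norm_eq_one n] with v hv
  have hs : MeasurableSet {c : CVec n | x < ‖inner ℂ v c‖ ^ 2} :=
    measurableSet_lt measurable_const (by fun_prop)
  have h1 : (isotropicLaw n).real {c : CVec n | x < ‖inner ℂ v c‖ ^ 2}ᶜ =
      1 - (1 - x) ^ (n - 1) := by
    rw [probReal_compl_eq_one_sub hs, isotropicLaw_sq_norm_inner_gt hv hx0 hx1]
  calc _ ≤ (Measure.pi fun _ : ι => isotropicLaw n).real
        (Set.univ.pi fun _ : ι => {c : CVec n | x < ‖inner ℂ v c‖ ^ 2}ᶜ) := by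
        refine measureReal_mono fun c hc => ?_
        simp only [Set.mem_ofPred_eq, Set.mem_univ_pi, Set.mem_compl_iff, not_lt] at hc ⊢
        intro k
        refine le_trans ?_ hc
        gcongr
        exact norm_inner_le_quantize v c k
    _ = (1 - (1 - x) ^ (n - 1)) ^ Fintype.card ι := by
        rw [measureReal_def, Measure.pi_pi, ENNReal.toReal_prod]
        change ∏ _k : ι, (isotropicLaw n).real {c : CVec n | x < ‖inner ℂ v c‖ ^ 2}ᶜ = _
        rw [h1]
        simp
    _ ≤ Real.exp (-((1 - x) ^ (n - 1))) ^ Fintype.card ι := by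
        refine pow_le_pow_left₀ ?_ (Real.one_sub_le_exp_neg _) _
        rw [← h1]
        exact measureReal_nonneg
    _ = _ := by
        rw [← Real.exp_nat_mul]
        congr 1
        ring

end Quantize

/-! ### Independence of the users -/

/-- Grouping an independent family of isotropic directions and codewords by users. -/
theorem map_pi_codebookLaw {n : ℕ} [NeZero n] {I : Type*} [Fintype I] (N : I → ℕ) :
    (Measure.pi fun i : I => codebookLaw n (Fin (N i))).map
      (fun b => Sum.elim (fun i => (b i).1) (fun y : Σ i, Fin (N i) => (b y.1).2 y.2)) =
      Measure.pi fun _ : I ⊕ (Σ i, Fin (N i)) => isotropicLaw n := by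
  have hm : Measurable (fun b : (i : I) → CVec n × (Fin (N i) → CVec n) =>
      (Sum.elim (fun i => (b i).1) (fun y : Σ i, Fin (N i) => (b y.1).2 y.2) :
        I ⊕ (Σ i, Fin (N i)) → CVec n)) := by
    refine measurable_pi_iff.2 fun a => ?_
    rcases a with i | y
    · exact measurable_fst.comp (measurable_pi_apply i)
    · exact (measurable_pi_apply y.2).comp (measurable_snd.comp (measurable_pi_apply y.1))
  refine (Measure.pi_eq fun s hs => ?_).symm
  rw [Measure.map_apply hm (MeasurableSet.univ_pi hs)]
  have hset : (fun b : (i : I) → CVec n × (Fin (N i) → CVec n) =>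
      (Sum.elim (fun i => (b i).1) (fun y : Σ i, Fin (N i) => (b y.1).2 y.2) :
        I ⊕ (Σ i, Fin (N i)) → CVec n)) ⁻¹' Set.univ.pi s =
      Set.univ.pi fun i => s (Sum.inl i) ×ˢ Set.univ.pi fun k => s (Sum.inr ⟨i, k⟩) := by
    ext b
    simp only [Set.mem_preimage, Set.mem_univ_pi, Set.mem_prod]
    constructor
    · exact fun h i => ⟨h (Sum.inl i), fun k => h (Sum.inr ⟨i, k⟩)⟩
    · rintro h (i | ⟨i, k⟩)
      · exact (h i).1
      · exact (h i).2 k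
  rw [hset, Measure.pi_pi, Fintype.prod_sum_type, Fintype.prod_sigma, ← Finset.prod_mul_distrib]
  refine Finset.prod_congr rfl fun i _ => ?_
  rw [codebookLaw, Measure.prod_prod, Measure.pi_pi]

/-- Mutual independence of all directions and codewords makes the pairs (direction, codebook) of the
users independent. -/
theorem hasLaw_blocks {Ω : Type*} [MeasurableSpace Ω] {P : Measure Ω} [IsProbabilityMeasure P]
    {n : ℕ} [NeZero n] {I : Type*} [Fintype I] {N : I → ℕ} {v : I → Ω → CVec n}
    {c : (Σ i, Fin (N i)) → Ω → CVec n} (hv : ∀ i, HasLaw (v i) (isotropicLaw n) P)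
    (hc : ∀ y, HasLaw (c y) (isotropicLaw n) P) (hind : iIndepFun (Sum.elim v c) P) :
    HasLaw (fun ω i => (v i ω, fun k => c ⟨i, k⟩ ω))
      (Measure.pi fun i : I => codebookLaw n (Fin (N i))) P := by
  have hlaw : ∀ a, HasLaw (Sum.elim v c a) (isotropicLaw n) P := by
    rintro (i | y)
    · exact hv i
    · exact hc y
  have hpi := hind.hasLaw_pi hlaw
  have hm1 : Measurable (fun b : (i : I) → CVec n × (Fin (N i) → CVec n) =>
      (Sum.elim (fun i => (b i).1) (fun y : Σ i, Fin (N i) => (b y.1).2 y.2) :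
        I ⊕ (Σ i, Fin (N i)) → CVec n)) := by
    refine measurable_pi_iff.2 fun a => ?_
    rcases a with i | y
    · exact measurable_fst.comp (measurable_pi_apply i)
    · exact (measurable_pi_apply y.2).comp (measurable_snd.comp (measurable_pi_apply y.1))
  have hm2 : Measurable (fun (z : I ⊕ (Σ i, Fin (N i)) → CVec n) (i : I) =>
      (z (Sum.inl i), fun k : Fin (N i) => z (Sum.inr ⟨i, k⟩))) := by fun_prop
  have h2 : HasLaw (fun (z : I ⊕ (Σ i, Fin (N i)) → CVec n) (i : I) =>
      (z (Sum.inl i), fun k : Fin (N i) => z (Sum.inr ⟨i, k⟩)))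
      (Measure.pi fun i : I => codebookLaw n (Fin (N i)))
      (Measure.pi fun _ : I ⊕ (Σ i, Fin (N i)) => isotropicLaw n) := by
    refine ⟨hm2.aemeasurable, ?_⟩
    rw [← map_pi_codebookLaw, Measure.map_map hm2 hm1]
    exact Measure.map_id
  exact h2.comp hpi

/-- The quantised directions of the other users are independent isotropic vectors, independent of
the direction and the codebook of a given user. -/
theorem hasLaw_quantize {Ω : Type*} [MeasurableSpace Ω] {P : Measure Ω} [IsProbabilityMeasure P]
    {n : ℕ} [NeZero n] {I : Type*} [Fintype I] {N : I → ℕ} [∀ i, NeZero (N i)]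
    {b : (i : I) → Ω → CVec n × (Fin (N i) → CVec n)}
    (hb : HasLaw (fun ω i => b i ω) (Measure.pi fun i : I => codebookLaw n (Fin (N i))) P)
    (i : I) {J : Type*} [Fintype J] {f : J → I} (hf : Function.Injective f) (hfi : ∀ j, f j ≠ i) :
    HasLaw (fun ω => (b i ω, fun j => quantize (b (f j) ω).1 (b (f j) ω).2))
      ((codebookLaw n (Fin (N i))).prod (Measure.pi fun _ : J => isotropicLaw n)) P := by
  classical
  have hbi : ∀ i, HasLaw (b i) (codebookLaw n (Fin (N i))) P := fun i =>
    (measurePreserving_eval (fun i : I => codebookLaw n (Fin (N i))) i).comp_hasLaw hb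
  have hind : iIndepFun b P := (iIndepFun_iff_hasLaw_pi_pi hbi).2 hb
  have hq : ∀ i, HasLaw (fun ω => quantize (b i ω).1 (b i ω).2) (isotropicLaw n) P := fun i =>
    HasLaw.comp (Y := fun z : CVec n × (Fin (N i) → CVec n) => quantize z.1 z.2)
      ⟨measurable_quantize.aemeasurable, codebookLaw_map_quantize⟩ (hbi i)
  have hqJ : HasLaw (fun ω j => quantize (b (f j) ω).1 (b (f j) ω).2)
      (Measure.pi fun _ : J => isotropicLaw n) P := by
    refine iIndepFun.hasLaw_pi (fun j => hq (f j)) ?_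
    exact (hind.precomp hf).comp (fun j z => quantize z.1 z.2) fun j => measurable_quantize
  have hprod : IndepFun (b i) (fun ω j => quantize (b (f j) ω).1 (b (f j) ω).2) P := by
    have h1 := hind.indepFun_finset₀ {i} (Finset.univ.image f)
      (by
        rw [Finset.disjoint_singleton_left]
        simpa using hfi) (fun i => (hbi i).aemeasurable)
    have hφ : Measurable fun z : (k : ({i} : Finset I)) → CVec n × (Fin (N k) → CVec n) =>
        z ⟨i, Finset.mem_singleton_self i⟩ :=
      measurable_pi_apply (⟨i, Finset.mem_singleton_self i⟩ : ({i} : Finset I))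
    exact h1.comp (φ := fun z => z ⟨i, Finset.mem_singleton_self i⟩)
      (ψ := fun z j => quantize (z ⟨f j, Finset.mem_image_of_mem f (Finset.mem_univ j)⟩).1
        (z ⟨f j, Finset.mem_image_of_mem f (Finset.mem_univ j)⟩).2)
      hφ (measurable_pi_iff.2 fun j => measurable_quantize.comp (measurable_pi_apply _))
  exact (indepFun_iff_hasLaw_prodMk_prod (hbi i) hqJ).1 hprod

/-! ### The beams and powers of a user in terms of the other quantised channels -/

section Powers

variable {n : ℕ} {A : Finset ℕ} {p : ℕ → CVec n} {i : ℕ}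

/-- The direction of the component of `p i` orthogonal to the other quantised channels. -/
theorem zfBeam_eq_direction :
    zfBeam A p i =
      direction (perpProj (Set.range fun j : {j // j ∈ A.erase i} => p j) (p i)) := by
  have hset : p '' {j | j ∈ A ∧ j ≠ i} = Set.range fun j : {j // j ∈ A.erase i} => p j := by
    ext y
    simp only [Set.mem_image, Set.mem_ofPred_eq, Set.mem_range, Subtype.exists, Finset.mem_erase,
      exists_prop]
    exact exists_congr fun j => and_congr_left fun _ => and_comm
  have hbeam : zfBeam A p i = direction (perpProj (p '' {j | j ∈ A ∧ j ≠ i}) (p i)) := rfl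
  rw [hbeam, hset]

theorem zfBeam_eq_beam (hi : i ∈ A) (j : {j // j ∈ A.erase i}) :
    zfBeam A p j = beam (p i) (fun k : {k // k ∈ A.erase i} => p k) j := by
  have hj := Finset.mem_erase.1 j.2
  have hset : p '' {k | k ∈ A ∧ k ≠ j} =
      insert (p i) ((fun k : {k // k ∈ A.erase i} => p k) '' {k | k ≠ j}) := by
    ext y
    simp only [Set.mem_image, Set.mem_ofPred_eq, Set.mem_insert_iff, Subtype.exists,
      Finset.mem_erase]
    constructor
    · rintro ⟨k, ⟨hkA, hkj⟩, rfl⟩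
      by_cases hki : k = i
      · exact Or.inl (by rw [hki])
      · exact Or.inr ⟨k, ⟨hki, hkA⟩, fun h => hkj (by rw [← h]), rfl⟩
    · rintro (rfl | ⟨k, hk, hkj, rfl⟩)
      · exact ⟨i, ⟨hi, fun h => hj.1 h.symm⟩, rfl⟩
      · exact ⟨k, ⟨hk.2, fun h => hkj (Subtype.ext h)⟩, rfl⟩
  have hbeam : zfBeam A p j = direction (perpProj (p '' {k | k ∈ A ∧ k ≠ j}) (p j)) := rfl
  rw [hbeam, hset, beam, zfResidual, range_update]

theorem sq_norm_inner_eq_sq_norm_mul (h q : CVec n) :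
    ‖inner ℂ h q‖ ^ 2 = ‖h‖ ^ 2 * ‖inner ℂ (direction h) q‖ ^ 2 := by
  conv_lhs => rw [← norm_smul_direction h]
  rw [inner_smul_left, norm_mul, mul_pow, Complex.conj_ofReal, Complex.norm_real, norm_norm]

theorem signalPower_eq (ρ γ : ℝ) (h : CVec n) :
    signalPower ρ γ A h p i = ρ / A.card * γ * (‖h‖ ^ 2 *
      (‖inner ℂ (direction h)
        (perpProj (Set.range fun j : {j // j ∈ A.erase i} => p j) (p i))‖ ^ 2 /
      ‖perpProj (Set.range fun j : {j // j ∈ A.erase i} => p j) (p i)‖ ^ 2)) := by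
  rw [signalPower, zfBeam_eq_direction, sq_norm_inner_eq_sq_norm_mul, norm_inner_direction_right_sq]

theorem interferencePower_eq (ρ γ : ℝ) (h : CVec n) (hi : i ∈ A) :
    interferencePower ρ γ A h p i = ρ / A.card * γ * (‖h‖ ^ 2 *
      ∑ j : {j // j ∈ A.erase i}, ‖inner ℂ (direction h)
        (beam (p i) (fun k : {k // k ∈ A.erase i} => p k) j)‖ ^ 2) := by
  rw [interferencePower, ← Finset.sum_coe_sort, Finset.mul_sum (a := ‖h‖ ^ 2)]
  congr 1
  refine Finset.sum_congr rfl fun j _ => ?_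
  rw [zfBeam_eq_beam hi, sq_norm_inner_eq_sq_norm_mul]

end Powers

/-! ### Error probabilities for a fixed number of antennas -/

theorem measureReal_preimage_of_hasLaw {Ω 𝓧 : Type*} [MeasurableSpace Ω] [MeasurableSpace 𝓧]
    {P : Measure Ω} {μ : Measure 𝓧} {X : Ω → 𝓧} (hX : HasLaw X μ P) {s : Set 𝓧}
    (hs : MeasurableSet s) : P.real (X ⁻¹' s) = μ.real s := by
  rw [← hX.map_eq, measureReal_def, measureReal_def, Measure.map_apply_of_aemeasurable
    hX.aemeasurable hs]

/-- The joint law of the direction and the codebook of user `i` and of the quantised channels of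
the other users. -/
theorem hasLaw_codebook_quantized {Ω : Type*} [MeasurableSpace Ω] {P : Measure Ω}
    [IsProbabilityMeasure P] {n : ℕ} [NeZero n] (hn : 2 ≤ n) {A : Finset ℕ} {R : ℕ → ℕ}
    {h : ℕ → Ω → CVec n} {c : (i : ℕ) → Fin (2 ^ R i) → Ω → CVec n} {p : ℕ → Ω → CVec n}
    (hchannel : ∀ i ∈ A, IsRayleigh P (h i))
    (hcode : ∀ i ∈ A, ∀ k, HasLaw (c i k) (isotropicLaw n) P)
    (hindep : iIndepFun (Sum.elim
      (fun (i : {i // i ∈ A}) (ω : Ω) => direction (h i ω))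
      (fun (y : Σ i : {i // i ∈ A}, Fin (2 ^ R i)) (ω : Ω) => c y.1 y.2 ω)) P)
    (hquant : ∀ i ∈ A, ∀ ω, IsQuantization (fun k => c i k ω) (h i ω) (p i ω))
    {i : ℕ} (hi : i ∈ A) :
    HasLaw (fun ω => ((direction (h i ω), fun k => c i k ω),
        fun j : {j // j ∈ A.erase i} => p j ω))
      ((codebookLaw n (Fin (2 ^ R i))).prod
        (Measure.pi fun _ : {j // j ∈ A.erase i} => isotropicLaw n)) P ∧
    ∀ᵐ ω ∂P, p i ω = quantize (direction (h i ω)) fun k => c i k ω := by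
  have hb := hasLaw_blocks (P := P) (N := fun j : {j // j ∈ A} => 2 ^ R j)
    (v := fun j ω => direction (h j ω)) (c := fun y ω => c y.1 y.2 ω)
    (fun j => (hchannel j j.2).hasLaw_direction) (fun y => hcode y.1 y.1.2 y.2) hindep
  have hae : ∀ j ∈ A, ∀ᵐ ω ∂P, p j ω = quantize (direction (h j ω)) fun k => c j k ω := by
    intro j hj
    have hbj : HasLaw (fun ω => (direction (h j ω), fun k => c j k ω))
        (codebookLaw n (Fin (2 ^ R j))) P :=
      (measurePreserving_eval (fun j : {j // j ∈ A} => codebookLaw n (Fin (2 ^ R j)))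
        ⟨j, hj⟩).comp_hasLaw hb
    have h1 := ae_codebookLaw_injective (n := n) (ι := Fin (2 ^ R j)) hn
    rw [← hbj.map_eq] at h1
    filter_upwards [ae_of_ae_map hbj.aemeasurable h1] with ω hω
    exact eq_quantize_of_injective (hquant j hj ω) hω
  refine ⟨?_, hae i hi⟩
  have hlaw := hasLaw_quantize (N := fun j : {j // j ∈ A} => 2 ^ R j)
    (b := fun j ω => (direction (h j ω), fun k => c j k ω)) hb ⟨i, hi⟩
    (J := {j // j ∈ A.erase i}) (f := fun j => ⟨j, Finset.mem_of_mem_erase j.2⟩)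
    (fun j k hjk => Subtype.ext (Subtype.mk.inj hjk))
    (fun j hj => (Finset.mem_erase.1 j.2).1 (congrArg Subtype.val hj))
  refine hlaw.congr ?_
  have hall : ∀ᵐ ω ∂P, ∀ j : {j // j ∈ A.erase i},
      p j ω = quantize (direction (h j ω)) fun k => c j k ω :=
    ae_all_iff.2 fun j => hae j (Finset.mem_of_mem_erase j.2)
  filter_upwards [hall] with ω hω
  exact Prod.ext rfl (funext hω)

section ErrorProbabilities

variable {Ω : Type*} [MeasurableSpace Ω] {P : Measure Ω} {n : ℕ} [NeZero n]
  {ι J : Type*} [Fintype ι] [Nonempty ι] [Fintype J]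
  {b : Ω → CVec n × (ι → CVec n)} {q : Ω → CVec n} {x : Ω → J → CVec n}

/-- A bound that holds for all fixed unit vectors in place of the direction and its quantisation
holds for the random ones, since the other quantised channels are independent of them. -/
theorem real_le_of_forall_unit
    (hlaw : HasLaw (fun ω => (b ω, x ω))
      ((codebookLaw n ι).prod (Measure.pi fun _ : J => isotropicLaw n)) P)
    (hq : ∀ᵐ ω ∂P, q ω = quantize (b ω).1 (b ω).2)
    {B : Set ((CVec n × CVec n) × (J → CVec n))} (hB : MeasurableSet B) {δ : ℝ} (hδ : 0 ≤ δ)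
    (h : ∀ v p : CVec n, ‖v‖ = 1 → ‖p‖ = 1 →
      (Measure.pi fun _ : J => isotropicLaw n).real {y | ((v, p), y) ∈ B} ≤ δ) :
    P.real {ω | (((b ω).1, q ω), x ω) ∈ B} ≤ δ := by
  set g : (CVec n × (ι → CVec n)) × (J → CVec n) → (CVec n × CVec n) × (J → CVec n) :=
    fun z => ((z.1.1, quantize z.1.1 z.1.2), z.2) with hg
  have hgm : Measurable g :=
    ((measurable_fst.comp measurable_fst).prodMk (measurable_quantize.comp measurable_fst)).prodMk
      measurable_snd
  have h1 : P.real {ω | (((b ω).1, q ω), x ω) ∈ B} =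
      P.real ((fun ω => (b ω, x ω)) ⁻¹' (g ⁻¹' B)) := by
    refine measureReal_congr ?_
    filter_upwards [hq] with ω hω
    refine propext ?_
    change (((b ω).1, q ω), x ω) ∈ B ↔ g (b ω, x ω) ∈ B
    rw [hω]
  rw [h1, measureReal_preimage_of_hasLaw hlaw (hgm hB)]
  refine prod_real_le_of_slice_le (hgm hB) hδ ?_
  have hv : ∀ᵐ z ∂codebookLaw n ι, ‖z.1‖ = 1 :=
    measurePreserving_fst.quasiMeasurePreserving.ae (ae_isotropicLaw_norm_eq_one n)
  have hp : ∀ᵐ z ∂codebookLaw n ι, ‖quantize z.1 z.2‖ = 1 := by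
    refine ae_of_ae_map (f := fun z : CVec n × (ι → CVec n) => quantize z.1 z.2)
      (p := fun y => ‖y‖ = 1) measurable_quantize.aemeasurable ?_
    rw [codebookLaw_map_quantize]
    exact ae_isotropicLaw_norm_eq_one n
  filter_upwards [hv, hp] with z hzv hzp
  exact h _ _ hzv hzp

theorem real_sq_norm_perpProj_tail [DecidableEq J]
    (hlaw : HasLaw (fun ω => (b ω, x ω))
      ((codebookLaw n ι).prod (Measure.pi fun _ : J => isotropicLaw n)) P)
    (hq : ∀ᵐ ω ∂P, q ω = quantize (b ω).1 (b ω).2)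
    (hn : 2 ≤ n) {η ε : ℝ} (hη : 0 < η) (hε : 0 < ε)
    (hgap : 2 * η ≤ 1 - (Fintype.card J : ℝ) / n) :
    P.real {ω | 4 * ε < |‖perpProj (Set.range (x ω)) (q ω)‖ ^ 2 -
      (1 - (Fintype.card J : ℝ) / n)|} ≤ projError n η ε := by
  have hm : Measurable fun z : (CVec n × CVec n) × (J → CVec n) =>
      perpProj (Set.range z.2) z.1.2 :=
    measurable_perpProj_range (X := fun j (z : (CVec n × CVec n) × (J → CVec n)) => z.2 j)
      (fun j => by fun_prop) (by fun_prop)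
  exact real_le_of_forall_unit hlaw hq
    (B := {z | 4 * ε < |‖perpProj (Set.range z.2) z.1.2‖ ^ 2 - (1 - (Fintype.card J : ℝ) / n)|})
    (measurableSet_lt measurable_const (by fun_prop)) (projError_nonneg n η ε)
    fun v p _ hp => pi_perpProj_unit_tail hn hη hε hgap hp

theorem real_inner_perpProj_tail [DecidableEq J]
    (hlaw : HasLaw (fun ω => (b ω, x ω))
      ((codebookLaw n ι).prod (Measure.pi fun _ : J => isotropicLaw n)) P)
    (hq : ∀ᵐ ω ∂P, q ω = quantize (b ω).1 (b ω).2)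
    (hn : 2 ≤ n) {η ε : ℝ} (hη : 0 < η) (hε : 0 < ε)
    (hgap : 2 * η ≤ 1 - (Fintype.card J : ℝ) / n) :
    P.real {ω | 16 * ε < ‖inner ℂ (b ω).1 (perpProj (Set.range (x ω)) (q ω)) -
      ((1 - (Fintype.card J : ℝ) / n : ℝ) : ℂ) * inner ℂ (b ω).1 (q ω)‖} ≤
      4 * projError n η ε := by
  have hm : Measurable fun z : (CVec n × CVec n) × (J → CVec n) =>
      perpProj (Set.range z.2) z.1.2 :=
    measurable_perpProj_range (X := fun j (z : (CVec n × CVec n) × (J → CVec n)) => z.2 j)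
      (fun j => by fun_prop) (by fun_prop)
  exact real_le_of_forall_unit hlaw hq
    (B := {z | 16 * ε < ‖inner ℂ z.1.1 (perpProj (Set.range z.2) z.1.2) -
      ((1 - (Fintype.card J : ℝ) / n : ℝ) : ℂ) * inner ℂ z.1.1 z.1.2‖})
    (measurableSet_lt measurable_const (by fun_prop))
    (mul_nonneg (by norm_num) (projError_nonneg n η ε))
    fun v p hv hp => pi_inner_perpProj_tail hn hη hε hgap hv hp

theorem real_sum_sq_inner_beam_tail [DecidableEq J]
    (hlaw : HasLaw (fun ω => (b ω, x ω))
      ((codebookLaw n ι).prod (Measure.pi fun _ : J => isotropicLaw n)) P)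
    (hq : ∀ᵐ ω ∂P, q ω = quantize (b ω).1 (b ω).2)
    (hn : 2 ≤ n) {η ε : ℝ} (hη : 0 < η) (hε : 0 < ε) (hε4 : ε ≤ 1 / 4) (hnε : 1 ≤ ε * n)
    (hgap : 2 * η ≤ 1 - (Fintype.card J : ℝ) / n) :
    P.real {ω | 6 * ε < |∑ j, ‖inner ℂ (b ω).1 (beam (q ω) (x ω) j)‖ ^ 2 -
      (1 - ‖inner ℂ (b ω).1 (q ω)‖ ^ 2) * ((Fintype.card J : ℝ) / n)|} ≤ beamError n η ε := by
  have hm : ∀ j, Measurable fun z : (CVec n × CVec n) × (J → CVec n) => beam z.1.2 z.2 j :=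
    fun j => measurable_beam (by fun_prop) (by fun_prop) j
  have hsum : Measurable fun z : (CVec n × CVec n) × (J → CVec n) =>
      ∑ j, ‖inner ℂ z.1.1 (beam z.1.2 z.2 j)‖ ^ 2 :=
    Finset.measurable_sum _ fun j _ =>
      (((measurable_fst.comp measurable_fst).inner (hm j)).norm.pow_const 2)
  exact real_le_of_forall_unit hlaw hq
    (B := {z | 6 * ε < |∑ j, ‖inner ℂ z.1.1 (beam z.1.2 z.2 j)‖ ^ 2 -
      (1 - ‖inner ℂ z.1.1 z.1.2‖ ^ 2) * ((Fintype.card J : ℝ) / n)|})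
    (measurableSet_lt measurable_const (by fun_prop)) (beamError_nonneg n η ε)
    fun v p hv hp => pi_sum_sq_inner_beam_tail hn hη hε hε4 hnε hgap hv hp

theorem real_sq_norm_inner_quantize_gt_le (hb : HasLaw b (codebookLaw n ι) P)
    (hq : ∀ᵐ ω ∂P, q ω = quantize (b ω).1 (b ω).2) {y : ℝ} (hy0 : 0 ≤ y) (hy1 : y < 1) :
    P.real {ω | y < ‖inner ℂ (b ω).1 (q ω)‖ ^ 2} ≤ Fintype.card ι * (1 - y) ^ (n - 1) := by
  have hqm := measurable_quantize (n := n) (ι := ι)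
  have hm : MeasurableSet {z : CVec n × (ι → CVec n) |
      y < ‖inner ℂ z.1 (quantize z.1 z.2)‖ ^ 2} :=
    measurableSet_lt measurable_const (by fun_prop)
  have h1 : P.real {ω | y < ‖inner ℂ (b ω).1 (q ω)‖ ^ 2} =
      P.real (b ⁻¹' {z | y < ‖inner ℂ z.1 (quantize z.1 z.2)‖ ^ 2}) := by
    refine measureReal_congr ?_
    filter_upwards [hq] with ω hω
    refine propext ?_
    change y < ‖inner ℂ (b ω).1 (q ω)‖ ^ 2 ↔
      y < ‖inner ℂ (b ω).1 (quantize (b ω).1 (b ω).2)‖ ^ 2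
    rw [hω]
  rw [h1, measureReal_preimage_of_hasLaw hb hm]
  exact codebookLaw_quantize_gt_le hy0 hy1

theorem real_sq_norm_inner_quantize_le_le (hb : HasLaw b (codebookLaw n ι) P)
    (hq : ∀ᵐ ω ∂P, q ω = quantize (b ω).1 (b ω).2) {y : ℝ} (hy0 : 0 ≤ y) (hy1 : y < 1) :
    P.real {ω | ‖inner ℂ (b ω).1 (q ω)‖ ^ 2 ≤ y} ≤
      Real.exp (-(Fintype.card ι * (1 - y) ^ (n - 1))) := by
  have hqm := measurable_quantize (n := n) (ι := ι)
  have hm : MeasurableSet {z : CVec n × (ι → CVec n) |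
      ‖inner ℂ z.1 (quantize z.1 z.2)‖ ^ 2 ≤ y} :=
    measurableSet_le (by fun_prop) measurable_const
  have h1 : P.real {ω | ‖inner ℂ (b ω).1 (q ω)‖ ^ 2 ≤ y} =
      P.real (b ⁻¹' {z | ‖inner ℂ z.1 (quantize z.1 z.2)‖ ^ 2 ≤ y}) := by
    refine measureReal_congr ?_
    filter_upwards [hq] with ω hω
    refine propext ?_
    change ‖inner ℂ (b ω).1 (q ω)‖ ^ 2 ≤ y ↔
      ‖inner ℂ (b ω).1 (quantize (b ω).1 (b ω).2)‖ ^ 2 ≤ y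
    rw [hω]
  rw [h1, measureReal_preimage_of_hasLaw hb hm]
  exact codebookLaw_quantize_le_le hy0 hy1

end ErrorProbabilities

/-! ### Summability and the Borel–Cantelli lemma -/

theorem exp_neg_le_div_pow_eight {y : ℝ} (hy : 0 < y) : Real.exp (-y) ≤ 40320 / y ^ 8 := by
  -- `40320 = 8!`
  have h := Real.pow_div_factorial_le_exp y hy.le 8
  have h8 : ((Nat.factorial 8 : ℕ) : ℝ) = 40320 := by norm_num [Nat.factorial]
  rw [h8] at h
  rw [Real.exp_neg, ← one_div, div_le_div_iff₀ (Real.exp_pos y) (by positivity)]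
  rw [div_le_iff₀ (by norm_num)] at h
  linarith

theorem summable_const_div_sq (C : ℝ) : Summable fun n : ℕ => C / (n : ℝ) ^ 2 := by
  simpa [div_eq_mul_inv] using (Real.summable_nat_pow_inv.2 one_lt_two).mul_left C

theorem summable_sq_mul_exp_neg_sqrt {c : ℝ} (hc : 0 < c) :
    Summable fun n : ℕ => (n : ℝ) ^ 2 * Real.exp (-(c * √n)) := by
  refine Summable.of_nonneg_of_le (fun n => by positivity) (fun n => ?_)
    (summable_const_div_sq (40320 / c ^ 8))
  rcases Nat.eq_zero_or_pos n with rfl | hn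
  · simp
  have hn' : (0 : ℝ) < n := by exact_mod_cast hn
  have h1 := exp_neg_le_div_pow_eight (y := c * √n) (by positivity)
  have h2 : (c * √n) ^ 8 = c ^ 8 * (n : ℝ) ^ 4 := by
    rw [mul_pow, show (√(n : ℝ)) ^ 8 = ((√(n : ℝ)) ^ 2) ^ 4 by ring, Real.sq_sqrt hn'.le]
  rw [h2] at h1
  calc (n : ℝ) ^ 2 * Real.exp (-(c * √n)) ≤ (n : ℝ) ^ 2 * (40320 / (c ^ 8 * (n : ℝ) ^ 4)) := by
        gcongr
    _ = 40320 / c ^ 8 / (n : ℝ) ^ 2 := by field_simp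

theorem summable_exp_neg_sqrt_sqrt {c : ℝ} (hc : 0 < c) :
    Summable fun n : ℕ => Real.exp (-(c * √(√n))) := by
  refine (summable_nat_add_iff 1).1 ?_
  refine Summable.of_nonneg_of_le (fun n => by positivity) (fun n => ?_)
    ((summable_nat_add_iff 1).2 (summable_const_div_sq (40320 / c ^ 8)))
  have hn' : (0 : ℝ) < (n + 1 : ℕ) := by positivity
  have h1 := exp_neg_le_div_pow_eight (y := c * √(√((n + 1 : ℕ) : ℝ))) (by positivity)
  have h2 : (c * √(√((n + 1 : ℕ) : ℝ))) ^ 8 = c ^ 8 * ((n + 1 : ℕ) : ℝ) ^ 2 := by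
    rw [mul_pow, show (√(√((n + 1 : ℕ) : ℝ))) ^ 8 = (((√(√((n + 1 : ℕ) : ℝ))) ^ 2) ^ 2) ^ 2 by ring,
      Real.sq_sqrt (Real.sqrt_nonneg _), Real.sq_sqrt hn'.le]
  rw [h2] at h1
  rwa [div_div]

theorem summable_exp_neg_sqrt {c : ℝ} (hc : 0 < c) :
    Summable fun n : ℕ => Real.exp (-(c * √n)) := by
  refine (summable_nat_add_iff 1).1 ?_
  refine Summable.of_nonneg_of_le (fun n => by positivity) (fun n => ?_)
    ((summable_nat_add_iff 1).2 (summable_sq_mul_exp_neg_sqrt hc))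
  refine le_mul_of_one_le_left (Real.exp_pos _).le (one_le_pow₀ ?_)
  push_cast
  linarith [(Nat.cast_nonneg n : (0 : ℝ) ≤ n)]

theorem summable_projError {η ε : ℝ} (hη : 0 < η) (hε : 0 < ε) :
    Summable fun n => projError n η ε := by
  unfold projError
  refine Summable.add ?_ ?_
  · refine ((summable_sq_mul_exp_neg_sqrt (c := η / 8) (by positivity)).mul_left 9).congr
      fun n => ?_
    rw [mul_assoc, show -(η / 8 * √(n : ℝ)) = -(η * √n) / 8 by ring]
  · refine ((summable_exp_neg_sqrt (c := ε / 2) (by positivity)).mul_left 8).congr fun n => ?_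
    rw [show -(ε / 2 * √(n : ℝ)) = -(ε * √n) / 2 by ring]

theorem summable_beamError {η ε : ℝ} (hη : 0 < η) (hε : 0 < ε) :
    Summable fun n => beamError n η ε := by
  unfold beamError
  refine Summable.add ?_ (Summable.add ?_ ?_)
  · refine ((summable_sq_mul_exp_neg_sqrt (c := η / 8) (by positivity)).mul_left 9).congr
      fun n => ?_
    rw [mul_assoc, show -(η / 8 * √(n : ℝ)) = -(η * √n) / 8 by ring]
  · refine ((summable_exp_neg_sqrt_sqrt (c := ε / (2 * √(2 / η))) (by positivity)).mul_left
      4).congr fun n => ?_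
    congr 3
    rcases Nat.eq_zero_or_pos n with rfl | hn
    · simp
    have hn' : (0 : ℝ) < n := by exact_mod_cast hn
    -- with `s = n ^ (1/4)`, both sides are `ε s / (2 √(2 / η))`
    have h1 : √(2 * ((n : ℝ) * √n) / η) = √(2 / η) * (√n * √(√n)) := by
      rw [show 2 * ((n : ℝ) * √n) / η = 2 / η * (n * √n) by ring, Real.sqrt_mul (by positivity),
        Real.sqrt_mul hn'.le]
    have h2 : (n : ℝ) = √(√n) * √(√n) * √n := by
      rw [Real.mul_self_sqrt (Real.sqrt_nonneg _), Real.mul_self_sqrt hn'.le]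
    have hs : 0 < √(√(n : ℝ)) := by positivity
    have hs' : 0 < √(n : ℝ) := by positivity
    have he : 0 < √(2 / η) := by positivity
    rw [h1, neg_div, neg_inj, div_mul_eq_mul_div, div_eq_div_iff (by positivity) (by positivity)]
    conv_rhs => rw [h2]
    ring
  · refine ((summable_exp_neg_sqrt (c := ε / 2) (by positivity)).mul_left 4).congr fun n => ?_
    rw [show -(ε / 2 * √(n : ℝ)) = -(ε * √n) / 2 by ring]

/-- The Borel–Cantelli lemma along the indices in `S`; the errors at different indices may depend on
each other in any way. -/
theorem ae_tendsto_zero_of_summable_tail {Ω : Type*} [MeasurableSpace Ω] {P : Measure Ω}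
    [IsProbabilityMeasure P] {S : Set ℕ} {e : ℕ → Ω → ℝ} (he : ∀ n ω, 0 ≤ e n ω)
    (h : ∀ ε > 0, ∃ f : ℕ → ℝ, Summable f ∧
      ∀ᶠ n in atTop, n ∈ S → P.real {ω | ε < e n ω} ≤ f n) :
    ∀ᵐ ω ∂P, Tendsto (fun n => e n ω) (atTop ⊓ 𝓟 S) (𝓝 0) := by
  have key : ∀ k : ℕ, ∀ᵐ ω ∂P, ∀ᶠ n in atTop, n ∈ S → e n ω ≤ 1 / ((k : ℝ) + 1) := by
    intro k
    obtain ⟨f, hf, hev⟩ := h (1 / ((k : ℝ) + 1)) (by positivity)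
    obtain ⟨n₀, hn₀⟩ := eventually_atTop.1 hev
    have hsum : ∑' n, P {ω | (n ∈ S ∧ n₀ ≤ n) ∧ 1 / ((k : ℝ) + 1) < e n ω} ≠ ∞ := by
      refine ne_top_of_le_ne_top hf.tsum_ofReal_ne_top (ENNReal.tsum_le_tsum fun n => ?_)
      by_cases hn : n ∈ S ∧ n₀ ≤ n
      · simp only [hn, and_self, true_and]
        rw [← ofReal_measureReal]
        exact ENNReal.ofReal_le_ofReal (hn₀ n hn.2 hn.1)
      · simp [hn]
    filter_upwards [ae_eventually_notMem hsum] with ω hω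
    filter_upwards [hω, eventually_ge_atTop n₀] with n hn hnn hnS
    by_contra hlt
    exact hn ⟨⟨hnS, hnn⟩, not_le.1 hlt⟩
  filter_upwards [ae_all_iff.2 key] with ω hω
  rw [Metric.tendsto_nhds]
  intro ε hε
  obtain ⟨k, hk⟩ := exists_nat_one_div_lt hε
  rw [eventually_inf_principal]
  filter_upwards [hω k] with n hn hnS
  rw [Real.dist_eq, sub_zero, abs_of_nonneg (he n ω)]
  exact (hn hnS).trans_lt hk

/-! ### The asymptotic regime -/

theorem two_rpow_div_pow (k : ℕ) {n : ℕ} (hn : n ≠ 0) :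
    ((2 : ℝ) ^ ((k : ℝ) / n)) ^ n = 2 ^ k := by
  rw [← Real.rpow_natCast, ← Real.rpow_mul (by norm_num),
    div_mul_cancel₀ _ (Nat.cast_ne_zero.2 hn), Real.rpow_natCast]

theorem tendsto_two_rpow_mul {R : ℕ → ℕ} {r : ℝ}
    (hR : Tendsto (fun n : ℕ => (R n : ℝ) / n) atTop (𝓝 r)) (a : ℝ) :
    Tendsto (fun n : ℕ => (2 : ℝ) ^ ((R n : ℝ) / n) * a) atTop (𝓝 (2 ^ r * a)) :=
  ((Real.continuous_const_rpow (by norm_num)).continuousAt.tendsto.comp hR).mul_const a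

/-- Above the threshold `1 - 2 ^ (-r)` the union bound over the codewords decays geometrically. -/
theorem summable_two_pow_mul_pow {R : ℕ → ℕ} {r : ℝ}
    (hR : Tendsto (fun n : ℕ => (R n : ℝ) / n) atTop (𝓝 r)) {y : ℝ}
    (hy : 1 - (2 : ℝ) ^ (-r) < y) (hy1 : y < 1) :
    Summable fun n => (2 : ℝ) ^ R n * (1 - y) ^ (n - 1) := by
  have ha : 0 < 1 - y := by linarith
  have hlt : (2 : ℝ) ^ r * (1 - y) < 1 := by
    calc (2 : ℝ) ^ r * (1 - y) < 2 ^ r * 2 ^ (-r) := by gcongr; linarith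
      _ = 1 := by rw [← Real.rpow_add (by norm_num)]; simp
  obtain ⟨q, hq1, hq2⟩ := exists_between hlt
  have hq0 : 0 < q := lt_trans (by positivity) hq1
  refine Summable.of_norm_bounded_eventually_nat
    ((summable_geometric_of_lt_one hq0.le hq2).mul_left (1 - y)⁻¹) ?_
  filter_upwards [(tendsto_two_rpow_mul hR (1 - y)).eventually_lt_const hq1,
    eventually_ge_atTop 1] with n hn hn1
  rw [Real.norm_of_nonneg (by positivity)]
  calc (2 : ℝ) ^ R n * (1 - y) ^ (n - 1)
      = (1 - y)⁻¹ * ((2 : ℝ) ^ ((R n : ℝ) / n) * (1 - y)) ^ n := by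
        rw [mul_pow, two_rpow_div_pow _ (by omega : n ≠ 0)]
        obtain ⟨k, rfl⟩ := Nat.exists_eq_add_of_le' hn1
        rw [Nat.add_sub_cancel, pow_succ]
        field_simp
    _ ≤ (1 - y)⁻¹ * q ^ n := by gcongr

/-- Below the threshold `1 - 2 ^ (-r)` the expected number of codewords that beat the level `y` grows
geometrically. -/
theorem summable_exp_neg_two_pow_mul_pow {R : ℕ → ℕ} {r : ℝ}
    (hR : Tendsto (fun n : ℕ => (R n : ℝ) / n) atTop (𝓝 r)) {y : ℝ}
    (hy : y < 1 - (2 : ℝ) ^ (-r)) (hy0 : 0 ≤ y) :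
    Summable fun n => Real.exp (-((2 : ℝ) ^ R n * (1 - y) ^ (n - 1))) := by
  have hpos : (0 : ℝ) < 2 ^ (-r) := by positivity
  have ha : 0 < 1 - y := by linarith
  have hlt : 1 < (2 : ℝ) ^ r * (1 - y) := by
    calc 1 = (2 : ℝ) ^ r * 2 ^ (-r) := by rw [← Real.rpow_add (by norm_num)]; simp
      _ < 2 ^ r * (1 - y) := by gcongr; linarith
  obtain ⟨q, hq1, hq2⟩ := exists_between hlt
  have hq0 : 0 < q := lt_trans one_pos hq1
  refine Summable.of_norm_bounded_eventually_nat
    (summable_geometric_of_lt_one (inv_nonneg.2 hq0.le) (inv_lt_one_of_one_lt₀ hq1)) ?_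
  filter_upwards [(tendsto_two_rpow_mul hR (1 - y)).eventually_const_lt hq2,
    eventually_ge_atTop 1] with n hn hn1
  have hle : q ^ n ≤ (2 : ℝ) ^ R n * (1 - y) ^ (n - 1) := by
    calc q ^ n ≤ ((2 : ℝ) ^ ((R n : ℝ) / n) * (1 - y)) ^ n := by gcongr
      _ = (2 : ℝ) ^ R n * (1 - y) ^ n := by
        rw [mul_pow, two_rpow_div_pow _ (by omega : n ≠ 0)]
      _ ≤ (2 : ℝ) ^ R n * (1 - y) ^ (n - 1) :=
        mul_le_mul_of_nonneg_left
          (pow_le_pow_of_le_one ha.le (by linarith) (Nat.sub_le n 1)) (by positivity)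
  have hqn : 0 < q ^ n := by positivity
  rw [Real.norm_of_nonneg (by positivity), inv_pow, Real.exp_neg]
  refine inv_anti₀ hqn (hle.trans ?_)
  linarith [Real.add_one_le_exp ((2 : ℝ) ^ R n * (1 - y) ^ (n - 1))]

/-- The normalised projection of `p` retains the fraction `1 - s` of the squared correlation. -/
theorem tendsto_sq_norm_div {l : Filter ℕ} {W K : ℕ → ℝ} {z y : ℕ → ℂ} {s t : ℝ} (hs : s < 1)
    (hK : Tendsto K l (𝓝 s)) (hW : Tendsto (fun n => |W n - (1 - K n)|) l (𝓝 0))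
    (hz : Tendsto (fun n => ‖z n - ((1 - K n : ℝ) : ℂ) * y n‖) l (𝓝 0))
    (hy : Tendsto (fun n => ‖y n‖ ^ 2) l (𝓝 t)) :
    Tendsto (fun n => ‖z n‖ ^ 2 / W n) l (𝓝 (t * (1 - s))) := by
  have hD : Tendsto (fun n => 1 - K n) l (𝓝 (1 - s)) := tendsto_const_nhds.sub hK
  have hW' : Tendsto W l (𝓝 (1 - s)) := by
    have := ((tendsto_zero_iff_abs_tendsto_zero _).2 hW).add hD
    simpa using this
  have hny : Tendsto (fun n => ‖y n‖) l (𝓝 √t) := by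
    have := (Real.continuous_sqrt.tendsto t).comp hy
    refine this.congr fun n => ?_
    simp
  have hnz : Tendsto (fun n => ‖z n‖) l (𝓝 ((1 - s) * √t)) := by
    have h1 : Tendsto (fun n => |1 - K n| * ‖y n‖) l (𝓝 ((1 - s) * √t)) := by
      have := hD.abs.mul hny
      rwa [abs_of_pos (by linarith : 0 < 1 - s)] at this
    have h2 : Tendsto (fun n => ‖z n‖ - |1 - K n| * ‖y n‖) l (𝓝 0) := by
      refine squeeze_zero_norm (fun n => ?_) hz
      have := abs_norm_sub_norm_le (z n) (((1 - K n : ℝ) : ℂ) * y n)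
      rwa [norm_mul, Complex.norm_real, Real.norm_eq_abs, ← Real.norm_eq_abs (‖z n‖ - _)] at this
    simpa using h2.add h1
  by_cases hl : l = ⊥
  · simp [hl]
  have : l.NeBot := ⟨hl⟩
  have ht : 0 ≤ t := ge_of_tendsto hy (Eventually.of_forall fun n => by positivity)
  have h1s : 1 - s ≠ 0 := by linarith
  have heq : ((1 - s) * √t) ^ 2 / (1 - s) = t * (1 - s) := by
    rw [mul_pow, Real.sq_sqrt ht]
    field_simp
  rw [← heq]
  exact (hnz.pow 2).div hW' h1s

theorem tendsto_userRate {l : Filter ℕ} {sig int : ℕ → ℝ} {ρ γ r s : ℝ} (hρ : 0 ≤ ρ) (hγ : 0 ≤ γ)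
    (hr : 0 ≤ r) (hs0 : 0 < s) (hs1 : s < 1)
    (hsig : Tendsto sig l (𝓝 (ρ / s * γ * (1 - (2 : ℝ) ^ (-r)) * (1 - s))))
    (hint : Tendsto int l (𝓝 (ρ * γ * (2 : ℝ) ^ (-r)))) :
    Tendsto (fun n => Real.logb 2 (1 + sig n / (1 + int n))) l
      (𝓝 (Real.logb 2 (1 + etaZF ρ γ r * ((1 - s) / s)))) := by
  have h2 : (0 : ℝ) < 2 ^ (-r) := by positivity
  have h2' : (2 : ℝ) ^ (-r) ≤ 1 := Real.rpow_le_one_of_one_le_of_nonpos (by norm_num) (by linarith)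
  have hden : 0 < 1 + ρ * γ * (2 : ℝ) ^ (-r) := by positivity
  have heta : 0 ≤ etaZF ρ γ r :=
    div_nonneg (mul_nonneg (by positivity) (by linarith)) hden.le
  have hpos : 0 < 1 + etaZF ρ γ r * ((1 - s) / s) := by
    have : 0 ≤ (1 - s) / s := div_nonneg (by linarith) hs0.le
    positivity
  have hlim := tendsto_const_nhds (x := (1 : ℝ)).add
    (hsig.div (tendsto_const_nhds (x := (1 : ℝ)).add hint) hden.ne')
  have heq : 1 + ρ / s * γ * (1 - (2 : ℝ) ^ (-r)) * (1 - s) / (1 + ρ * γ * (2 : ℝ) ^ (-r)) =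
      1 + etaZF ρ γ r * ((1 - s) / s) := by
    rw [etaZF]
    field_simp
  rw [heq] at hlim
  exact (Real.continuousAt_logb hpos.ne').tendsto.comp hlim

theorem mainTheorem2 {Ω : Type*} [MeasurableSpace Ω] (P : Measure Ω) [IsProbabilityMeasure P]
    -- total power and path losses
    (ρ : ℝ) (hρ : 0 ≤ ρ) (γ : ℕ → ℝ) (hγ : ∀ i, 0 ≤ γ i)
    -- for `L` antennas: `m L` users, the set `A L` of the `s L` on-users, `R L i` feedback bits
    (m s : ℕ → ℕ) (A : ℕ → Finset ℕ) (R : ℕ → ℕ → ℕ)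
    (hA : ∀ L, A L ⊆ Finset.range (m L)) (hcard : ∀ L, (A L).card = s L)
    -- the linear asymptotic regime
    (mbar sbar : ℝ) (rbar : ℕ → ℝ)
    (hm : Tendsto (fun L : ℕ => (m L : ℝ) / L) atTop (𝓝 mbar))
    (hs : Tendsto (fun L : ℕ => (s L : ℝ) / L) atTop (𝓝 sbar))
    (hR : ∀ i, Tendsto (fun L : ℕ => (R L i : ℝ) / L) atTop (𝓝 (rbar i)))
    (hs0 : 0 < sbar) (hs1 : sbar < 1)
    -- channel states `h`, codewords `c`, quantised channel states `p`
    (h : (L : ℕ) → ℕ → Ω → CVec L)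
    (c : (L i : ℕ) → Fin (2 ^ R L i) → Ω → CVec L)
    (p : (L : ℕ) → ℕ → Ω → CVec L)
    (hchannel : ∀ L, 1 ≤ L → ∀ i ∈ A L, IsRayleigh P (h L i))
    (hcode : ∀ L, 1 ≤ L → ∀ i ∈ A L, ∀ k, HasLaw (c L i k) (isotropicLaw L) P)
    -- for each `L`, the directions and the codewords of all on-users are mutually independent
    (hindep : ∀ L, 1 ≤ L →
      iIndepFun (Sum.elim
        (fun (i : {i // i ∈ A L}) (ω : Ω) => direction (h L i ω))
        (fun (y : Σ i : {i // i ∈ A L}, Fin (2 ^ R L i)) (ω : Ω) => c L y.1 y.2 ω)) P)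
    (hquant : ∀ L, 1 ≤ L → ∀ i ∈ A L, ∀ ω,
      IsQuantization (fun k => c L i k ω) (h L i ω) (p L i ω)) :
    -- limits for a user `i`, as `L → ∞` through those `L` for which user `i` is on
    ∀ i : ℕ, ∀ᵐ ω ∂P,
      Tendsto (fun L => signalPower ρ (γ i) (A L) (h L i ω) (fun j => p L j ω) i)
        (atTop ⊓ 𝓟 {L | i ∈ A L})
        (𝓝 (ρ / sbar * γ i * (1 - (2 : ℝ) ^ (-rbar i)) * (1 - sbar))) ∧
      Tendsto (fun L => interferencePower ρ (γ i) (A L) (h L i ω) (fun j => p L j ω) i)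
        (atTop ⊓ 𝓟 {L | i ∈ A L})
        (𝓝 (ρ * γ i * (2 : ℝ) ^ (-rbar i))) ∧
      Tendsto (fun L => userRate ρ (γ i) (A L) (h L i ω) (fun j => p L j ω) i)
        (atTop ⊓ 𝓟 {L | i ∈ A L})
        (𝓝 (Real.logb 2 (1 + etaZF ρ (γ i) (rbar i) * ((1 - sbar) / sbar)))) := by
  intro i
  set S : Set ℕ := {L | i ∈ A L} with hS
  set r := rbar i with hr
  set t : ℝ := 1 - (2 : ℝ) ^ (-r) with ht
  have hr0 : 0 ≤ r := ge_of_tendsto (hR i) (Eventually.of_forall fun L => by positivity)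
  have h2r : (0 : ℝ) < 2 ^ (-r) := by positivity
  have h2r' : (2 : ℝ) ^ (-r) ≤ 1 :=
    Real.rpow_le_one_of_one_le_of_nonpos (by norm_num) (by linarith)
  have ht0 : 0 ≤ t := by linarith
  have ht1 : t < 1 := by linarith
  -- the number of other on-users per antenna
  set K : ℕ → ℝ := fun L => (Fintype.card {j // j ∈ (A L).erase i} : ℝ) / L with hK
  have hKlim : Tendsto K atTop (𝓝 sbar) := by
    have hlow : Tendsto (fun L : ℕ => (s L : ℝ) / L - 1 / L) atTop (𝓝 sbar) := by
      simpa using hs.sub tendsto_one_div_atTop_nhds_zero_nat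
    refine tendsto_of_tendsto_of_tendsto_of_le_of_le hlow hs (fun L => ?_) fun L => ?_
    · have h1 := Finset.pred_card_le_card_erase (s := A L) (a := i)
      rw [hcard L] at h1
      have h2 : (s L : ℝ) ≤ ((A L).erase i).card + 1 := by exact_mod_cast Nat.sub_le_iff_le_add.1 h1
      simp only [hK, Fintype.card_coe]
      rw [← sub_div]
      gcongr
      linarith
    · have h1 := Finset.card_erase_le (s := A L) (a := i)
      rw [hcard L] at h1
      simp only [hK, Fintype.card_coe]
      gcongr
  -- the gap `1 - sbar` leaves a fixed share of the dimensions free after zero-forcing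
  set η : ℝ := (1 - sbar) / 4 with hη
  have hη0 : 0 < η := by rw [hη]; linarith
  have hgap : ∀ᶠ L in atTop, 2 * η ≤ 1 - K L := by
    filter_upwards [hKlim.eventually_lt_const (show sbar < (1 + sbar) / 2 by linarith)] with L hL
    rw [hη]
    linarith
  have hlaw : ∀ L, 2 ≤ L → i ∈ A L → _ ∧ _ := fun L hL hi =>
    haveI : NeZero L := ⟨by omega⟩
    hasLaw_codebook_quantized (P := P) hL (hchannel L (by omega)) (hcode L (by omega))
      (hindep L (by omega)) (hquant L (by omega)) hi
  -- the norm of the channel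
  have hnorm : ∀ᵐ ω ∂P, Tendsto (fun L : ℕ => |‖h L i ω‖ ^ 2 / L - 1|) (atTop ⊓ 𝓟 S) (𝓝 0) := by
    refine ae_tendsto_zero_of_summable_tail (fun L ω => abs_nonneg _) fun ε hε =>
      ⟨_, (summable_exp_neg_sqrt (c := ε / 2) (by positivity)).mul_left 4, ?_⟩
    filter_upwards [eventually_ge_atTop 2] with L hL hi
    have : NeZero L := ⟨by omega⟩
    have hL0 : (0 : ℝ) < L := by exact_mod_cast (by omega : 0 < L)
    have hm : MeasurableSet {g : CVec L | ε * L ≤ |‖g‖ ^ 2 - L|} :=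
      measurableSet_le measurable_const (by fun_prop)
    have h1 := measureReal_preimage_of_hasLaw (hchannel L (by omega) i hi).hasLaw hm
    have h2 := gaussianVec_norm_sq_tail (n := L) (ε * L)
    have hexp : -(ε * L) / (2 * √(L : ℝ)) = -(ε / 2 * √L) := by
      rw [div_eq_iff (by positivity)]
      nth_rw 1 [← Real.mul_self_sqrt hL0.le]
      ring
    rw [hexp, ← h1] at h2
    refine (measureReal_mono fun ω hω => ?_).trans h2
    rw [Set.mem_ofPred_eq] at hω
    rw [Set.mem_preimage, Set.mem_ofPred_eq]
    have h3 : ‖h L i ω‖ ^ 2 / L - 1 = (‖h L i ω‖ ^ 2 - L) / L := by field_simp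
    rw [h3, abs_div, abs_of_pos hL0, lt_div_iff₀ hL0] at hω
    exact hω.le
  -- the accuracy of the quantisation
  have hcorr : ∀ᵐ ω ∂P, Tendsto
      (fun L : ℕ => |‖inner ℂ (direction (h L i ω)) (p L i ω)‖ ^ 2 - t|)
      (atTop ⊓ 𝓟 S) (𝓝 0) := by
    refine ae_tendsto_zero_of_summable_tail (fun L ω => abs_nonneg _) fun ε hε => ?_
    -- thresholds in `[0, 1)` on both sides of `t`
    obtain ⟨y, hty, hy⟩ := exists_between (lt_min (show t < t + ε by linarith) ht1)
    have hsum1 := summable_two_pow_mul_pow (hR i) hty (hy.trans_le (min_le_right _ _))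
    have hbound1 : ∀ L, 2 ≤ L → i ∈ A L →
        P.real {ω | y < ‖inner ℂ (direction (h L i ω)) (p L i ω)‖ ^ 2} ≤
          (2 : ℝ) ^ R L i * (1 - y) ^ (L - 1) := by
      intro L hL hi
      have : NeZero L := ⟨by omega⟩
      obtain ⟨h1, h2⟩ := hlaw L hL hi
      have h3 := real_sq_norm_inner_quantize_gt_le (measurePreserving_fst.comp_hasLaw h1) h2
        (ht0.trans hty.le) (hy.trans_le (min_le_right _ _))
      simpa only [Function.comp_apply, Fintype.card_fin, Nat.cast_pow, Nat.cast_ofNat] using h3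
    rcases ht0.eq_or_lt with ht0' | ht0'
    · refine ⟨_, hsum1, ?_⟩
      filter_upwards [eventually_ge_atTop 2] with L hL hi
      refine (measureReal_mono fun ω hω => ?_).trans (hbound1 L hL hi)
      rw [Set.mem_ofPred_eq] at hω ⊢
      rw [← ht0', sub_zero, abs_of_nonneg (sq_nonneg _)] at hω
      have := hy.trans_le (min_le_left _ _)
      linarith
    · have hxt : max (t - ε) 0 < t := max_lt (by linarith) ht0'
      have hsum2 := summable_exp_neg_two_pow_mul_pow (hR i) hxt (le_max_right _ _)
      refine ⟨_, hsum1.add hsum2, ?_⟩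
      filter_upwards [eventually_ge_atTop 2] with L hL hi
      have hbound2 : P.real {ω | ‖inner ℂ (direction (h L i ω)) (p L i ω)‖ ^ 2 ≤ max (t - ε) 0} ≤
          Real.exp (-((2 : ℝ) ^ R L i * (1 - max (t - ε) 0) ^ (L - 1))) := by
        have : NeZero L := ⟨by omega⟩
        obtain ⟨h1, h2⟩ := hlaw L hL hi
        have h3 := real_sq_norm_inner_quantize_le_le (measurePreserving_fst.comp_hasLaw h1) h2
          (le_max_right (t - ε) 0) (hxt.trans ht1)
        simpa only [Function.comp_apply, Fintype.card_fin, Nat.cast_pow, Nat.cast_ofNat] using h3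
      refine le_trans ((measureReal_mono fun ω hω => ?_).trans (measureReal_union_le _ _))
        (add_le_add (hbound1 L hL hi) hbound2)
      rw [Set.mem_ofPred_eq, lt_abs] at hω
      rw [Set.mem_union, Set.mem_ofPred_eq, Set.mem_ofPred_eq]
      rcases hω with hω | hω
      · left
        have := hy.trans_le (min_le_left _ _)
        linarith
      · right
        exact le_trans (by linarith) (le_max_left _ _)
  -- the projections onto the orthogonal complement of the other quantised channels
  have hproj : ∀ᵐ ω ∂P, Tendsto (fun L : ℕ =>
      |‖perpProj (Set.range fun j : {j // j ∈ (A L).erase i} => p L j ω) (p L i ω)‖ ^ 2 -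
        (1 - K L)|) (atTop ⊓ 𝓟 S) (𝓝 0) := by
    refine ae_tendsto_zero_of_summable_tail (fun L ω => abs_nonneg _) fun ε hε =>
      ⟨_, summable_projError hη0 (show 0 < ε / 4 by positivity), ?_⟩
    filter_upwards [eventually_ge_atTop 2, hgap] with L hL hLgap hi
    have : NeZero L := ⟨by omega⟩
    obtain ⟨h1, h2⟩ := hlaw L hL hi
    have h3 := real_sq_norm_perpProj_tail h1 h2 hL hη0 (show 0 < ε / 4 by positivity) hLgap
    rwa [show 4 * (ε / 4) = ε by ring] at h3
  have hinner : ∀ᵐ ω ∂P, Tendsto (fun L : ℕ =>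
      ‖inner ℂ (direction (h L i ω))
        (perpProj (Set.range fun j : {j // j ∈ (A L).erase i} => p L j ω) (p L i ω)) -
        ((1 - K L : ℝ) : ℂ) * inner ℂ (direction (h L i ω)) (p L i ω)‖)
      (atTop ⊓ 𝓟 S) (𝓝 0) := by
    refine ae_tendsto_zero_of_summable_tail (fun L ω => norm_nonneg _) fun ε hε =>
      ⟨_, (summable_projError hη0 (show 0 < ε / 16 by positivity)).mul_left 4, ?_⟩
    filter_upwards [eventually_ge_atTop 2, hgap] with L hL hLgap hi
    have : NeZero L := ⟨by omega⟩
    obtain ⟨h1, h2⟩ := hlaw L hL hi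
    have h3 := real_inner_perpProj_tail h1 h2 hL hη0 (show 0 < ε / 16 by positivity) hLgap
    rwa [show 16 * (ε / 16) = ε by ring] at h3
  -- the beams of the other users
  have hbeams : ∀ᵐ ω ∂P, Tendsto (fun L : ℕ =>
      |∑ j : {j // j ∈ (A L).erase i}, ‖inner ℂ (direction (h L i ω))
        (beam (p L i ω) (fun k : {k // k ∈ (A L).erase i} => p L k ω) j)‖ ^ 2 -
        (1 - ‖inner ℂ (direction (h L i ω)) (p L i ω)‖ ^ 2) * K L|)
      (atTop ⊓ 𝓟 S) (𝓝 0) := by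
    refine ae_tendsto_zero_of_summable_tail (fun L ω => abs_nonneg _) fun ε hε => ?_
    have hδ : 0 < min (ε / 6) (1 / 4) := lt_min (by positivity) (by norm_num)
    refine ⟨_, summable_beamError hη0 hδ, ?_⟩
    have hlarge : ∀ᶠ L : ℕ in atTop, 1 / min (ε / 6) (1 / 4) ≤ (L : ℝ) :=
      tendsto_natCast_atTop_atTop.eventually_ge_atTop _
    filter_upwards [eventually_ge_atTop 2, hgap, hlarge] with L hL hLgap hLε hi
    have : NeZero L := ⟨by omega⟩
    obtain ⟨h1, h2⟩ := hlaw L hL hi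
    rw [div_le_iff₀' hδ] at hLε
    have h3 := real_sum_sq_inner_beam_tail h1 h2 hL hη0 hδ (min_le_right _ _) hLε hLgap
    refine (measureReal_mono fun ω hω => ?_).trans h3
    rw [Set.mem_ofPred_eq] at hω ⊢
    exact lt_of_le_of_lt (by linarith [min_le_left (ε / 6) (1 / 4)]) hω
  filter_upwards [hnorm, hcorr, hproj, hinner, hbeams] with ω hnω hcω hpω hiω hbω
  have hle : atTop ⊓ 𝓟 S ≤ (atTop : Filter ℕ) := inf_le_left
  have hK' := hKlim.mono_left hle
  have hcω' : Tendsto (fun L : ℕ => ‖inner ℂ (direction (h L i ω)) (p L i ω)‖ ^ 2)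
      (atTop ⊓ 𝓟 S) (𝓝 t) := by
    simpa using ((tendsto_zero_iff_abs_tendsto_zero _).2 hcω).add_const t
  -- the common factor `ρ γ (‖h‖² / L) / (s / L)`
  have hfac : Tendsto (fun L : ℕ => ρ / ((A L).card : ℝ) * γ i * ‖h L i ω‖ ^ 2)
      (atTop ⊓ 𝓟 S) (𝓝 (ρ / sbar * γ i)) := by
    have hnω' : Tendsto (fun L : ℕ => ‖h L i ω‖ ^ 2 / L) (atTop ⊓ 𝓟 S) (𝓝 1) := by
      simpa using ((tendsto_zero_iff_abs_tendsto_zero _).2 hnω).add_const 1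
    have h1 := ((tendsto_const_nhds (x := ρ)).div (hs.mono_left hle) hs0.ne').mul_const (γ i)
    have h2 := h1.mul hnω'
    rw [mul_one] at h2
    refine h2.congr' ?_
    filter_upwards [hle (eventually_ge_atTop 1)] with L hL
    have hL0 : (L : ℝ) ≠ 0 := by exact_mod_cast (by omega : L ≠ 0)
    rw [hcard L]
    rcases eq_or_ne (s L : ℝ) 0 with h0 | h0
    · simp [h0]
    · simp only [Pi.div_apply]
      field_simp
  have hsig : Tendsto (fun L => signalPower ρ (γ i) (A L) (h L i ω) (fun j => p L j ω) i)
      (atTop ⊓ 𝓟 S) (𝓝 (ρ / sbar * γ i * t * (1 - sbar))) := by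
    have h1 := hfac.mul (tendsto_sq_norm_div hs1 hK' hpω hiω hcω')
    rw [← mul_assoc] at h1
    refine h1.congr fun L => ?_
    rw [signalPower_eq]
    ring
  have hint : Tendsto (fun L => interferencePower ρ (γ i) (A L) (h L i ω) (fun j => p L j ω) i)
      (atTop ⊓ 𝓟 S) (𝓝 (ρ * γ i * (2 : ℝ) ^ (-r))) := by
    have h1 := ((tendsto_zero_iff_abs_tendsto_zero _).2 hbω).add
      (((tendsto_const_nhds (x := (1 : ℝ))).sub hcω').mul hK')
    have h2 := hfac.mul h1
    have heq : ρ / sbar * γ i * (0 + (1 - t) * sbar) = ρ * γ i * (2 : ℝ) ^ (-r) := by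
      rw [ht]
      field_simp
      ring
    rw [heq] at h2
    refine h2.congr' ?_
    filter_upwards [mem_inf_of_right (mem_principal_self S)] with L hL
    rw [interferencePower_eq _ _ _ hL]
    ring
  exact ⟨hsig, hint, tendsto_userRate hρ (hγ i) hr0 hs0 hs1 hsig hint⟩
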